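/- **Conventions.** A Cantor space is a nonempty compact metrizable totally disconnected space without isolated points. If $R$, $S$ are relations on sets $X$, $Y$, a surjection $\varphi:X\to Y$ *maps $R$ to $S$* if $(\varphi\times\varphi)(R)=S$; a map $T:X\to X$ is regarded as the relation given by its graph. For $m\ge 1$ let $\Theta_m=\mathbb Z/m\mathbb Z$ and let $\Theta=\varprojlim\Theta_m$ be the inverse limit over the positive integers ordered by divisibility, a topological ring containing $\mathbb Z$. Let $\mathbb Z_*=\mathbb Z\cup\{\pm\infty\}$. **The Special Homeomorphism.** Let $C\subset[0,1]$ be the classical Cantor set, and let $D\subset[0,1]$ be the set of points having a ternary expansion $.a_0a_1a_2\dots$ such that the smallest index $i$ with $a_i=1$, if there is one, is even. Let $\mathcal J$ be the set of components $j=(j_-,j_+)$ of $D\setminus C$. For each $j\in\mathcal J$ put $q(j,x)=j_-+(j_+-j_-)\,\frac{2^x}{1+2^x}$ $(x\in\mathbb Z)$, a strictly increasing sequence in $j$ converging to $j_\pm$ as $x\to\pm\infty$. Let $$Z(D,C)=(C\times\Theta)\ \cup\ \{(q(j,x),x): j\in\mathcal J,\ x\in\mathbb Z\}\ \subset\ \mathbb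 R\times\Theta ,$$ with the subspace topology, and let $\tau_{(D,C)}$ be the homeomorphism of $Z(D,C)$ given by $(a,t)\mapsto(a,t+1)$ for $a\in C$ and $(q(j,x),x)\mapsto(q(j,x+1),x+1)$. Let $X(D,C)=Z(D,C)\times C$ and $T(D,C)=\tau_{(D,C)}\times 1_C$. **The finite spiral relations.** For $n\ge0$ let $\tilde\Sigma_n=\{(x,t)\in\mathbb Z_*\times\Theta_{n!}: x=\pm\infty,\text{ or }x\in\mathbb Z\text{ and }t=x \bmod n!\}$, with the translation $\tau(x,t)=(x+1,t+1)$, where $\pm\infty+1=\pm\infty$. Let $\Sigma_n$ be the finite quotient of $\tilde\Sigma_n$ obtained by identifying $(x,t)$ with $(+\infty,t)$ for all $x\ge n$ and with $(-\infty,t)$ for all $x\le -n$, and let $R_n$ be the image of (the graph of) $\tau$ in $\Sigma_n\times\Sigma_n$. Let $\xi_M:\Sigma_{n+1}\to\Sigma_n$ be the canonical projection, and let $\xi_L$ and $\xi_R:\Sigma_{n+1}\to\Sigma_n$ send the class of $(x,t)$ to the class of $(-\infty,t \bmod n!)$ and of $(+\infty,t\bmod n!)$ respectively. Let $B_n$ be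 the set of words of length $n$ in the six letters $L_1,L_2,M_1,M_2,R_1,R_2$, let $\mathcal W_n=B_n\times\Sigma_n$ (finite and discrete), and let $R_n$ also denote the relation on $\mathcal W_n$ given by $R_n$ on each $\{\omega\}\times\Sigma_n$. Define $\xi:\mathcal W_{n+1}\to\mathcal W_n$ by $\xi(\omega K_\alpha,s)=(\omega,\xi_K(s))$ for $K\in\{L,M,R\}$, $\alpha\in\{1,2\}$, and write $\xi:\mathcal W_{n+k}\to\mathcal W_n$ for the compositions. Let $\mathcal W_\infty$ be the inverse limit of the $\mathcal W_n$ and let $R_\infty$ be the relation on $\mathcal W_\infty$ that holds between $(u_n)_n$ and $(v_n)_n$ when $(u_n,v_n)\in R_n$ for all $n$. **Lifting Property.** A homeomorphism $T:X\to X$ of a Cantor space with metric $d$ has the Lifting Property if, for every $n\ge0$, every continuous surjection $\varphi:X\to\mathcal W_n$ which maps $T$ to $R_n$, and every $\varepsilon>0$, there are an integer $k\ge1$ and a continuous surjection $\rho:X\to\mathcal W_{n+k}$ which maps $T$ to $R_{n+k}$, such that every fibre of $\rho$ has diameter at most $\varepsilon$ and $\varphi=\xi\circ\rho$. **Statement.**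 A homeomorphism $T$ of a Cantor space $X$ (with any metric $d$ inducing its topology) has the Lifting Property if and only if there is a homeomorphism $H:X\to X(D,C)$ with $H\circ T=T(D,C)\circ H$. Moreover $X(D,C)$ is a Cantor space, and $(X(D,C),T(D,C))$ is isomorphic to $(\mathcal W_\infty,R_\infty)$: there is a homeomorphism $X(D,C)\to\mathcal W_\infty$ which maps $T(D,C)$ to $R_\infty$. -/

import Mathlib

open Set Topology

namespace GenericHomeo

/-! ## Cantor spaces and maps of relations -/

/-- A Cantor space: a nonempty, compact, metrizable, totally disconnected space without
isolated points. -/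
structure IsCantorSpace (X : Type*) [TopologicalSpace X] : Prop where
  nonempty : Nonempty X
  compact : CompactSpace X
  metrizable : TopologicalSpace.MetrizableSpace X
  totallyDisconnected : TotallyDisconnectedSpace X
  perfect : PerfectSpace X

/-- The graph of a map, as a relation. -/
def graphRel {X : Type*} (T : X → X) : X → X → Prop := fun x y => T x = y

/-- `φ` maps the relation `R` to the relation `S`: `φ` is surjective and `(φ × φ)(R) = S`. -/
def MapsRel {X Y : Type*} (φ : X → Y) (R : X → X → Prop) (S : Y → Y → Prop) : Prop :=
  Function.Surjective φ ∧ ∀ a b, S a b ↔ ∃ x y, R x y ∧ φ x = a ∧ φ y = b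

/-! ## The universal adding machine -/

/-- The topological ring `Θ`, the inverse limit of the finite rings `ℤ/m` (`m ≥ 1`) ordered by
divisibility, as a subring of their product (with the product of the discrete topologies). -/
def Theta : Subring ((m : ℕ+) → ZMod m) where
  carrier := {t | ∀ m n : ℕ+, ∀ h : (m : ℕ) ∣ n, ZMod.castHom h (ZMod m) (t n) = t m}
  mul_mem' := by
    intro a b ha hb m n h
    simp only [Pi.mul_apply, map_mul, ha m n h, hb m n h]
  one_mem' := by intro m n h; simp only [Pi.one_apply, map_one]
  add_mem' := by
    intro a b ha hb m n h
    simp only [Pi.add_apply, map_add, ha m n h, hb m n h]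
  zero_mem' := by intro m n h; simp only [Pi.zero_apply, map_zero]
  neg_mem' := by
    intro a ha m n h
    simp only [Pi.neg_apply, map_neg, ha m n h]

/-! ## The space of spirals `Z(A, A₀)` -/

/-- The open intervals `j = (j₋, j₊)` which are the components of `A \ A₀`, recorded by their
pairs of endpoints: the endpoints belong to `A₀`, and the interval lies in `A` and misses `A₀`. -/
def gaps (A A₀ : Set ℝ) : Set (ℝ × ℝ) :=
  {j | j.1 < j.2 ∧ j.1 ∈ A₀ ∧ j.2 ∈ A₀ ∧ Ioo j.1 j.2 ⊆ A \ A₀}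

/-- The point `q(j, x)`: for fixed `j` this is a strictly increasing sequence in the open interval
`j`, which tends to the endpoints `j₋`, `j₊` as `x → -∞`, `x → +∞`. -/
noncomputable def qPoint (j : ℝ × ℝ) (x : ℤ) : ℝ :=
  j.1 + (j.2 - j.1) * ((2 : ℝ) ^ x / (1 + (2 : ℝ) ^ x))

/-- The space of spirals `Z(A, A₀)`, realised in `ℝ × Θ` by the embedding `q × ζ`. It consists of
the adding machines `{a} × Θ` (`a ∈ A₀`) and, for every component `j` of `A \ A₀` and `x : ℤ`, of
the wandering point `(q(j, x), x)`. The two ends `{±∞} × Θ` of the spiral over `j` are the adding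
machines `{j₋} × Θ` and `{j₊} × Θ`. The topology is the subspace topology. -/
def SpiralSpace (A A₀ : Set ℝ) : Set (ℝ × Theta) :=
  {p | p.1 ∈ A₀ ∨ ∃ j ∈ gaps A A₀, ∃ x : ℤ, p = (qPoint j x, (x : Theta))}

/-- The map of `ℝ` that is given by `g`, rescaled from `(0,1)` to `j`, on each component `j` of
`A \ A₀`, and is the identity elsewhere. -/
noncomputable def gapMap (A A₀ : Set ℝ) (g : ℝ → ℝ) (a : ℝ) : ℝ :=
  open Classical in
  if h : ∃ j ∈ gaps A A₀, a ∈ Ioo j.1 j.2 then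
    h.choose.1 + (h.choose.2 - h.choose.1) *
      g ((a - h.choose.1) / (h.choose.2 - h.choose.1))
  else a

theorem gaps_unique {A A₀ : Set ℝ} {j k : ℝ × ℝ} (hj : j ∈ gaps A A₀) (hk : k ∈ gaps A A₀)
    {a : ℝ} (haj : a ∈ Ioo j.1 j.2) (hak : a ∈ Ioo k.1 k.2) : j = k := by
  obtain ⟨hj0, hj1, hj2, hj3⟩ := hj
  obtain ⟨hk0, hk1, hk2, hk3⟩ := hk
  have e1 : ¬ j.1 < k.1 := fun h => (hj3 ⟨h, hak.1.trans haj.2⟩).2 hk1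
  have e2 : ¬ k.1 < j.1 := fun h => (hk3 ⟨h, haj.1.trans hak.2⟩).2 hj1
  have e3 : ¬ j.2 < k.2 := fun h => (hk3 ⟨hak.1.trans haj.2, h⟩).2 hj2
  have e4 : ¬ k.2 < j.2 := fun h => (hj3 ⟨haj.1.trans hak.2, h⟩).2 hk2
  exact Prod.ext (le_antisymm (not_lt.1 e2) (not_lt.1 e1))
    (le_antisymm (not_lt.1 e4) (not_lt.1 e3))

theorem gapMap_of_mem {A A₀ : Set ℝ} {g : ℝ → ℝ} {j : ℝ × ℝ} (hj : j ∈ gaps A A₀) {a : ℝ}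
    (ha : a ∈ Ioo j.1 j.2) :
    gapMap A A₀ g a = j.1 + (j.2 - j.1) * g ((a - j.1) / (j.2 - j.1)) := by
  have h : ∃ j ∈ gaps A A₀, a ∈ Ioo j.1 j.2 := ⟨j, hj, ha⟩
  have e : h.choose = j := gaps_unique h.choose_spec.1 hj h.choose_spec.2 ha
  unfold gapMap
  rw [dif_pos h, e]

theorem gapMap_of_not {A A₀ : Set ℝ} {g : ℝ → ℝ} {a : ℝ}
    (ha : ¬ ∃ j ∈ gaps A A₀, a ∈ Ioo j.1 j.2) : gapMap A A₀ g a = a := by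
  unfold gapMap
  rw [dif_neg ha]

theorem gapMap_of_base {A A₀ : Set ℝ} {g : ℝ → ℝ} {a : ℝ} (ha : a ∈ A₀) :
    gapMap A A₀ g a = a :=
  gapMap_of_not fun ⟨_, hj, haj⟩ => (hj.2.2.2 haj).2 ha

theorem unscale_mem {j : ℝ × ℝ} {a : ℝ} (ha : a ∈ Ioo j.1 j.2) :
    (a - j.1) / (j.2 - j.1) ∈ Ioo (0 : ℝ) 1 := by
  have h : 0 < j.2 - j.1 := by linarith [ha.1, ha.2]
  refine ⟨div_pos (by linarith [ha.1]) h, ?_⟩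
  rw [div_lt_one h]
  linarith [ha.2]

theorem scale_mem {j : ℝ × ℝ} (hj : j.1 < j.2) {y : ℝ} (hy : y ∈ Ioo (0 : ℝ) 1) :
    j.1 + (j.2 - j.1) * y ∈ Ioo j.1 j.2 := by
  obtain ⟨h0, h1⟩ := hy
  constructor <;> nlinarith

theorem gapMap_mem {A A₀ : Set ℝ} {g : ℝ → ℝ} (hg : ∀ y ∈ Ioo (0 : ℝ) 1, g y ∈ Ioo (0 : ℝ) 1)
    {j : ℝ × ℝ} (hj : j ∈ gaps A A₀) {a : ℝ} (ha : a ∈ Ioo j.1 j.2) :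
    gapMap A A₀ g a ∈ Ioo j.1 j.2 := by
  rw [gapMap_of_mem hj ha]
  exact scale_mem hj.1 (hg _ (unscale_mem ha))

theorem gapMap_leftInverse {A A₀ : Set ℝ} {g g' : ℝ → ℝ}
    (hg : ∀ y ∈ Ioo (0 : ℝ) 1, g y ∈ Ioo (0 : ℝ) 1)
    (hgg : ∀ y ∈ Ioo (0 : ℝ) 1, g' (g y) = y) (a : ℝ) :
    gapMap A A₀ g' (gapMap A A₀ g a) = a := by
  by_cases h : ∃ j ∈ gaps A A₀, a ∈ Ioo j.1 j.2
  · obtain ⟨j, hj, ha⟩ := h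
    have hne : j.2 - j.1 ≠ 0 := by linarith [hj.1]
    rw [gapMap_of_mem hj (gapMap_mem hg hj ha), gapMap_of_mem hj ha, add_sub_cancel_left,
      mul_div_cancel_left₀ _ hne, hgg _ (unscale_mem ha), mul_div_cancel₀ _ hne]
    ring
  · rw [gapMap_of_not h, gapMap_of_not h]

theorem gapMap_strictMono {A A₀ : Set ℝ} {g : ℝ → ℝ}
    (hg : ∀ y ∈ Ioo (0 : ℝ) 1, g y ∈ Ioo (0 : ℝ) 1)
    (hm : StrictMonoOn g (Ioo (0 : ℝ) 1)) : StrictMono (gapMap A A₀ g) := by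
  intro a b hab
  by_cases h : ∃ j ∈ gaps A A₀, a ∈ Ioo j.1 j.2
  · obtain ⟨j, hj, ha⟩ := h
    have h1 := gapMap_mem hg hj ha
    by_cases hbj : b < j.2
    · have hb : b ∈ Ioo j.1 j.2 := ⟨ha.1.trans hab, hbj⟩
      rw [gapMap_of_mem hj ha, gapMap_of_mem hj hb]
      have hpos : 0 < j.2 - j.1 := by linarith [hj.1]
      have h2 := hm (unscale_mem ha) (unscale_mem hb)
        (div_lt_div_of_pos_right (by linarith) hpos)
      have h3 := mul_lt_mul_of_pos_left h2 hpos
      linarith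
    · refine h1.2.trans_le ?_
      by_cases h' : ∃ k ∈ gaps A A₀, b ∈ Ioo k.1 k.2
      · obtain ⟨k, hk, hb⟩ := h'
        have h2 := gapMap_mem hg hk hb
        have : ¬ k.1 < j.2 := fun hlt => (hk.2.2.2 ⟨hlt, (not_lt.1 hbj).trans_lt hb.2⟩).2 hj.2.2.1
        linarith [h2.1]
      · rw [gapMap_of_not h']
        exact not_lt.1 hbj
  · rw [gapMap_of_not h]
    by_cases h' : ∃ k ∈ gaps A A₀, b ∈ Ioo k.1 k.2
    · obtain ⟨k, hk, hb⟩ := h'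
      have h2 := gapMap_mem hg hk hb
      have : ¬ k.1 < a := fun hlt => h ⟨k, hk, hlt, hab.trans hb.2⟩
      linarith [h2.1]
    · rw [gapMap_of_not h']
      exact hab

/-- The homeomorphism of `(0,1)` with `2^x / (1 + 2^x) ↦ 2^(x+1) / (1 + 2^(x+1))`. -/
noncomputable def stepUp (y : ℝ) : ℝ := 2 * y / (1 + y)

/-- The inverse of `stepUp`. -/
noncomputable def stepDown (y : ℝ) : ℝ := y / (2 - y)

theorem stepUp_mem : ∀ y ∈ Ioo (0 : ℝ) 1, stepUp y ∈ Ioo (0 : ℝ) 1 := by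
  rintro y ⟨h0, h1⟩
  refine ⟨by unfold stepUp; positivity, ?_⟩
  unfold stepUp
  rw [div_lt_one (by linarith)]
  linarith

theorem stepDown_mem : ∀ y ∈ Ioo (0 : ℝ) 1, stepDown y ∈ Ioo (0 : ℝ) 1 := by
  rintro y ⟨h0, h1⟩
  refine ⟨div_pos h0 (by linarith), ?_⟩
  unfold stepDown
  rw [div_lt_one (by linarith)]
  linarith

theorem stepDown_stepUp : ∀ y ∈ Ioo (0 : ℝ) 1, stepDown (stepUp y) = y := by
  rintro y ⟨h0, h1⟩
  have : (1 : ℝ) + y ≠ 0 := by linarith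
  have e : 2 - 2 * y / (1 + y) = 2 / (1 + y) := by field_simp; ring
  unfold stepDown stepUp
  rw [e]
  field_simp

theorem stepUp_stepDown : ∀ y ∈ Ioo (0 : ℝ) 1, stepUp (stepDown y) = y := by
  rintro y ⟨h0, h1⟩
  have : (2 : ℝ) - y ≠ 0 := by linarith
  have e : 1 + y / (2 - y) = 2 / (2 - y) := by field_simp; ring
  unfold stepDown stepUp
  rw [e]
  field_simp

theorem stepUp_strictMonoOn : StrictMonoOn stepUp (Ioo (0 : ℝ) 1) := by
  rintro y ⟨hy0, _⟩ z ⟨hz0, _⟩ hyz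
  unfold stepUp
  rw [div_lt_div_iff₀ (by linarith) (by linarith)]
  nlinarith

/-- The homeomorphism of `ℝ` that fixes `A₀` and moves every `q(j, x)` to `q(j, x + 1)`. -/
noncomputable def gapShift (A A₀ : Set ℝ) : ℝ ≃ₜ ℝ :=
  (StrictMono.orderIsoOfRightInverse (gapMap A A₀ stepUp)
    (gapMap_strictMono stepUp_mem stepUp_strictMonoOn) (gapMap A A₀ stepDown)
    (gapMap_leftInverse stepDown_mem stepUp_stepDown)).toHomeomorph

theorem gapShift_base {A A₀ : Set ℝ} {a : ℝ} (ha : a ∈ A₀) : gapShift A A₀ a = a :=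
  gapMap_of_base ha

theorem qPoint_mem {j : ℝ × ℝ} (hj : j.1 < j.2) (x : ℤ) : qPoint j x ∈ Ioo j.1 j.2 := by
  have h : (0 : ℝ) < 2 ^ x := by positivity
  refine scale_mem hj ⟨by positivity, ?_⟩
  rw [div_lt_one (by linarith)]
  linarith

theorem gapShift_qPoint {A A₀ : Set ℝ} {j : ℝ × ℝ} (hj : j ∈ gaps A A₀) (x : ℤ) :
    gapShift A A₀ (qPoint j x) = qPoint j (x + 1) := by
  have h : (0 : ℝ) < 2 ^ x := by positivity
  have hne : j.2 - j.1 ≠ 0 := by linarith [hj.1]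
  have e : gapShift A A₀ (qPoint j x) = gapMap A A₀ stepUp (qPoint j x) := rfl
  rw [e, gapMap_of_mem hj (qPoint_mem hj.1 x)]
  unfold qPoint stepUp
  rw [add_sub_cancel_left, mul_div_cancel_left₀ _ hne, zpow_add₀ (by norm_num), zpow_one]
  congr 2
  field_simp
  ring

theorem shift_mem_iff (A A₀ : Set ℝ) (p : ℝ × Theta) :
    p ∈ SpiralSpace A A₀ ↔
      ((gapShift A A₀).prodCongr (Homeomorph.addRight (1 : Theta))) p ∈ SpiralSpace A A₀ := by
  obtain ⟨a, t⟩ := p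
  change (a, t) ∈ SpiralSpace A A₀ ↔ (gapShift A A₀ a, t + 1) ∈ SpiralSpace A A₀
  constructor
  · rintro (h | ⟨j, hj, x, h⟩)
    · left
      change gapShift A A₀ a ∈ A₀
      rw [gapShift_base h]
      exact h
    · right
      obtain ⟨rfl, rfl⟩ := Prod.mk.inj h
      exact ⟨j, hj, x + 1, by rw [gapShift_qPoint hj]; push_cast; rfl⟩
  · rintro (h | ⟨j, hj, x, h⟩)
    · left
      change gapShift A A₀ a ∈ A₀ at h
      have := (gapShift A A₀).injective (gapShift_base h)
      rwa [this] at h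
    · right
      obtain ⟨h1, h2⟩ := Prod.mk.inj h
      refine ⟨j, hj, x - 1, Prod.ext ?_ ?_⟩
      · apply (gapShift A A₀).injective
        change gapShift A A₀ a = gapShift A A₀ (qPoint j (x - 1))
        rw [gapShift_qPoint hj, h1, sub_add_cancel]
      · change t = ((x - 1 : ℤ) : Theta)
        push_cast
        rw [← h2, add_sub_cancel_right]

/-- The homeomorphism `τ_(A, A₀)` of the space of spirals: it translates each adding machine
`{a} × Θ` by `1` and moves each wandering point `(q(j, x), x)` to `(q(j, x + 1), x + 1)`. -/
noncomputable def spiralTau (A A₀ : Set ℝ) : SpiralSpace A A₀ ≃ₜ SpiralSpace A A₀ :=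
  ((gapShift A A₀).prodCongr (Homeomorph.addRight (1 : Theta))).subtype (shift_mem_iff A A₀)

theorem spiralTau_base {A A₀ : Set ℝ} (p : SpiralSpace A A₀) (h : p.1.1 ∈ A₀) :
    (spiralTau A A₀ p).1 = (p.1.1, p.1.2 + 1) :=
  Prod.ext (gapShift_base h) rfl

theorem spiralTau_wandering {A A₀ : Set ℝ} (p : SpiralSpace A A₀) {j : ℝ × ℝ}
    (hj : j ∈ gaps A A₀) {x : ℤ} (h : p.1 = (qPoint j x, (x : Theta))) :
    (spiralTau A A₀ p).1 = (qPoint j (x + 1), ((x + 1 : ℤ) : Theta)) := by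
  change (gapShift A A₀ p.1.1, p.1.2 + 1) = _
  rw [h, gapShift_qPoint hj]
  push_cast
  rfl

/-- `X(A, A₀) = Z(A, A₀) × C`, with `C` the classical Cantor set. -/
abbrev XSpace (A A₀ : Set ℝ) : Type := SpiralSpace A A₀ × cantorSet

/-- `T(A, A₀) = τ_(A, A₀) × 1_C`. -/
noncomputable def XHomeo (A A₀ : Set ℝ) : XSpace A A₀ ≃ₜ XSpace A A₀ :=
  (spiralTau A A₀).prodCongr (Homeomorph.refl cantorSet)

/-- The set `D`: the points with a ternary expansion `.a₀a₁a₂…` such that the smallest index `i`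
with `aᵢ = 1`, if there is one, is even. Thus `D` is the Cantor set together with its open
complementary intervals of lengths `1/3, 1/27, …` (but not those of lengths `1/9, 1/81, …`). -/
def setD : Set ℝ :=
  {a | ∃ d : ℕ → Fin 3, a = Real.ofDigits d ∧ ∀ i, d i = 1 → (∀ k < i, d k ≠ 1) → Even i}

/-- The space `X(D, C)`. -/
abbrev SpecialSpace : Type := XSpace setD cantorSet

/-- The Special Homeomorphism `T(D, C)`. -/
noncomputable def specialHomeo : SpecialSpace ≃ₜ SpecialSpace := XHomeo setD cantorSet

/-! ## Finite spirals -/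

/-- The two point compactification `ℤ ∪ {±∞}` of the integers, as a set. -/
inductive ZStar : Type
  | negInf : ZStar
  | int (x : ℤ) : ZStar
  | posInf : ZStar

/-- Translation by one, fixing `±∞`. -/
def ZStar.shift : ZStar → ZStar
  | negInf => negInf
  | int x => int (x + 1)
  | posInf => posInf

/-- The set `{(x, t) ∈ (ℤ ∪ {±∞}) × ℤ/n! : x = ±∞, or x ∈ ℤ and t = x mod n!}`. -/
def PreSpiral (n : ℕ) : Type :=
  {p : ZStar × ZMod n.factorial // ∀ x : ℤ, p.1 = ZStar.int x → p.2 = (x : ZMod n.factorial)}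

/-- The translation `τ` of `PreSpiral n`. -/
def PreSpiral.tau {n : ℕ} (s : PreSpiral n) : PreSpiral n :=
  ⟨(s.1.1.shift, s.1.2 + 1), by
    obtain ⟨⟨y, t⟩, hs⟩ := s
    intro x hx
    cases y with
    | negInf => cases hx
    | posInf => cases hx
    | int y =>
      have h : y + 1 = x := ZStar.int.inj hx
      have ht : t = (y : ZMod n.factorial) := hs y rfl
      subst h
      change t + 1 = _
      rw [ht]
      push_cast
      rfl⟩

/-- The collapse of `ℤ ∪ {±∞}` to `{-n, …, n}`, which sends `x ≥ n` and `+∞` to `n`, and `x ≤ -n`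
and `-∞` to `-n`. -/
def ZStar.collapse (n : ℕ) : ZStar → ℤ
  | negInf => -n
  | int x => max (-n) (min n x)
  | posInf => n

/-- The finite spiral `Σ_n`: the quotient of `PreSpiral n` by the identification of `(x, t)` with
`(+∞, t)` for `x ≥ n`, and with `(-∞, t)` for `x ≤ -n`. It is realised as the image of the map
`(x, t) ↦ (collapse n x, t)`, whose fibres are the classes of this identification. So `±∞` is
written `±n`; for `n = 0` there is one point. -/
def FinSpiral (n : ℕ) : Type :=
  {p : ℤ × ZMod n.factorial // ∃ s : PreSpiral n, (s.1.1.collapse n, s.1.2) = p}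

/-- The quotient map of `PreSpiral n` onto `Σ_n`. -/
def PreSpiral.proj {n : ℕ} (s : PreSpiral n) : FinSpiral n :=
  ⟨(s.1.1.collapse n, s.1.2), s, rfl⟩

/-- The relation `R_n` on `Σ_n`: the image of `τ`. -/
def FinSpiral.Rel {n : ℕ} (a b : FinSpiral n) : Prop :=
  ∃ s : PreSpiral n, s.proj = a ∧ s.tau.proj = b

/-- The projection `ℤ/(n+1)! → ℤ/n!`. -/
def factProj (n : ℕ) : ZMod (n + 1).factorial →+* ZMod n.factorial :=
  ZMod.castHom (Nat.factorial_dvd_factorial n.le_succ) (ZMod n.factorial)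

/-- The three types `L`, `M`, `R` of letters. -/
inductive Side : Type
  | L : Side
  | M : Side
  | R : Side

/-- The maps `ξ_L, ξ_M, ξ_R : Σ_{n+1} → Σ_n`. `ξ_M` is the canonical projection; `ξ_L`, `ξ_R`
project onto the `ℤ/n!` coordinate, which is identified with the cycle at `-∞`, `+∞`. -/
def xiSide {n : ℕ} (K : Side) (p : FinSpiral (n + 1)) : FinSpiral n :=
  match K with
  | Side.L => ⟨(-n, factProj n p.1.2), ⟨(ZStar.negInf, factProj n p.1.2), by intro x h; cases h⟩,
      rfl⟩
  | Side.M => ⟨(max (-n) (min n p.1.1), factProj n p.1.2), by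
      obtain ⟨q, ⟨⟨y, t⟩, hs⟩, rfl⟩ := p
      refine ⟨⟨(y, factProj n t), ?_⟩, Prod.ext ?_ rfl⟩
      · intro x hx
        change factProj n t = _
        rw [show t = (x : ZMod (n + 1).factorial) from hs x hx, map_intCast]
      · cases y <;> simp only [ZStar.collapse] <;> omega⟩
  | Side.R => ⟨(n, factProj n p.1.2), ⟨(ZStar.posInf, factProj n p.1.2), by intro x h; cases h⟩,
      rfl⟩

/-! ## The inverse system -/

/-- The six letters `L₁, L₂, M₁, M₂, R₁, R₂`. -/
abbrev Letter : Type := Side × Fin 2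

/-- `𝓦_n`: the disjoint union of copies of `Σ_n` indexed by the words of length `n`. -/
def W (n : ℕ) : Type := (Fin n → Letter) × FinSpiral n

/-- The finite set `𝓦_n` is discrete. -/
instance (n : ℕ) : TopologicalSpace (W n) := ⊥

/-- The relation `R_n` on `𝓦_n`, given by `R_n` on each of the copies of `Σ_n`. -/
def WRel (n : ℕ) (a b : W n) : Prop := a.1 = b.1 ∧ FinSpiral.Rel a.2 b.2

/-- The bonding map `ξ : 𝓦_{n+1} → 𝓦_n`; it maps the spiral indexed by `ω K_α` to the spiral
indexed by `ω`, by means of `ξ_K`. -/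
def xi (n : ℕ) (a : W (n + 1)) : W n :=
  (Fin.init a.1, xiSide (a.1 (Fin.last n)).1 a.2)

/-- The composition `ξ : 𝓦_{n+k} → 𝓦_n` of the bonding maps. -/
def xiIter (n : ℕ) : (k : ℕ) → W (n + k) → W n
  | 0 => id
  | k + 1 => fun a => xiIter n k (xi (n + k) a)

/-- The inverse limit `𝓦_∞`, with the topology induced by the product topology. -/
def WInf : Type := {w : (n : ℕ) → W n // ∀ n, xi n (w (n + 1)) = w n}

instance : TopologicalSpace WInf := inferInstanceAs (TopologicalSpace (Subtype _))

/-- The inverse limit `R_∞` of the relations `R_n`. -/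
def RInf (a b : WInf) : Prop := ∀ n, WRel n (a.1 n) (b.1 n)

/-- The Lifting Property of a homeomorphism `T` for the inverse system `(𝓦_n, ξ)`. -/
def LiftingProperty {X : Type*} [MetricSpace X] (T : X ≃ₜ X) : Prop :=
  ∀ (n : ℕ) (φ : X → W n), Continuous φ → MapsRel φ (graphRel T) (WRel n) →
    ∀ ε : ℝ, 0 < ε →
      ∃ k : ℕ, 0 < k ∧ ∃ ρ : X → W (n + k), Continuous ρ ∧
        MapsRel ρ (graphRel T) (WRel (n + k)) ∧
        (∀ a, Metric.diam (ρ ⁻¹' {a}) ≤ ε) ∧ φ = xiIter n k ∘ ρ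

end GenericHomeo

/-! Everything passes through the inverse limit `(𝓦_∞, R_∞)`. A nonempty compact metric system with
the Lifting Property is isomorphic to it (`LiftingProperty.exists_homeomorph`): starting from the
constant map to the one-point space `𝓦_0`, one lifts repeatedly with fibres of diameter tending to
`0`. The stages assemble to a bijection onto the limit, and the small fibres identify `R_∞` with the
graph of `T`. So any two such systems are conjugate, and it remains to prove that the Special
Homeomorphism has the Lifting Property (`exists_lift`, carried along conjugacies by
`liftingProperty_of_conj`).

Let `φ` be a map to `𝓦_n` and `g` a locally constant function with small fibres. For each gap `j`
there is an equivariant retraction `loc j` of the whole space to a full spiral. A bi-infinite walk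
in `Σ_n` stays at an end or crosses once (`exists_side_of_walk`), so on a wandering orbit `φ` is a
translated retraction followed by some `K ∈ {L, M, R}`. By density and local constancy this persists
near the closed spiral (`exists_local_spiral`). Over a single adding machine recurrence leaves only
`K = L, R` (`exists_local_mach`). Points outside `D` accumulate at the ends of gaps from outside,
and at all other Cantor points from both sides. Hence these neighbourhoods may be taken clopen and
invariant, and compactness yields finitely many disjoint `Good` pieces labelled by pairs `(ω, K)`
(`ClopenInv.decomposes`).

On the spiral of a word of length `n + k`, the map to `𝓦_n` depends on the word only through its
prefix `ω` and its first later letter other than `M` (`xiIter_toFin`), so a word has a label `(ω,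
K)` too. A lift is a matching of pieces with words of the same label. It exists for large `k`: every
label occurs among the pieces, as gaps accumulate at both ends of each spiral
(`exists_good_of_each_side`); pieces can be subdivided at will thanks to the factor `C`
(`Good.split`); and the doubled letters supply arbitrarily many words of each label
(`le_card_words`). -/

namespace GenericHomeo

/-! ## Ternary expansions -/

/-- Prefixing the first `i` ternary digits of `d` to the expansion of `y`. -/
noncomputable def digitMap : ℕ → (ℕ → Fin 3) → ℝ → ℝ
  | 0, _, y => y
  | i + 1, d, y => ((d 0 : ℕ) + digitMap i (fun k => d (k + 1)) y) / 3

theorem ofDigits_head (d : ℕ → Fin 3) :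
    Real.ofDigits d = ((d 0 : ℕ) + Real.ofDigits (fun k => d (k + 1))) / 3 := by
  rw [Real.ofDigits_eq_sum_add_ofDigits d 1]
  simp [Real.ofDigitsTerm]
  ring

theorem ofDigits_eq_digitMap (i : ℕ) (d : ℕ → Fin 3) :
    Real.ofDigits d = digitMap i d (Real.ofDigits fun k => d (k + i)) := by
  induction i generalizing d with
  | zero => rfl
  | succ i ih =>
    rw [ofDigits_head, ih]
    simp only [digitMap]
    congr 5

theorem digitMap_congr {i : ℕ} {d e : ℕ → Fin 3} (h : ∀ k < i, d k = e k) (y : ℝ) :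
    digitMap i d y = digitMap i e y := by
  induction i generalizing d e with
  | zero => rfl
  | succ i ih =>
    simp only [digitMap]
    rw [h 0 (by omega), ih fun k hk => h (k + 1) (by omega)]

/-- Each prefixed digit contracts by `1/3`, so `digitMap i d` is affine of slope `3⁻ⁱ`.
Monotonicity, surjectivity and the distance estimates near Cantor points come from this. -/
theorem digitMap_sub (i : ℕ) (d : ℕ → Fin 3) (y z : ℝ) :
    digitMap i d y - digitMap i d z = (y - z) / 3 ^ i := by
  induction i generalizing d with
  | zero => simp [digitMap]
  | succ i ih =>
    have := ih (fun k => d (k + 1))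
    simp only [digitMap, pow_succ]
    rw [← div_div, ← this]
    ring

theorem digitMap_strictMono (i : ℕ) (d : ℕ → Fin 3) : StrictMono (digitMap i d) := by
  intro y z h
  have := digitMap_sub i d z y
  have h2 : 0 < (z - y) / 3 ^ i := by have : 0 < z - y := by linarith
                                      positivity
  linarith

theorem exists_digitMap_eq (i : ℕ) (d : ℕ → Fin 3) (a : ℝ) : ∃ y, digitMap i d y = a := by
  refine ⟨3 ^ i * (a - digitMap i d 0), ?_⟩
  have := digitMap_sub i d (3 ^ i * (a - digitMap i d 0)) 0
  rw [sub_zero, mul_div_cancel_left₀ _ (by positivity)] at this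
  linarith

theorem mem_Ioo_digitMap {i : ℕ} {d : ℕ → Fin 3} {u v a : ℝ}
    (h : a ∈ Ioo (digitMap i d u) (digitMap i d v)) : ∃ y ∈ Ioo u v, digitMap i d y = a := by
  obtain ⟨y, rfl⟩ := exists_digitMap_eq i d a
  exact ⟨y, ⟨(digitMap_strictMono i d).lt_iff_lt.1 h.1, (digitMap_strictMono i d).lt_iff_lt.1 h.2⟩,
    rfl⟩

theorem digitMap_mem_Ioo (i : ℕ) (d : ℕ → Fin 3) {y : ℝ} (hy : y ∈ Ioo (0 : ℝ) 1) :
    digitMap i d y ∈ Ioo (0 : ℝ) 1 := by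
  induction i generalizing d with
  | zero => exact hy
  | succ i ih =>
    obtain ⟨h0, h1⟩ := ih (fun k => d (k + 1))
    have h2 : ((d 0 : ℕ) : ℝ) ≤ 2 := by exact_mod_cast Nat.le_of_lt_succ (d 0).2
    have h3 : (0 : ℝ) ≤ ((d 0 : ℕ) : ℝ) := by positivity
    simp only [digitMap]
    constructor <;> linarith

/-- A point in the interior of a ternary interval determines the digits of that interval. -/
theorem digits_eq_of_interior {i : ℕ} {b d : ℕ → Fin 3} {y : ℝ} (hy : y ∈ Ioo (0 : ℝ) 1)
    (h : Real.ofDigits b = digitMap i d y) :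
    (∀ k < i, b k = d k) ∧ Real.ofDigits (fun k => b (k + i)) = y := by
  induction i generalizing b d with
  | zero => exact ⟨by simp, h⟩
  | succ i ih =>
    have hm := digitMap_mem_Ioo i (fun k => d (k + 1)) hy
    have h0 := Real.ofDigits_nonneg fun k => b (k + 1)
    have h1 := Real.ofDigits_le_one fun k => b (k + 1)
    rw [ofDigits_head] at h
    simp only [digitMap] at h
    -- The tails lie in `[0, 1]` and `(0, 1)`, so the leading digits differ by less than `1`.
    have e : (b 0 : ℕ) = (d 0 : ℕ) := by
      have l1 : ((b 0 : ℕ) : ℝ) < (d 0 : ℕ) + 1 := by linarith [hm.2]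
      have l2 : ((d 0 : ℕ) : ℝ) < (b 0 : ℕ) + 1 := by linarith [hm.1]
      norm_cast at l1 l2
      omega
    obtain ⟨h3, h4⟩ := ih (b := fun k => b (k + 1)) (d := fun k => d (k + 1)) (by rw [e] at h; linarith)
    refine ⟨fun k hk => ?_, ?_⟩
    · rcases k with _ | k
      · exact Fin.ext e
      · exact h3 k (by omega)
    · rw [← h4]
      congr 1

theorem head_eq_one {b : ℕ → Fin 3} (h : Real.ofDigits b ∈ Ioo (1 / 3 : ℝ) (2 / 3)) : b 0 = 1 := by
  have h0 := Real.ofDigits_nonneg fun k => b (k + 1)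
  have h1 := Real.ofDigits_le_one fun k => b (k + 1)
  rw [ofDigits_head] at h
  have l1 : (0 : ℝ) < (b 0 : ℕ) := by linarith [h.1]
  have l2 : ((b 0 : ℕ) : ℝ) < 2 := by linarith [h.2]
  norm_cast at l1 l2
  apply Fin.ext
  change (b 0 : ℕ) = 1
  omega

theorem mem_Icc_of_head_eq_one {b : ℕ → Fin 3} (h : b 0 = 1) :
    Real.ofDigits b ∈ Icc (1 / 3 : ℝ) (2 / 3) := by
  have h0 := Real.ofDigits_nonneg fun k => b (k + 1)
  have h1 := Real.ofDigits_le_one fun k => b (k + 1)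
  rw [ofDigits_head, h]
  constructor <;> norm_num <;> linarith

theorem exists_ofDigits {a : ℝ} (h : a ∈ Icc (0 : ℝ) 1) : ∃ b : ℕ → Fin 3, Real.ofDigits b = a := by
  obtain ⟨b, -, hb⟩ := Real.ofDigits_SurjOn (b := 3) (by norm_num) h
  exact ⟨b, hb⟩

theorem mem_cantorSet_iff {a : ℝ} :
    a ∈ cantorSet ↔ ∃ d : ℕ → Fin 3, (∀ i, d i ≠ 1) ∧ Real.ofDigits d = a := by
  rw [cantorSet_eq_zero_two_ofDigits]
  rfl

theorem one_mem_cantorSet : (1 : ℝ) ∈ cantorSet := by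
  exact mem_cantorSet_iff.2 ⟨fun _ => 2, fun _ => (by decide : (2 : Fin 3) ≠ 1), Real.ofDigits_const_last_eq_one 2⟩

theorem third_mem_cantorSet : (1 / 3 : ℝ) ∈ cantorSet := by
  rw [cantorSet_eq_union_halves]
  exact Or.inl ⟨1, one_mem_cantorSet, rfl⟩

theorem two_thirds_mem_cantorSet : (2 / 3 : ℝ) ∈ cantorSet := by
  rw [cantorSet_eq_union_halves]
  exact Or.inr ⟨0, zero_mem_cantorSet, by norm_num⟩

theorem digitMap_mem_cantorSet {i : ℕ} {d : ℕ → Fin 3} (hd : ∀ k < i, d k ≠ 1) {y : ℝ}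
    (hy : y ∈ cantorSet) : digitMap i d y ∈ cantorSet := by
  induction i generalizing d with
  | zero => exact hy
  | succ i ih =>
    have h := ih (d := fun k => d (k + 1)) fun k hk => hd (k + 1) (by omega)
    have h0 := hd 0 (by omega)
    rw [cantorSet_eq_union_halves]
    simp only [digitMap]
    generalize d 0 = x at h0
    fin_cases x
    · exact Or.inl ⟨_, h, by simp⟩
    · exact absurd rfl h0
    · exact Or.inr ⟨_, h, by simp⟩

/-! ## The gaps of the Cantor set -/

/-- The middle third of a ternary interval. -/
noncomputable def middleThird (i : ℕ) (d : ℕ → Fin 3) : ℝ × ℝ :=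
  (digitMap i d (1 / 3), digitMap i d (2 / 3))

theorem middleThird_lt (i : ℕ) (d : ℕ → Fin 3) : (middleThird i d).1 < (middleThird i d).2 :=
  digitMap_strictMono i d (by norm_num)

theorem digits_of_mem_middleThird {i : ℕ} {b d : ℕ → Fin 3}
    (h : Real.ofDigits b ∈ Ioo (middleThird i d).1 (middleThird i d).2) :
    (∀ k < i, b k = d k) ∧ b i = 1 := by
  obtain ⟨y, hy, e⟩ := mem_Ioo_digitMap h
  obtain ⟨h1, h2⟩ := digits_eq_of_interior (y := y)
    ⟨by linarith [hy.1], by linarith [hy.2]⟩ e.symm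
  refine ⟨h1, ?_⟩
  have := head_eq_one (b := fun k => b (k + i)) (by rw [h2]; exact hy)
  simpa using this

theorem middleThird_disjoint_cantorSet {i : ℕ} {d : ℕ → Fin 3} {a : ℝ}
    (h : a ∈ Ioo (middleThird i d).1 (middleThird i d).2) : a ∉ cantorSet := by
  intro ha
  obtain ⟨b, hb, rfl⟩ := mem_cantorSet_iff.1 ha
  exact hb i (digits_of_mem_middleThird h).2

/-- Follow the first `i` digits of `d` by an expansion of the rescaled point. That point is in
`(1/3, 2/3)`, so the first `1` is exactly at place `i`. -/
theorem middleThird_subset_setD {i : ℕ} (hi : Even i) {d : ℕ → Fin 3} (hd : ∀ k < i, d k ≠ 1)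
    {a : ℝ} (h : a ∈ Ioo (middleThird i d).1 (middleThird i d).2) : a ∈ setD := by
  obtain ⟨y, hy, rfl⟩ := mem_Ioo_digitMap h
  obtain ⟨e, he⟩ := exists_ofDigits (a := y) ⟨by linarith [hy.1], by linarith [hy.2]⟩
  have he0 : e 0 = 1 := head_eq_one (by rw [he]; exact hy)
  refine ⟨fun k => if k < i then d k else e (k - i), ?_, fun m hm hlt => ?_⟩
  · rw [ofDigits_eq_digitMap i, ← he]
    rw [digitMap_congr (d := fun k => if k < i then d k else e (k - i)) (e := d)
      (fun k hk => by simp [hk])]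
    congr 2
    ext k
    simp
  · rcases lt_trichotomy m i with h1 | rfl | h1
    · simp only [h1, if_true] at hm
      exact absurd hm (hd m h1)
    · exact hi
    · have := hlt i h1
      simp [he0] at this

/-- Inside a middle third the digits up to place `i` are the same in every expansion, so the choice
of expansion in the definition of `D` cannot move the first `1`. -/
theorem middleThird_disjoint_setD {i : ℕ} (hi : Odd i) {d : ℕ → Fin 3} (hd : ∀ k < i, d k ≠ 1)
    {a : ℝ} (h : a ∈ Ioo (middleThird i d).1 (middleThird i d).2) : a ∉ setD := by
  rintro ⟨b, rfl, hb⟩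
  obtain ⟨h1, h2⟩ := digits_of_mem_middleThird h
  exact (Nat.not_even_iff_odd.2 hi) (hb i h2 fun k hk => by rw [h1 k hk]; exact hd k hk)

theorem cantorSet_subset_setD : cantorSet ⊆ setD := by
  intro a ha
  obtain ⟨d, hd, rfl⟩ := mem_cantorSet_iff.1 ha
  exact ⟨d, rfl, fun i hi => absurd hi (hd i)⟩

theorem middleThird_mem_gaps {i : ℕ} (hi : Even i) {d : ℕ → Fin 3} (hd : ∀ k < i, d k ≠ 1) :
    middleThird i d ∈ gaps setD cantorSet :=
  ⟨middleThird_lt i d, digitMap_mem_cantorSet hd third_mem_cantorSet,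
    digitMap_mem_cantorSet hd two_thirds_mem_cantorSet,
    fun _ ha => ⟨middleThird_subset_setD hi hd ha, middleThird_disjoint_cantorSet ha⟩⟩

/-- The first digit `1` locates the middle third; its endpoints are excluded because they belong to
the Cantor set. -/
theorem exists_middleThird {b : ℕ → Fin 3} (hb : Real.ofDigits b ∉ cantorSet) :
    ∃ i, (∀ k < i, b k ≠ 1) ∧ b i = 1 ∧
      Real.ofDigits b ∈ Ioo (middleThird i b).1 (middleThird i b).2 := by
  classical
  have h : ∃ i, b i = 1 := by
    by_contra! h
    exact hb (mem_cantorSet_iff.2 ⟨b, h, rfl⟩)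
  have hlt : ∀ k < Nat.find h, b k ≠ 1 := fun k hk => Nat.find_min h hk
  refine ⟨Nat.find h, hlt, Nat.find_spec h, ?_⟩
  have hm := mem_Icc_of_head_eq_one (b := fun k => b (k + Nat.find h))
    (by simpa using Nat.find_spec h)
  have e := ofDigits_eq_digitMap (Nat.find h) b
  have hmono := digitMap_strictMono (Nat.find h) b
  constructor
  · rw [e]
    refine hmono (lt_of_le_of_ne hm.1 fun h1 => hb ?_)
    rw [e, ← h1]
    exact digitMap_mem_cantorSet hlt third_mem_cantorSet
  · rw [e]
    refine hmono (lt_of_le_of_ne hm.2 fun h1 => hb ?_)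
    rw [e, h1]
    exact digitMap_mem_cantorSet hlt two_thirds_mem_cantorSet

theorem exists_gap_of_mem_setD {a : ℝ} (ha : a ∈ setD) (hc : a ∉ cantorSet) :
    ∃ j ∈ gaps setD cantorSet, a ∈ Ioo j.1 j.2 := by
  obtain ⟨b, rfl, hb⟩ := ha
  obtain ⟨i, h1, h2, h3⟩ := exists_middleThird hc
  exact ⟨_, middleThird_mem_gaps (hb i h2 h1) h1, h3⟩

theorem setD_subset_unitInterval : setD ⊆ Icc 0 1 := by
  rintro _ ⟨b, rfl, -⟩
  exact ⟨Real.ofDigits_nonneg b, Real.ofDigits_le_one b⟩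

/-- A point of `[0, 1]` outside `D` lies in a middle third of odd level, an open set that misses
`D`. -/
theorem isClosed_setD : IsClosed setD := by
  rw [← isOpen_compl_iff, isOpen_iff_mem_nhds]
  intro a ha
  by_cases h01 : a ∈ Icc (0 : ℝ) 1
  · obtain ⟨b, rfl⟩ := exists_ofDigits h01
    obtain ⟨i, h1, h2, h3⟩ := exists_middleThird fun h => ha (cantorSet_subset_setD h)
    rcases Nat.even_or_odd i with hi | hi
    · exact absurd (middleThird_subset_setD hi h1 h3) ha
    · exact Filter.mem_of_superset (isOpen_Ioo.mem_nhds h3)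
        fun y hy => middleThird_disjoint_setD hi h1 hy
  · exact Filter.mem_of_superset (isClosed_Icc.isOpen_compl.mem_nhds h01)
      fun y hy h => hy (setD_subset_unitInterval h)

theorem exists_pow_lt {δ : ℝ} (hδ : 0 < δ) : ∃ N : ℕ, ∀ i ≥ N, ((3 : ℝ) ^ i)⁻¹ < δ := by
  obtain ⟨N, hN⟩ := exists_pow_lt_of_lt_one hδ (show (3⁻¹ : ℝ) < 1 by norm_num)
  refine ⟨N, fun i hi => ?_⟩
  rw [← inv_pow]
  exact (pow_le_pow_of_le_one (by norm_num) (by norm_num) hi).trans_lt hN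

theorem exists_gap_near {c : ℝ} (hc : c ∈ cantorSet) {δ : ℝ} (hδ : 0 < δ) :
    ∃ j ∈ gaps setD cantorSet, j.1 ∈ Ioo (c - δ) (c + δ) ∧ j.2 ∈ Ioo (c - δ) (c + δ) := by
  obtain ⟨d, hd, rfl⟩ := mem_cantorSet_iff.1 hc
  obtain ⟨N, hN⟩ := exists_pow_lt hδ
  have hN' := hN (2 * N) (by omega)
  -- The level is even so that this middle third is a gap of `(D, C)`, and at least `N` so that it
  -- is within `δ` of `c`.
  refine ⟨middleThird (2 * N) d, middleThird_mem_gaps (even_two_mul N) (fun k _ => hd k), ?_⟩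
  have hp : (0 : ℝ) < (3 ^ (2 * N))⁻¹ := by positivity
  have h0 := Real.ofDigits_nonneg fun k => d (k + 2 * N)
  have h1 := Real.ofDigits_le_one fun k => d (k + 2 * N)
  have e := ofDigits_eq_digitMap (2 * N) d
  have s1 := digitMap_sub (2 * N) d (1 / 3) (Real.ofDigits fun k => d (k + 2 * N))
  have s2 := digitMap_sub (2 * N) d (2 / 3) (Real.ofDigits fun k => d (k + 2 * N))
  rw [← e, div_eq_mul_inv _ ((3 : ℝ) ^ _)] at s1 s2
  simp only [middleThird]
  generalize Real.ofDigits (fun k => d (k + 2 * N)) = y at *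
  refine ⟨⟨?_, ?_⟩, ?_, ?_⟩ <;> nlinarith

theorem digitMap_succ_tail (i : ℕ) (d : ℕ → Fin 3) (y : ℝ) :
    digitMap (i + 1) d y = digitMap i d (((d i : ℕ) + y) / 3) := by
  induction i generalizing d with
  | zero => simp [digitMap]
  | succ i ih =>
    rw [digitMap, ih]
    simp only [digitMap]

/-- To the left of a point of the Cantor set, and arbitrarily close to it, there are points outside
`D`, unless the point is the right endpoint of a gap of `(D, C)`. -/
theorem exists_cut_left {c : ℝ} (hc : c ∈ cantorSet) {δ : ℝ} (hδ : 0 < δ)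
    (hne : ∀ j ∈ gaps setD cantorSet, j.2 ≠ c) : ∃ e ∈ Ioo (c - δ) c, e ∉ setD := by
  obtain ⟨d, hd, rfl⟩ := mem_cantorSet_iff.1 hc
  obtain ⟨N, hN⟩ := exists_pow_lt hδ
  have hd2 : ∀ i, d i ≠ 0 → d i = 2 := fun i h => by
    have := hd i
    generalize d i = x at *
    fin_cases x <;> simp_all
  -- a digit `2` at a place `i ≥ N` gives a cut
  have key : ∀ i ≥ N, d i = 2 → ∃ e ∈ Ioo (Real.ofDigits d - δ) (Real.ofDigits d), e ∉ setD := by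
    intro i hi h2
    have e1 := ofDigits_eq_digitMap (i + 1) d
    rw [digitMap_succ_tail, h2] at e1
    have h0 := Real.ofDigits_nonneg fun k => d (k + (i + 1))
    have h1 := Real.ofDigits_le_one fun k => d (k + (i + 1))
    have hNi := hN i hi
    have hp : (0 : ℝ) < (3 ^ i)⁻¹ := by positivity
    rcases Nat.even_or_odd i with hev | hodd
    · -- use the middle third of the interval with digit `0` at `i`
      let d' : ℕ → Fin 3 := Function.update d i 0
      have hd' : ∀ k < i + 1, d' k ≠ 1 := by
        intro k _
        by_cases hk : k = i
        · simp [d', hk]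
        · simp only [d', Function.update_of_ne hk]
          exact hd k
      have e3 : ∀ y, digitMap (i + 1) d' y = digitMap i d (y / 3) := by
        intro y
        rw [digitMap_succ_tail, digitMap_congr (d := d') (e := d)
          (fun k hk => by simp [d', Function.update_of_ne hk.ne])]
        simp [d']
      have hmem : digitMap (i + 1) d' (1 / 2) ∈
          Ioo (middleThird (i + 1) d').1 (middleThird (i + 1) d').2 :=
        ⟨digitMap_strictMono _ _ (by norm_num), digitMap_strictMono _ _ (by norm_num)⟩
      refine ⟨_, ?_, middleThird_disjoint_setD hev.add_one hd' hmem⟩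
      rw [e3]
      have s := digitMap_sub i d (1 / 2 / 3)
        ((((2 : Fin 3) : ℕ) + Real.ofDigits fun k => d (k + (i + 1))) / 3)
      rw [← e1, div_eq_mul_inv _ ((3 : ℝ) ^ i)] at s
      generalize (Real.ofDigits fun k => d (k + (i + 1))) = y at *
      norm_num at s
      constructor <;> nlinarith
    -- At an odd place the middle third adjacent to the third with digit `2` is itself outside `D`.
    · have hmem : digitMap i d (1 / 2) ∈ Ioo (middleThird i d).1 (middleThird i d).2 :=
        ⟨digitMap_strictMono _ _ (by norm_num), digitMap_strictMono _ _ (by norm_num)⟩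
      refine ⟨_, ?_, middleThird_disjoint_setD hodd (fun k _ => hd k) hmem⟩
      have s := digitMap_sub i d (1 / 2)
        ((((2 : Fin 3) : ℕ) + Real.ofDigits fun k => d (k + (i + 1))) / 3)
      rw [← e1, div_eq_mul_inv _ ((3 : ℝ) ^ i)] at s
      generalize (Real.ofDigits fun k => d (k + (i + 1))) = y at *
      norm_num at s
      constructor <;> nlinarith
  by_cases hinf : ∃ i ≥ N, d i = 2
  · obtain ⟨i, hi, h2⟩ := hinf
    exact key i hi h2
  have htail : ∀ i ≥ N, d i = 0 := fun i hi => by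
    by_contra h
    exact hinf ⟨i, hi, hd2 i h⟩
  classical
  -- If all digits vanish then `c = 0`, and negative numbers are outside `D`.
  by_cases hall : ∀ i, d i = 0
  · refine ⟨-(δ / 2), ?_, fun h => by linarith [(setD_subset_unitInterval h).1]⟩
    have : Real.ofDigits d = 0 := by
      unfold Real.ofDigits Real.ofDigitsTerm
      simp [hall]
    rw [this]
    constructor <;> linarith
  -- the last digit `2`
  have hex : ∃ M, ∀ k ≥ M, d k = 0 := ⟨N, htail⟩
  have hM := Nat.find_spec hex
  obtain ⟨i, hi⟩ : ∃ i, Nat.find hex = i + 1 := by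
    refine Nat.exists_eq_succ_of_ne_zero fun h0 => hall fun i => hM i (by omega)
  have hi2 : d i = 2 := by
    refine hd2 i fun h0 => ?_
    refine Nat.find_min hex (m := i) (by omega) fun k hk => ?_
    rcases Nat.eq_or_lt_of_le hk with rfl | h
    · exact h0
    · exact hM k (by omega)
  have e1 : Real.ofDigits d = digitMap i d (2 / 3) := by
    rw [ofDigits_eq_digitMap (i + 1) d, digitMap_succ_tail, hi2]
    have : (Real.ofDigits fun k => d (k + (i + 1))) = 0 := by
      unfold Real.ofDigits Real.ofDigitsTerm
      have : ∀ k, d (k + (i + 1)) = 0 := fun k => hM _ (by omega)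
      simp [this]
    rw [this]
    norm_num
  -- Now `c` is the right endpoint of the middle third at place `i`. For even `i` that is a gap of
  -- `(D, C)`, which `hne` excludes; for odd `i` it lies outside `D`.
  rcases Nat.even_or_odd i with hev | hodd
  · exact absurd e1.symm (hne _ (middleThird_mem_gaps hev fun k _ => hd k))
  · have hlt : max ((middleThird i d).1) (Real.ofDigits d - δ) < (middleThird i d).2 := by
      refine max_lt (middleThird_lt i d) ?_
      change _ < digitMap i d (2 / 3)
      rw [← e1]
      linarith
    obtain ⟨e, he1, he2⟩ := exists_between hlt
    refine ⟨e, ⟨(le_max_right _ _).trans_lt he1, ?_⟩, middleThird_disjoint_setD hodd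
      (fun k _ => hd k) ⟨(le_max_left _ _).trans_lt he1, he2⟩⟩
    rw [e1]
    exact he2

/-- The reflection `a ↦ 1 - a` exchanges the digits `0` and `2` and fixes `1`. It therefore
preserves `C`, `D` and the gaps, and turns cuts on the left into cuts on the right. -/
theorem ofDigits_rev (d : ℕ → Fin 3) :
    Real.ofDigits (fun k => Fin.rev (d k)) = 1 - Real.ofDigits d := by
  have h1 : Real.ofDigits (fun _ => (2 : Fin 3)) = 1 := Real.ofDigits_const_last_eq_one 2
  rw [← h1]
  unfold Real.ofDigits
  rw [← Summable.tsum_sub Real.summable_ofDigitsTerm Real.summable_ofDigitsTerm]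
  congr 1
  ext k
  simp only [Real.ofDigitsTerm, Fin.val_rev]
  rw [Nat.cast_sub (by omega)]
  push_cast
  norm_num
  ring

theorem fin_rev_eq_one {x : Fin 3} : Fin.rev x = 1 ↔ x = 1 := by
  fin_cases x <;> decide

theorem one_sub_mem_cantorSet {a : ℝ} (h : a ∈ cantorSet) : 1 - a ∈ cantorSet := by
  obtain ⟨d, hd, rfl⟩ := mem_cantorSet_iff.1 h
  exact mem_cantorSet_iff.2 ⟨fun k => Fin.rev (d k),
    fun k hk => hd k (fin_rev_eq_one.1 hk), ofDigits_rev d⟩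

theorem one_sub_mem_setD {a : ℝ} (h : a ∈ setD) : 1 - a ∈ setD := by
  obtain ⟨d, rfl, hd⟩ := h
  refine ⟨fun k => Fin.rev (d k), (ofDigits_rev d).symm, fun i hi hlt => ?_⟩
  exact hd i (fin_rev_eq_one.1 hi) fun k hk h1 => hlt k hk (fin_rev_eq_one.2 h1)

theorem one_sub_mem_gaps {j : ℝ × ℝ} (h : j ∈ gaps setD cantorSet) :
    (1 - j.2, 1 - j.1) ∈ gaps setD cantorSet := by
  obtain ⟨h1, h2, h3, h4⟩ := h
  refine ⟨by simpa using h1, one_sub_mem_cantorSet h3, one_sub_mem_cantorSet h2, fun a ha => ?_⟩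
  obtain ⟨h5, h6⟩ := h4 (show 1 - a ∈ Ioo j.1 j.2 from ⟨by linarith [ha.2], by linarith [ha.1]⟩)
  refine ⟨by simpa using one_sub_mem_setD h5, fun h => h6 (one_sub_mem_cantorSet h)⟩

theorem exists_cut_right {c : ℝ} (hc : c ∈ cantorSet) {δ : ℝ} (hδ : 0 < δ)
    (hne : ∀ j ∈ gaps setD cantorSet, j.1 ≠ c) : ∃ e ∈ Ioo c (c + δ), e ∉ setD := by
  obtain ⟨e, he, h⟩ := exists_cut_left (one_sub_mem_cantorSet hc) hδ fun j hj h =>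
    hne _ (one_sub_mem_gaps hj) (by simp [h])
  exact ⟨1 - e, ⟨by linarith [he.2], by linarith [he.1]⟩,
    fun h' => h (by simpa using one_sub_mem_setD h')⟩

/-- A common endpoint of two gaps would be isolated in `C`; but small gaps accumulate there, and
their two distinct ends belong to `C`. -/
theorem gap_ends_ne {j k : ℝ × ℝ} (hj : j ∈ gaps setD cantorSet) (hk : k ∈ gaps setD cantorSet) :
    j.2 ≠ k.1 := by
  intro h
  obtain ⟨i, hi, h1, h2⟩ := exists_gap_near hj.2.2.1 (δ := min (j.2 - j.1) (k.2 - k.1))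
    (lt_min (by linarith [hj.1]) (by linarith [hk.1]))
  have l1 := min_le_left (j.2 - j.1) (k.2 - k.1)
  have l2 := min_le_right (j.2 - j.1) (k.2 - k.1)
  have mem : ∀ a ∈ cantorSet, a ∈ Ioo j.1 k.2 → a = j.2 := by
    intro a ha hm
    rcases lt_trichotomy a j.2 with hlt | rfl | hlt
    · exact absurd ha (hj.2.2.2 ⟨hm.1, hlt⟩).2
    · rfl
    · exact absurd ha (hk.2.2.2 ⟨h ▸ hlt, hm.2⟩).2
  have e1 := mem _ hi.2.1 ⟨by linarith [h1.1], by linarith [h1.2]⟩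
  have e2 := mem _ hi.2.2.1 ⟨by linarith [h2.1], by linarith [h2.2]⟩
  exact absurd hi.1 (by rw [e1, e2]; exact lt_irrefl _)

/-! ## The adding machine -/

/-- The reduction `Θ → ℤ/N!`. -/
def tmod (N : ℕ) : Theta →+* ZMod N.factorial :=
  (Pi.evalRingHom (fun m : ℕ+ => ZMod m) ⟨N.factorial, N.factorial_pos⟩).comp Theta.subtype

theorem tmod_continuous (N : ℕ) : Continuous (tmod N) :=
  (continuous_apply (A := fun m : ℕ+ => ZMod m) (⟨N.factorial, N.factorial_pos⟩ : ℕ+)).comp continuous_subtype_val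

theorem factProj_tmod (N : ℕ) (t : Theta) : factProj N (tmod (N + 1) t) = tmod N t :=
  t.2 ⟨N.factorial, N.factorial_pos⟩ ⟨(N + 1).factorial, (N + 1).factorial_pos⟩
    (Nat.factorial_dvd_factorial N.le_succ)

theorem tmod_eq_of_le {M N : ℕ} (h : M ≤ N) {s t : Theta} (e : tmod N s = tmod N t) :
    tmod M s = tmod M t := by
  induction N, h using Nat.le_induction with
  | base => exact e
  | succ N _ ih => exact ih (by rw [← factProj_tmod, e, factProj_tmod])

/-- As `m ∣ m!`, the factorials are cofinal for divisibility, so residues modulo factorials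
determine an element of `Θ` and govern convergence. -/
theorem apply_eq_of_tmod_eq {s t : Theta} {m : ℕ+} (e : tmod m s = tmod m t) : s.1 m = t.1 m := by
  have hs := s.2 m ⟨(m : ℕ).factorial, Nat.factorial_pos _⟩ (Nat.dvd_factorial m.pos le_rfl)
  have ht := t.2 m ⟨(m : ℕ).factorial, Nat.factorial_pos _⟩ (Nat.dvd_factorial m.pos le_rfl)
  rw [← hs, ← ht]
  exact congrArg _ e

theorem ext_tmod {s t : Theta} (h : ∀ N, tmod N s = tmod N t) : s = t :=
  Subtype.ext (funext fun m => apply_eq_of_tmod_eq (h m))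

theorem tendsto_theta {ι : Type*} {l : Filter ι} {u : ι → Theta} {t : Theta}
    (h : ∀ N, ∀ᶠ k in l, tmod N (u k) = tmod N t) : Filter.Tendsto u l (𝓝 t) := by
  rw [tendsto_subtype_rng, tendsto_pi_nhds]
  intro m
  refine tendsto_nhds_of_eventually_eq ?_
  filter_upwards [h m] with k hk using apply_eq_of_tmod_eq hk

theorem exists_int_tmod (N : ℕ) (t : Theta) : ∃ a : ℤ, tmod N (a : Theta) = tmod N t := by
  obtain ⟨a, ha⟩ := ZMod.intCast_surjective (tmod N t)
  exact ⟨a, by rw [map_intCast, ha]⟩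

theorem exists_int_ge_tmod (N : ℕ) (t : Theta) (m : ℤ) :
    ∃ a : ℤ, m ≤ a ∧ tmod N (a : Theta) = tmod N t := by
  obtain ⟨a, ha⟩ := exists_int_tmod N t
  have hp : (1 : ℤ) ≤ (N.factorial : ℤ) := by exact_mod_cast N.factorial_pos
  -- Multiples of `N!` do not change the residue, and `|m| + |a|` of them suffice to reach `m`.
  refine ⟨a + (|m| + |a|) * N.factorial, ?_, ?_⟩
  · have h1 := neg_abs_le a
    have h2 := le_abs_self m
    nlinarith [abs_nonneg m, abs_nonneg a]
  · rw [← ha]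
    simp [map_intCast]

/-- Integers tending to `+∞` approximate every element of `Θ`. This makes spirals accumulate on
whole adding machines, and makes the adding machine recurrent. -/
theorem exists_seq_atTop (t : Theta) : ∃ u : ℕ → ℤ, Filter.Tendsto u Filter.atTop Filter.atTop ∧
    Filter.Tendsto (fun k => (u k : Theta)) Filter.atTop (𝓝 t) := by
  choose u h1 h2 using fun k : ℕ => exists_int_ge_tmod k t k
  refine ⟨u, Filter.tendsto_atTop_mono h1 tendsto_natCast_atTop_atTop, tendsto_theta fun N => ?_⟩
  filter_upwards [Filter.eventually_ge_atTop N] with k hk using tmod_eq_of_le hk (h2 k)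

theorem exists_seq_atBot (t : Theta) : ∃ u : ℕ → ℤ, Filter.Tendsto u Filter.atTop Filter.atBot ∧
    Filter.Tendsto (fun k => (u k : Theta)) Filter.atTop (𝓝 t) := by
  obtain ⟨u, h1, h2⟩ := exists_seq_atTop (-t)
  refine ⟨fun k => -u k, Filter.tendsto_neg_atTop_atBot.comp h1, ?_⟩
  have := h2.neg
  rw [neg_neg] at this
  simpa using this

theorem isClosed_theta : IsClosed (Theta : Set ((m : ℕ+) → ZMod m)) := by
  have : (Theta : Set ((m : ℕ+) → ZMod m)) = ⋂ (m : ℕ+) (n : ℕ+) (h : (m : ℕ) ∣ n),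
      {t | ZMod.castHom h (ZMod m) (t n) = t m} := by
    ext t
    simp only [mem_iInter, mem_ofPred_eq]
    rfl
  rw [this]
  refine isClosed_iInter fun m => isClosed_iInter fun n => isClosed_iInter fun h => ?_
  exact isClosed_eq (continuous_of_discreteTopology.comp (continuous_apply n)) (continuous_apply m)

instance : CompactSpace Theta := by
  have : ∀ m : ℕ+, Finite (ZMod m) := fun m => by
    have : NeZero (m : ℕ) := ⟨m.ne_zero⟩
    infer_instance
  exact isCompact_iff_compactSpace.1 isClosed_theta.isCompact

/-! ## The full spiral -/

/-- Translation by `r`, fixing `±∞`. -/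
def ZStar.add (r : ℤ) : ZStar → ZStar
  | negInf => negInf
  | int x => int (x + r)
  | posInf => posInf

/-- The substitution of `y` by `-∞`, `y` or `+∞`. -/
def Side.act : Side → ZStar → ZStar
  | L, _ => ZStar.negInf
  | M, y => y
  | R, _ => ZStar.posInf

/-- The composition of the substitutions `Side.act`. -/
def Side.comp : Side → Side → Side
  | L, _ => L
  | M, B => B
  | R, _ => R

theorem Side.act_comp (A B : Side) (y : ZStar) : (A.comp B).act y = A.act (B.act y) := by
  cases A <;> rfl

/-- The spiral `{(x, t) ∈ (ℤ ∪ {±∞}) × Θ : x = ±∞, or x ∈ ℤ and t = x}`. -/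
def Spiral : Type := {p : ZStar × Theta // ∀ x : ℤ, p.1 = ZStar.int x → p.2 = (x : Theta)}

namespace Spiral

/-- The translation of the spiral by `r`. -/
def add (r : ℤ) (s : Spiral) : Spiral :=
  ⟨(s.1.1.add r, s.1.2 + r), by
    obtain ⟨⟨y, t⟩, hs⟩ := s
    intro x hx
    cases y with
    | negInf => cases hx
    | posInf => cases hx
    | int y =>
      have h : y + r = x := ZStar.int.inj hx
      have ht : t = (y : Theta) := hs y rfl
      subst h
      change t + r = _
      rw [ht]
      push_cast
      rfl⟩

/-- The retraction of the spiral to one of its ends, or the identity. -/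
def side (K : Side) (s : Spiral) : Spiral :=
  ⟨(K.act s.1.1, s.1.2), by
    cases K with
    | L => intro x hx; cases hx
    | R => intro x hx; cases hx
    | M => exact s.2⟩

/-- The projection of the spiral to `PreSpiral N`. -/
def toPre (N : ℕ) (s : Spiral) : PreSpiral N :=
  ⟨(s.1.1, tmod N s.1.2), fun x hx => by
    change tmod N s.1.2 = _
    rw [s.2 x hx, map_intCast]⟩

/-- The projection of the spiral to `Σ_N`. -/
def toFin (N : ℕ) (s : Spiral) : FinSpiral N := (s.toPre N).proj

theorem ext' {s s' : Spiral} (h1 : s.1.1 = s'.1.1) (h2 : s.1.2 = s'.1.2) : s = s' :=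
  Subtype.ext (Prod.ext h1 h2)

theorem side_M (s : Spiral) : s.side Side.M = s := rfl

theorem side_comp (A B : Side) (s : Spiral) : s.side (A.comp B) = (s.side B).side A :=
  ext' (Side.act_comp A B _) rfl

theorem side_add (K : Side) (r : ℤ) (s : Spiral) : (s.add r).side K = (s.side K).add r := by
  cases K <;> rfl

theorem add_add (q r : ℤ) (s : Spiral) : (s.add q).add r = s.add (q + r) := by
  obtain ⟨⟨y, t⟩, hs⟩ := s
  refine ext' ?_ ?_
  · cases y <;> simp [add, ZStar.add, add_assoc]
  · simp [add, add_assoc]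

theorem add_comm' (q r : ℤ) (s : Spiral) : (s.add q).add r = (s.add r).add q := by
  rw [add_add, add_add, add_comm]

theorem add_zero' (s : Spiral) : s.add 0 = s := by
  obtain ⟨⟨y, t⟩, hs⟩ := s
  refine ext' ?_ ?_
  · cases y <;> simp [add, ZStar.add]
  · simp [add]

theorem toPre_add_one (N : ℕ) (s : Spiral) : (s.add 1).toPre N = (s.toPre N).tau := by
  obtain ⟨⟨y, t⟩, hs⟩ := s
  refine Subtype.ext (Prod.ext ?_ ?_)
  · cases y <;> rfl
  · simp [toPre, add, PreSpiral.tau]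

theorem toPre_surjective (N : ℕ) : Function.Surjective (toPre N) := by
  rintro ⟨⟨y, t⟩, hs⟩
  obtain ⟨a, rfl⟩ := ZMod.intCast_surjective t
  cases y with
  | int x =>
    refine ⟨⟨(ZStar.int x, (x : Theta)), fun y hy => by cases hy; rfl⟩, ?_⟩
    refine Subtype.ext (Prod.ext rfl ?_)
    change tmod N (x : Theta) = _
    rw [map_intCast]
    exact (hs x rfl).symm
  | negInf =>
    refine ⟨⟨(ZStar.negInf, (a : Theta)), fun y hy => by cases hy⟩, ?_⟩
    exact Subtype.ext (Prod.ext rfl (map_intCast _ _))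
  | posInf =>
    refine ⟨⟨(ZStar.posInf, (a : Theta)), fun y hy => by cases hy⟩, ?_⟩
    exact Subtype.ext (Prod.ext rfl (map_intCast _ _))

theorem toFin_surjective (N : ℕ) : Function.Surjective (toFin N) := by
  rintro ⟨_, s, rfl⟩
  obtain ⟨u, rfl⟩ := toPre_surjective N s
  exact ⟨u, rfl⟩

/-- Lifting `R_N` to the full spiral, where translations commute with retractions, leaves the finite
spirals to enter only through `toFin`. -/
theorem rel_iff {N : ℕ} {a b : FinSpiral N} :
    FinSpiral.Rel a b ↔ ∃ s : Spiral, s.toFin N = a ∧ (s.add 1).toFin N = b := by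
  constructor
  · rintro ⟨s, rfl, rfl⟩
    obtain ⟨u, rfl⟩ := toPre_surjective N s
    exact ⟨u, rfl, by rw [toFin, toPre_add_one]⟩
  · rintro ⟨s, rfl, rfl⟩
    exact ⟨s.toPre N, rfl, by rw [toFin, toPre_add_one]⟩

/-- Each bonding map is induced by a retraction of the full spiral, so long compositions can be
computed there. -/
theorem xiSide_toFin (K : Side) (N : ℕ) (s : Spiral) :
    xiSide K (s.toFin (N + 1)) = (s.side K).toFin N := by
  obtain ⟨⟨y, t⟩, hs⟩ := s
  refine Subtype.ext (Prod.ext ?_ ?_)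
  · cases K
    · rfl
    · cases y <;>
        simp [xiSide, toFin, toPre, PreSpiral.proj, side, Side.act, ZStar.collapse] <;> omega
    · rfl
  · cases K <;> exact factProj_tmod N t

theorem toFin_eq_of_le {M N : ℕ} (h : M ≤ N) {s s' : Spiral} (e : s.toFin N = s'.toFin N) :
    s.toFin M = s'.toFin M := by
  induction N, h using Nat.le_induction with
  | base => exact e
  | succ N _ ih =>
    refine ih ?_
    rw [← side_M s, ← side_M s', ← xiSide_toFin, ← xiSide_toFin, e]

theorem toFin_fst (N : ℕ) (s : Spiral) : (s.toFin N).1.1 = s.1.1.collapse N := rfl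

theorem toFin_ext {N : ℕ} {s s' : Spiral} (h1 : s.1.1.collapse N = s'.1.1.collapse N)
    (h2 : tmod N s.1.2 = tmod N s'.1.2) : s.toFin N = s'.toFin N :=
  Subtype.ext (Prod.ext h1 h2)

theorem tmod_eq_of_toFin_eq {N : ℕ} {s s' : Spiral} (e : s.toFin N = s'.toFin N) :
    tmod N s.1.2 = tmod N s'.1.2 := congrArg (fun a : FinSpiral N => a.1.2) e

/-- `collapse N` separates two positions once `N` is large compared with those that are integers;
the residues are handled by `ext_tmod`. -/
theorem ext_toFin {s s' : Spiral} (h : ∀ N, s.toFin N = s'.toFin N) : s = s' := by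
  refine ext' ?_ (ext_tmod fun N => tmod_eq_of_toFin_eq (h N))
  have hc : ∀ N : ℕ, s.1.1.collapse N = s'.1.1.collapse N :=
    fun N => congrArg (fun a : FinSpiral N => a.1.1) (h N)
  obtain ⟨⟨y, t⟩, hs⟩ := s
  obtain ⟨⟨y', t'⟩, hs'⟩ := s'
  change ∀ N : ℕ, y.collapse N = y'.collapse N at hc
  change y = y'
  cases y with
  | negInf =>
    cases y' with
    | negInf => rfl
    | int x => have := hc (x.natAbs + 1); simp only [ZStar.collapse] at this; omega
    | posInf => have := hc 1; simp only [ZStar.collapse] at this; omega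
  | posInf =>
    cases y' with
    | negInf => have := hc 1; simp only [ZStar.collapse] at this; omega
    | int x => have := hc (x.natAbs + 1); simp only [ZStar.collapse] at this; omega
    | posInf => rfl
  | int z =>
    cases y' with
    | negInf => have := hc (z.natAbs + 1); simp only [ZStar.collapse] at this; omega
    | posInf => have := hc (z.natAbs + 1); simp only [ZStar.collapse] at this; omega
    | int x =>
      have := hc (z.natAbs + x.natAbs + 1)
      simp only [ZStar.collapse] at this
      congr 1
      omega

end Spiral

/-- The point `x` of the spiral. -/
def Spiral.ofInt (x : ℤ) : Spiral :=
  ⟨(ZStar.int x, (x : Theta)), fun y hy => by cases hy; rfl⟩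

theorem Spiral.ofInt_add (x r : ℤ) : (Spiral.ofInt x).add r = Spiral.ofInt (x + r) :=
  Spiral.ext' rfl (Int.cast_add x r).symm

/-! ## Walks in finite spirals -/

theorem FinSpiral.rel_snd {n : ℕ} {a b : FinSpiral n} (h : FinSpiral.Rel a b) :
    b.1.2 = a.1.2 + 1 := by
  obtain ⟨s, rfl, rfl⟩ := h
  rfl

theorem FinSpiral.fst_mem {n : ℕ} (a : FinSpiral n) : -(n : ℤ) ≤ a.1.1 ∧ a.1.1 ≤ n := by
  obtain ⟨_, ⟨⟨y, t⟩, hs⟩, rfl⟩ := a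
  cases y <;> simp only [ZStar.collapse] <;> omega

theorem FinSpiral.snd_eq_of_interior {n : ℕ} {a : FinSpiral n} (h1 : -(n : ℤ) < a.1.1)
    (h2 : a.1.1 < n) : a.1.2 = ((a.1.1 : ℤ) : ZMod n.factorial) := by
  obtain ⟨_, ⟨⟨y, t⟩, hs⟩, rfl⟩ := a
  cases y with
  | negInf => simp only [ZStar.collapse] at h1; omega
  | posInf => simp only [ZStar.collapse] at h2; omega
  | int x =>
    simp only [ZStar.collapse] at h1 h2 ⊢
    have : max (-(n : ℤ)) (min n x) = x := by omega
    rw [this]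
    exact hs x rfl

theorem FinSpiral.rel_fst {n : ℕ} {a b : FinSpiral n} (h : FinSpiral.Rel a b) :
    (a.1.1 = -n ∧ b.1.1 = -n) ∨ (a.1.1 = n ∧ b.1.1 = n) ∨ (a.1.1 < n ∧ b.1.1 = a.1.1 + 1) := by
  obtain ⟨⟨⟨y, t⟩, hs⟩, rfl, rfl⟩ := h
  cases y with
  | negInf => exact Or.inl ⟨rfl, rfl⟩
  | posInf => exact Or.inr (Or.inl ⟨rfl, rfl⟩)
  | int x =>
    simp only [PreSpiral.proj, PreSpiral.tau, ZStar.collapse, ZStar.shift]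
    omega

/-- A bi-infinite walk in a finite spiral stays at one of the ends, or crosses once. -/
theorem exists_side_of_walk {n : ℕ} {f : ℤ → FinSpiral n}
    (hf : ∀ x, FinSpiral.Rel (f x) (f (x + 1))) :
    ∃ (K : Side) (r : ℤ), ∀ x, f x = ((Spiral.ofInt (x + r)).side K).toFin n := by
  have hsnd : ∀ x y : ℤ, (f x).1.2 = (f y).1.2 + ((x - y : ℤ) : ZMod n.factorial) := by
    intro x y
    induction x using Int.inductionOn' (b := y) with
    | zero => simp
    | succ k _ ih => rw [FinSpiral.rel_snd (hf k), ih]; push_cast; ring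
    | pred k _ ih =>
      have := FinSpiral.rel_snd (hf (k - 1))
      rw [sub_add_cancel, ih] at this
      rw [← sub_eq_iff_eq_add.2 this]
      push_cast
      ring
  obtain ⟨r₀, hr₀⟩ := ZMod.intCast_surjective (f 0).1.2
  have hfst : ∀ x, _ := fun x => FinSpiral.rel_fst (hf x)
  have hmem : ∀ x, _ := fun x => FinSpiral.fst_mem (f x)
  -- A visit to the interior fixes position and residue, hence the whole walk. Without one the
  -- position is constant, since it moves by at most one at a time.
  by_cases hint : ∃ x₀, -(n : ℤ) < (f x₀).1.1 ∧ (f x₀).1.1 < n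
  · obtain ⟨x₀, h1, h2⟩ := hint
    refine ⟨Side.M, (f x₀).1.1 - x₀, fun x => Subtype.ext (Prod.ext ?_ ?_)⟩
    · change (f x).1.1 = max (-(n : ℤ)) (min n (x + ((f x₀).1.1 - x₀)))
      induction x using Int.inductionOn' (b := x₀) with
      | zero => omega
      | succ k _ ih => have := hfst k; have := hmem k; have := hmem (k + 1); omega
      | pred k _ ih =>
        have := hfst (k - 1)
        have := hmem (k - 1)
        have := hmem k
        rw [sub_add_cancel] at *
        omega
    · change (f x).1.2 = tmod n ((x + ((f x₀).1.1 - x₀) : ℤ) : Theta)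
      rw [hsnd x x₀, FinSpiral.snd_eq_of_interior h1 h2, map_intCast]
      push_cast
      ring
  · push Not at hint
    have hsnd' : ∀ x, (f x).1.2 = tmod n ((x + r₀ : ℤ) : Theta) := fun x => by
      rw [hsnd x 0, ← hr₀, map_intCast]
      push_cast
      ring
    have hconst : ∀ x, (f x).1.1 = (f 0).1.1 := by
      intro x
      induction x using Int.inductionOn' (b := 0) with
      | zero => rfl
      | succ k _ ih =>
        have := hfst k; have := hmem k; have := hmem (k + 1); have := hint k
        have := hint (k + 1); omega
      | pred k _ ih =>
        have := hfst (k - 1); have := hmem (k - 1); have := hmem k; have := hint k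
        have := hint (k - 1)
        rw [sub_add_cancel] at *
        omega
    by_cases h0 : (f 0).1.1 = -n
    · exact ⟨Side.L, r₀, fun x => Subtype.ext (Prod.ext ((hconst x).trans h0) (hsnd' x))⟩
    · have : (f 0).1.1 = n := by have := hint 0; have := hmem 0; omega
      exact ⟨Side.R, r₀, fun x => Subtype.ext (Prod.ext ((hconst x).trans this) (hsnd' x))⟩

/-! ## Coordinates on the space of the Special Homeomorphism -/

/-- The components of `D \ C`. -/
abbrev Gap : Type := gaps setD cantorSet

/-- The real coordinate. -/
def dpos (p : SpecialSpace) : ℝ := p.1.1.1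

/-- The adding machine coordinate. -/
def theta (p : SpecialSpace) : Theta := p.1.1.2

/-- The point `t` of the adding machine over `a`. -/
def mach {a : ℝ} (ha : a ∈ cantorSet) (t : Theta) (c : cantorSet) : SpecialSpace :=
  (⟨(a, t), Or.inl ha⟩, c)

/-- The wandering point `x` over the gap `j`. -/
noncomputable def wand (j : Gap) (x : ℤ) (c : cantorSet) : SpecialSpace :=
  (⟨(qPoint j x, (x : Theta)), Or.inr ⟨j.1, j.2, x, rfl⟩⟩, c)

theorem special_ext {p p' : SpecialSpace} (h1 : dpos p = dpos p') (h2 : theta p = theta p')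
    (h3 : p.2 = p'.2) : p = p' :=
  Prod.ext (Subtype.ext (Prod.ext h1 h2)) h3

theorem special_cases (p : SpecialSpace) :
    (∃ h : dpos p ∈ cantorSet, p = mach h (theta p) p.2) ∨ ∃ (j : Gap) (x : ℤ), p = wand j x p.2 := by
  rcases p.1.2 with h | ⟨j, hj, x, h⟩
  · exact Or.inl ⟨h, rfl⟩
  · exact Or.inr ⟨⟨j, hj⟩, x, Prod.ext (Subtype.ext h) rfl⟩

theorem continuous_dpos : Continuous dpos := by unfold dpos; fun_prop

theorem continuous_theta : Continuous theta := by unfold theta; fun_prop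

theorem dpos_special_of_mem {p : SpecialSpace} (h : dpos p ∈ cantorSet) :
    dpos (specialHomeo p) = dpos p := by
  have := congrArg Prod.fst (spiralTau_base p.1 h)
  exact this

theorem special_wand (j : Gap) (x : ℤ) (c : cantorSet) :
    specialHomeo (wand j x c) = wand j (x + 1) c :=
  Prod.ext (Subtype.ext (spiralTau_wandering (wand j x c).1 j.2 rfl)) rfl

theorem special_mach {a : ℝ} (ha : a ∈ cantorSet) (t : Theta) (c : cantorSet) :
    specialHomeo (mach ha t c) = mach ha (t + 1) c :=
  special_ext (dpos_special_of_mem (p := mach ha t c) ha) rfl rfl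

theorem Gap.lt (j : Gap) : j.1.1 < j.1.2 := j.2.1

theorem dpos_wand (j : Gap) (x : ℤ) (c : cantorSet) :
    dpos (wand j x c) ∈ Ioo j.1.1 j.1.2 := qPoint_mem j.lt x

theorem dpos_mem_setD (p : SpecialSpace) : dpos p ∈ setD := by
  rcases special_cases p with ⟨h, -⟩ | ⟨j, x, h⟩
  · exact cantorSet_subset_setD h
  · rw [h]
    exact (j.2.2.2.2 (dpos_wand j x p.2)).1

theorem eq_wand_of_mem {p : SpecialSpace} {j : Gap} (h : dpos p ∈ Ioo j.1.1 j.1.2) :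
    ∃ x, p = wand j x p.2 := by
  rcases special_cases p with ⟨h', -⟩ | ⟨k, x, h'⟩
  · exact absurd h' (j.2.2.2.2 h).2
  · have : k = j := Subtype.ext (gaps_unique k.2 j.2 (h' ▸ dpos_wand k x p.2) h)
    subst this
    exact ⟨x, h'⟩

theorem dpos_mem_cantorSet_or (p : SpecialSpace) :
    dpos p ∈ cantorSet ∨ ∃ j : Gap, dpos p ∈ Ioo j.1.1 j.1.2 := by
  rcases special_cases p with ⟨h, -⟩ | ⟨k, x, h'⟩
  · exact Or.inl h
  · exact Or.inr ⟨k, h' ▸ dpos_wand k x p.2⟩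

/-- The position of a point in the interval `j`, on a logarithmic scale. -/
noncomputable def gapLevel (j : ℝ × ℝ) (d : ℝ) : ℝ := Real.logb 2 ((d - j.1) / (j.2 - d))

theorem gapLevel_qPoint {j : ℝ × ℝ} (hj : j.1 < j.2) (x : ℤ) : gapLevel j (qPoint j x) = x := by
  have h : (0 : ℝ) < 2 ^ x := by positivity
  have hl : j.2 - j.1 ≠ 0 := by linarith
  have e : (qPoint j x - j.1) / (j.2 - qPoint j x) = (2 : ℝ) ^ x := by
    have e1 : qPoint j x - j.1 = (j.2 - j.1) * (2 ^ x / (1 + 2 ^ x)) := by unfold qPoint; ring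
    have e2 : j.2 - qPoint j x = (j.2 - j.1) * (1 / (1 + 2 ^ x)) := by
      unfold qPoint
      field_simp
      ring
    rw [e1, e2, mul_div_mul_left _ _ hl]
    field_simp
  rw [gapLevel, e, ← Real.rpow_intCast, Real.logb_rpow (by norm_num) (by norm_num)]

theorem qPoint_strictMono {j : ℝ × ℝ} (hj : j.1 < j.2) : StrictMono (qPoint j) := by
  intro x y hxy
  have h1 : (0 : ℝ) < 2 ^ x := by positivity
  have h2 : (2 : ℝ) ^ x < 2 ^ y := zpow_lt_zpow_right₀ (by norm_num) hxy
  unfold qPoint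
  have : (2 : ℝ) ^ x / (1 + 2 ^ x) < 2 ^ y / (1 + 2 ^ y) := by
    rw [div_lt_div_iff₀ (by linarith) (by linarith)]
    nlinarith
  have hl : 0 < j.2 - j.1 := by linarith
  nlinarith

theorem continuousAt_gapLevel {j : ℝ × ℝ} {d : ℝ} (h : d ∈ Ioo j.1 j.2) :
    ContinuousAt (gapLevel j) d := by
  have h1 : 0 < d - j.1 := by linarith [h.1]
  have h2 : 0 < j.2 - d := by linarith [h.2]
  unfold gapLevel Real.logb
  have : ContinuousAt (fun d => (d - j.1) / (j.2 - d)) d :=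
    ContinuousAt.div (by fun_prop) (by fun_prop) h2.ne'
  exact (this.log (div_pos h1 h2).ne').div_const _

theorem tendsto_two_zpow_atBot :
    Filter.Tendsto (fun x : ℤ => (2 : ℝ) ^ x) Filter.atBot (𝓝 0) := by
  have h := (tendsto_rpow_atBot_of_base_gt_one 2 (by norm_num)).comp
    (tendsto_intCast_atBot_iff.2 Filter.tendsto_id)
  refine h.congr fun x => ?_
  simp [Real.rpow_intCast]

theorem tendsto_qPoint_atTop (j : ℝ × ℝ) : Filter.Tendsto (qPoint j) Filter.atTop (𝓝 j.2) := by
  have h0 : Filter.Tendsto (fun x : ℤ => (2 : ℝ) ^ (-x)) Filter.atTop (𝓝 0) :=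
    tendsto_two_zpow_atBot.comp Filter.tendsto_neg_atTop_atBot
  have e : qPoint j = fun x : ℤ => j.1 + (j.2 - j.1) * (1 / (1 + (2 : ℝ) ^ (-x))) := by
    ext x
    have h : (0 : ℝ) < 2 ^ x := by positivity
    unfold qPoint
    rw [zpow_neg]
    congr 2
    field_simp
    ring
  rw [e]
  have := (((tendsto_const_nhds (x := (1 : ℝ))).div (tendsto_const_nhds.add h0)
    (by norm_num : (1 : ℝ) + 0 ≠ 0)).const_mul (j.2 - j.1)).const_add j.1
  simpa using this

theorem tendsto_qPoint_atBot (j : ℝ × ℝ) : Filter.Tendsto (qPoint j) Filter.atBot (𝓝 j.1) := by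
  have h0 := tendsto_two_zpow_atBot
  unfold qPoint
  have := ((h0.div (tendsto_const_nhds.add h0)
    (by norm_num : (1 : ℝ) + 0 ≠ 0)).const_mul (j.2 - j.1)).const_add j.1
  simpa using this

/-! ## Compactness -/

/-- On a gap the logarithmic level turns the wandering points into the graph of `ℤ → Θ`, which is
closed in `ℝ × Θ`; so they do not accumulate at other points over the open gap. Outside the closed
set `D` there is nothing. -/
theorem isClosed_spiralSpace : IsClosed (SpiralSpace setD cantorSet) := by
  have hS : IsClosed (range fun x : ℤ => ((x : ℝ), (x : Theta))) := by
    have h1 : IsClosedEmbedding (Prod.map ((↑) : ℤ → ℝ) (id : Theta → Theta)) :=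
      Int.isClosedEmbedding_coe_real.prodMap .id
    have h2 : IsClosed {q : ℤ × Theta | q.2 = (q.1 : Theta)} :=
      isClosed_eq continuous_snd (continuous_of_discreteTopology.comp continuous_fst)
    convert h1.isClosedMap _ h2 using 1
    ext ⟨d, t⟩
    constructor
    · rintro ⟨x, hx⟩
      exact ⟨(x, (x : Theta)), rfl, hx⟩
    · rintro ⟨⟨x, t'⟩, h, hx⟩
      obtain rfl : t' = (x : Theta) := h
      exact ⟨x, hx⟩
  rw [← isOpen_compl_iff, isOpen_iff_mem_nhds]
  rintro ⟨d, t⟩ h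
  have hc : d ∉ cantorSet := fun hc => h (Or.inl hc)
  by_cases hd : d ∈ setD
  · obtain ⟨j, hj, hdj⟩ := exists_gap_of_mem_setD hd hc
    have hcont : ContinuousAt (fun q : ℝ × Theta => (gapLevel j q.1, q.2)) (d, t) :=
      (ContinuousAt.comp (x := ((d, t) : ℝ × Theta)) (f := Prod.fst) (g := gapLevel j)
        (continuousAt_gapLevel hdj) continuousAt_fst).prodMk continuousAt_snd
    have hn : (gapLevel j d, t) ∉ range fun x : ℤ => ((x : ℝ), (x : Theta)) := by
      rintro ⟨x, hx⟩
      obtain ⟨h1, rfl⟩ := Prod.mk.inj hx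
      refine h (Or.inr ⟨j, hj, x, Prod.ext ?_ rfl⟩)
      have hu : 0 < (d - j.1) / (j.2 - d) :=
        div_pos (by linarith [hdj.1]) (by linarith [hdj.2])
      have h2 : (d - j.1) / (j.2 - d) = 2 ^ x := by
        rw [← Real.rpow_intCast, h1, gapLevel, Real.rpow_logb (by norm_num) (by norm_num) hu]
      have h3 : j.2 - d ≠ 0 := by linarith [hdj.2]
      have h4 : (0 : ℝ) < 2 ^ x := by positivity
      rw [div_eq_iff h3] at h2
      change d = qPoint j x
      unfold qPoint
      field_simp
      linarith
    have h1 := hcont.eventually (hS.isOpen_compl.mem_nhds hn)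
    have h2 : ∀ᶠ q : ℝ × Theta in 𝓝 (d, t), q.1 ∈ Ioo j.1 j.2 :=
      continuousAt_fst.eventually (isOpen_Ioo.mem_nhds hdj)
    filter_upwards [h1, h2] with q hq1 hq2 hq
    rcases hq with hq | ⟨k, hk, x, rfl⟩
    · exact (hj.2.2.2 hq2).2 hq
    · obtain rfl := gaps_unique hk hj (qPoint_mem hk.1 x) hq2
      exact hq1 ⟨x, by simp [gapLevel_qPoint hj.1]⟩
  · have : ∀ᶠ q : ℝ × Theta in 𝓝 (d, t), q.1 ∉ setD :=
      continuousAt_fst.eventually (isClosed_setD.isOpen_compl.mem_nhds (show d ∈ setDᶜ from hd))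
    filter_upwards [this] with q hq h'
    exact hq (dpos_mem_setD (⟨q, h'⟩, ⟨0, zero_mem_cantorSet⟩))

instance : CompactSpace cantorSet := isCompact_iff_compactSpace.1 isCompact_cantorSet

instance : CompactSpace (SpiralSpace setD cantorSet) := by
  refine isCompact_iff_compactSpace.1 (IsCompact.of_isClosed_subset
    ((isCompact_Icc (a := (0 : ℝ)) (b := 1)).prod (isCompact_univ (X := Theta)))
    isClosed_spiralSpace fun q hq => ⟨?_, mem_univ _⟩)
  exact setD_subset_unitInterval (dpos_mem_setD (⟨q, hq⟩, ⟨0, zero_mem_cantorSet⟩))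

instance : TotallyDisconnectedSpace cantorSet :=
  cantorSetHomeomorphNatToBool.symm.totallyDisconnectedSpace

/-! ## The retractions to spirals -/

/-- The position of a point relative to the gap `j`. -/
noncomputable def spos (j : Gap) (p : SpecialSpace) : ZStar :=
  open Classical in
  if dpos p ≤ j.1.1 then .negInf else if j.1.2 ≤ dpos p then .posInf
  -- The only points over the open gap are the wandering ones, whose level is an integer, so the
  -- floor loses nothing.
  else .int ⌊gapLevel j (dpos p)⌋

theorem spos_of_le {j : Gap} {p : SpecialSpace} (h : dpos p ≤ j.1.1) : spos j p = .negInf :=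
  if_pos h

theorem spos_of_ge {j : Gap} {p : SpecialSpace} (h : j.1.2 ≤ dpos p) : spos j p = .posInf := by
  unfold spos
  rw [if_neg (by linarith [j.lt]), if_pos h]

theorem spos_wand (j : Gap) (x : ℤ) (c : cantorSet) : spos j (wand j x c) = .int x := by
  have h := dpos_wand j x c
  have e : gapLevel j (dpos (wand j x c)) = x := gapLevel_qPoint j.lt x
  unfold spos
  rw [if_neg (by linarith [h.1]), if_neg (by linarith [h.2]), e, Int.floor_intCast]

theorem spos_cases (j : Gap) (p : SpecialSpace) :
    (dpos p ≤ j.1.1 ∧ spos j p = .negInf) ∨ (j.1.2 ≤ dpos p ∧ spos j p = .posInf) ∨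
      ∃ x, p = wand j x p.2 ∧ spos j p = .int x := by
  by_cases h1 : dpos p ≤ j.1.1
  · exact Or.inl ⟨h1, spos_of_le h1⟩
  by_cases h2 : j.1.2 ≤ dpos p
  · exact Or.inr (Or.inl ⟨h2, spos_of_ge h2⟩)
  obtain ⟨x, hx⟩ := eq_wand_of_mem ⟨not_le.1 h1, not_le.1 h2⟩
  exact Or.inr (Or.inr ⟨x, hx, hx ▸ spos_wand j x p.2⟩)

theorem eq_wand_of_spos {j : Gap} {p : SpecialSpace} {x : ℤ} (h : spos j p = .int x) :
    p = wand j x p.2 := by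
  rcases spos_cases j p with ⟨-, h'⟩ | ⟨-, h'⟩ | ⟨y, h1, h'⟩ <;> rw [h] at h' <;> cases h'
  exact h1

/-- The equivariant retraction of the space to the spiral over the gap `j`. -/
noncomputable def loc (j : Gap) (p : SpecialSpace) : Spiral :=
  ⟨(spos j p, theta p), fun x hx => by
    change theta p = _
    rw [eq_wand_of_spos hx]
    rfl⟩

theorem loc_wand (j : Gap) (x : ℤ) (c : cantorSet) : loc j (wand j x c) = Spiral.ofInt x :=
  Spiral.ext' (spos_wand j x c) rfl

/-- Points over `C` keep their real coordinate, and a point over another gap stays over it, on one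
side of `j`. Only points over `j` itself change position, by one. -/
theorem loc_special (j : Gap) (p : SpecialSpace) : loc j (specialHomeo p) = (loc j p).add 1 := by
  refine Spiral.ext' ?_ ?_
  · change spos j (specialHomeo p) = (spos j p).add 1
    rcases special_cases p with ⟨h, -⟩ | ⟨k, x, h⟩
    · have e := dpos_special_of_mem h
      rcases spos_cases j p with ⟨h1, h2⟩ | ⟨h1, h2⟩ | ⟨x, h1, -⟩
      · rw [h2, spos_of_le (by rw [e]; exact h1)]; rfl
      · rw [h2, spos_of_ge (by rw [e]; exact h1)]; rfl
      · rw [h1] at h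
        exact absurd h (j.2.2.2.2 (dpos_wand j x p.2)).2
    · rw [h, special_wand]
      generalize p.2 = c
      by_cases hk : k = j
      · subst hk
        rw [spos_wand, spos_wand]; rfl
      · have h1 := dpos_wand k x c
        have h2 := dpos_wand k (x + 1) c
        have hno : ∀ y, spos j (wand k y c) = .negInf ∧ k.1.1 ≤ j.1.1 ∨
            spos j (wand k y c) = .posInf ∧ j.1.1 < k.1.1 := by
          intro y
          have h3 := dpos_wand k y c
          rcases spos_cases j (wand k y c) with ⟨h1, h2⟩ | ⟨h1, h2⟩ | ⟨z, h1, -⟩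
          · exact Or.inl ⟨h2, by linarith [h3.1]⟩
          · refine Or.inr ⟨h2, not_le.1 fun hle => ?_⟩
            have : j.1.2 ∈ Ioo k.1.1 k.1.2 := ⟨by linarith [j.lt], lt_of_le_of_lt h1 h3.2⟩
            exact (k.2.2.2.2 this).2 j.2.2.2.1
          · have h4 := dpos_wand j z (wand k y c).2
            rw [← h1] at h4
            exact absurd (Subtype.ext (gaps_unique k.2 j.2 h3 h4)) hk
        rcases hno x with ⟨a1, a2⟩ | ⟨a1, a2⟩ <;> rcases hno (x + 1) with ⟨b1, b2⟩ | ⟨b1, b2⟩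
        · rw [a1, b1]; rfl
        · linarith
        · linarith
        · rw [a1, b1]; rfl
  · change theta p + 1 = theta p + ((1 : ℤ) : Theta)
    rw [Int.cast_one]

/-- No point of the space has real coordinate strictly between `q(j, m - 1)` and `q(j, m)`, so the
closed condition is also an open one. -/
theorem isClopen_spos_ge (j : Gap) (m : ℤ) :
    IsClopen {p : SpecialSpace | qPoint j m ≤ dpos p} := by
  refine ⟨isClosed_le continuous_const continuous_dpos, ?_⟩
  have : {p : SpecialSpace | qPoint j m ≤ dpos p} = {p | qPoint j (m - 1) < dpos p} := by
    ext p
    have h1 := qPoint_mem j.lt m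
    have h2 := qPoint_mem j.lt (m - 1)
    have h3 := qPoint_strictMono j.lt (show m - 1 < m by omega)
    refine ⟨fun h => h3.trans_le h, fun h => ?_⟩
    change qPoint j (m - 1) < dpos p at h
    change _ ≤ dpos p
    by_cases hp : j.1.2 ≤ dpos p
    · linarith [h1.2]
    · obtain ⟨x, hx⟩ := eq_wand_of_mem (p := p) (j := j) ⟨by linarith [h2.1], not_le.1 hp⟩
      have e : dpos p = qPoint j x := by rw [hx]; rfl
      rw [e] at h ⊢
      have := (qPoint_strictMono j.lt).lt_iff_lt.1 h
      exact (qPoint_strictMono j.lt).monotone (by omega)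
  rw [this]
  exact isOpen_lt continuous_const continuous_dpos

instance (N : ℕ) : TopologicalSpace (FinSpiral N) := ⊥

instance (N : ℕ) : DiscreteTopology (FinSpiral N) := ⟨rfl⟩

instance (N : ℕ) : DiscreteTopology (W N) := ⟨rfl⟩

theorem continuous_toFin_of {Y : Type*} [TopologicalSpace Y] {N : ℕ} {s : Y → Spiral}
    (h1 : Continuous fun y => (s y).1.1.collapse N) (h2 : Continuous fun y => tmod N (s y).1.2) :
    Continuous fun y => (s y).toFin N := by
  rw [continuous_discrete_rng]
  intro b
  have : (fun y => (s y).toFin N) ⁻¹' {b} =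
      (fun y => (s y).1.1.collapse N) ⁻¹' {b.1.1} ∩ (fun y => tmod N (s y).1.2) ⁻¹' {b.1.2} := by
    ext y
    exact ⟨fun h => by obtain rfl : (s y).toFin N = b := h
                       exact ⟨rfl, rfl⟩,
      fun h => Subtype.ext (Prod.ext h.1 h.2)⟩
  rw [this]
  exact ((isOpen_discrete _).preimage h1).inter ((isOpen_discrete _).preimage h2)

/-- For `K = M` the superlevel sets of the collapsed position are clopen: they are trivial outside
the range `-N < m ≤ N`, and otherwise are cut out by the point `q(j, m - r)`. -/
theorem continuous_loc (j : Gap) (r : ℤ) (K : Side) (N : ℕ) :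
    Continuous fun p => (((loc j p).add r).side K).toFin N := by
  refine continuous_toFin_of ?_ ?_
  · cases K with
    | L => exact continuous_const
    | R => exact continuous_const
    | M =>
      have key : ∀ m : ℤ, IsClopen {p | m ≤ (((loc j p).add r).side .M).1.1.collapse N} := by
        intro m
        by_cases h1 : m ≤ -N
        · convert isClopen_univ
          simp only [eq_univ_iff_forall]
          intro p
          change m ≤ ((spos j p).add r).collapse N
          generalize spos j p = y
          cases y <;> simp only [ZStar.add, ZStar.collapse] <;> omega
        by_cases h2 : (N : ℤ) < m
        · convert isClopen_empty
          simp only [eq_empty_iff_forall_notMem]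
          intro p
          change ¬ m ≤ ((spos j p).add r).collapse N
          generalize spos j p = y
          cases y <;> simp only [ZStar.add, ZStar.collapse] <;> omega
        · convert isClopen_spos_ge j (m - r) using 1
          ext p
          change m ≤ ((spos j p).add r).collapse N ↔ qPoint j (m - r) ≤ dpos p
          have hq := qPoint_mem j.lt (m - r)
          rcases spos_cases j p with ⟨a1, a2⟩ | ⟨a1, a2⟩ | ⟨x, a1, a2⟩
          · rw [a2]
            simp only [ZStar.add, ZStar.collapse]
            exact ⟨fun h => absurd h h1, fun h => by linarith [hq.1]⟩
          · rw [a2]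
            simp only [ZStar.add, ZStar.collapse]
            exact ⟨fun h => by linarith [hq.2], fun h => by omega⟩
          · have e : dpos p = qPoint j x := by rw [a1]; rfl
            rw [a2, e, (qPoint_strictMono j.lt).le_iff_le]
            simp only [ZStar.add, ZStar.collapse]
            omega
      rw [continuous_discrete_rng]
      intro b
      convert ((key b).diff (key (b + 1))).isOpen using 1
      ext p
      simp only [mem_preimage, mem_singleton_iff, mem_sdiff, mem_ofPred_eq]
      omega
  · exact (tmod_continuous N).comp (continuous_theta.add continuous_const)

/-! ## Density of the wandering orbits -/

theorem tendsto_special {u : ℕ → SpecialSpace} {p : SpecialSpace}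
    (h1 : Filter.Tendsto (fun k => dpos (u k)) Filter.atTop (𝓝 (dpos p)))
    (h2 : Filter.Tendsto (fun k => theta (u k)) Filter.atTop (𝓝 (theta p)))
    (h3 : ∀ k, (u k).2 = p.2) : Filter.Tendsto u Filter.atTop (𝓝 p) := by
  refine Prod.tendsto_iff _ _ |>.2 ⟨?_, ?_⟩
  · rw [tendsto_subtype_rng, nhds_prod_eq]
    exact h1.prodMk h2
  · simp only [h3]
    exact tendsto_const_nhds

/-- The closed spiral over the gap `j`. -/
def spiralOver (j : Gap) (c : cantorSet) : Set SpecialSpace :=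
  {p | dpos p ∈ Icc j.1.1 j.1.2 ∧ p.2 = c}

theorem wand_mem_spiralOver (j : Gap) (x : ℤ) (c : cantorSet) : wand j x c ∈ spiralOver j c :=
  ⟨Ioo_subset_Icc_self (dpos_wand j x c), rfl⟩

theorem spiralOver_subset_closure (j : Gap) (c : cantorSet) :
    spiralOver j c ⊆ closure (range fun x => wand j x c) := by
  rintro p ⟨⟨h1, h2⟩, rfl⟩
  rcases h1.eq_or_lt with h1 | h1
  · obtain ⟨u, hu, ht⟩ := exists_seq_atBot (theta p)
    refine mem_closure_of_tendsto (tendsto_special (u := fun k => wand j (u k) p.2) ?_ ht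
      fun _ => rfl) (Filter.Eventually.of_forall fun k => ⟨u k, rfl⟩)
    rw [← h1]
    exact (tendsto_qPoint_atBot j).comp hu
  rcases h2.eq_or_lt with h2 | h2
  · obtain ⟨u, hu, ht⟩ := exists_seq_atTop (theta p)
    refine mem_closure_of_tendsto (tendsto_special (u := fun k => wand j (u k) p.2) ?_ ht
      fun _ => rfl) (Filter.Eventually.of_forall fun k => ⟨u k, rfl⟩)
    rw [h2]
    exact (tendsto_qPoint_atTop j).comp hu
  · obtain ⟨x, hx⟩ := eq_wand_of_mem ⟨h1, h2⟩
    exact subset_closure ⟨x, hx.symm⟩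

theorem mach_mem_closure {a : ℝ} (ha : a ∈ cantorSet) (t : Theta) (c : cantorSet) :
    mach ha t c ∈ closure (range fun x : ℤ => mach ha (x : Theta) c) := by
  obtain ⟨u, -, ht⟩ := exists_seq_atTop t
  exact mem_closure_of_tendsto (tendsto_special (u := fun k => mach ha (u k : Theta) c)
    tendsto_const_nhds ht fun _ => rfl) (Filter.Eventually.of_forall fun k => ⟨u k, rfl⟩)

/-- Every Cantor point is a limit of gaps, and the position over each of these gaps can be chosen to
approximate a prescribed element of `Θ`. -/
theorem exists_wand_mem {O : Set SpecialSpace} (hO : IsOpen O) (hne : O.Nonempty) :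
    ∃ j x c, wand j x c ∈ O := by
  obtain ⟨p, hp⟩ := hne
  rcases special_cases p with ⟨h, -⟩ | ⟨j, x, h⟩
  · obtain ⟨u, -, ht⟩ := exists_seq_atTop (theta p)
    choose j hj h1 h2 using fun k : ℕ => exists_gap_near h (δ := 1 / ((k : ℝ) + 1)) (by positivity)
    have hz := tendsto_one_div_add_atTop_nhds_zero_nat (𝕜 := ℝ)
    have : Filter.Tendsto (fun k => wand ⟨j k, hj k⟩ (u k) p.2) Filter.atTop (𝓝 p) := by
      refine tendsto_special ?_ ht fun _ => rfl
      refine tendsto_of_tendsto_of_tendsto_of_le_of_le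
        (g := fun k : ℕ => dpos p - 1 / ((k : ℝ) + 1)) (h := fun k : ℕ => dpos p + 1 / ((k : ℝ) + 1))
        (by simpa using hz.const_sub (dpos p)) (by simpa using hz.const_add (dpos p)) ?_ ?_
      · intro k
        have := dpos_wand ⟨j k, hj k⟩ (u k) p.2
        linarith [this.1, (h1 k).1]
      · intro k
        have := dpos_wand ⟨j k, hj k⟩ (u k) p.2
        linarith [this.2, (h2 k).2]
    obtain ⟨k, hk⟩ := (this.eventually (hO.mem_nhds hp)).exists
    exact ⟨_, _, _, hk⟩
  · exact ⟨j, x, p.2, h ▸ hp⟩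

/-! ## The space is a Cantor space -/

theorem exists_ne_mem_cantorSet {O : Set cantorSet} (hO : IsOpen O) {c : cantorSet} (hc : c ∈ O) :
    ∃ c' ∈ O, c' ≠ c := by
  obtain ⟨δ, hδ, hb⟩ := Metric.isOpen_iff.1 hO c hc
  obtain ⟨j, hj, h1, h2⟩ := exists_gap_near c.2 hδ
  by_cases h : j.1 = c
  · refine ⟨⟨j.2, hj.2.2.1⟩, hb ?_, fun e => ?_⟩
    · rw [Metric.mem_ball, Subtype.dist_eq, Real.dist_eq, abs_lt]
      constructor <;> linarith [h2.1, h2.2]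
    · have : j.2 = c := congrArg Subtype.val e
      linarith [hj.1]
  · refine ⟨⟨j.1, hj.2.1⟩, hb ?_, fun e => h (congrArg Subtype.val e)⟩
    rw [Metric.mem_ball, Subtype.dist_eq, Real.dist_eq, abs_lt]
    constructor <;> linarith [h1.1, h1.2]

theorem isClopen_dpos_lt {e : ℝ} (he : e ∉ setD) : IsClopen {p : SpecialSpace | dpos p < e} := by
  refine ⟨?_, isOpen_lt continuous_dpos continuous_const⟩
  have : {p : SpecialSpace | dpos p < e} = {p | dpos p ≤ e} := by
    ext p
    exact ⟨fun (h : dpos p < e) => show dpos p ≤ e from h.le, fun h => lt_of_le_of_ne h fun (h' : dpos p = e) => he (h' ▸ dpos_mem_setD p)⟩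
  rw [this]
  exact isClosed_le continuous_dpos continuous_const

theorem exists_notMem_cantorSet {u v : ℝ} (h : u < v) : ∃ e ∈ Ioo u v, e ∉ cantorSet := by
  by_cases hm : (u + v) / 2 ∈ cantorSet
  · obtain ⟨j, hj, h1, h2⟩ := exists_gap_near hm (δ := (v - u) / 2) (by linarith)
    have hj1 := hj.1
    exact ⟨(j.1 + j.2) / 2, ⟨by linarith [h1.1], by linarith [h2.2]⟩,
      (hj.2.2.2 ⟨by linarith, by linarith⟩).2⟩
  · exact ⟨_, ⟨by linarith, by linarith⟩, hm⟩

/-- One half of an antisymmetry argument. Between two Cantor points there is a point outside `C`: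
either it is in a gap, whose retraction separates them, or it is outside `D` and is itself a cut. -/
theorem dpos_eq_of_forall {p p' : SpecialSpace} (h1 : ∀ j N, (loc j p).toFin N = (loc j p').toFin N)
    (h2 : ∀ e ∉ setD, dpos p < e ↔ dpos p' < e) : ¬ dpos p < dpos p' := by
  intro hlt
  have hl : ∀ j, spos j p = spos j p' := fun j =>
    congrArg (fun s : Spiral => s.1.1) (Spiral.ext_toFin (h1 j))
  rcases special_cases p with ⟨h, -⟩ | ⟨j, x, h⟩
  · rcases special_cases p' with ⟨h', -⟩ | ⟨j, x, h'⟩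
    · obtain ⟨e, he, hec⟩ := exists_notMem_cantorSet hlt
      by_cases hed : e ∈ setD
      · obtain ⟨j, hj, hej⟩ := exists_gap_of_mem_setD hed hec
        have a1 : dpos p ≤ j.1 := not_lt.1 fun hh => (hj.2.2.2 ⟨hh, he.1.trans hej.2⟩).2 h
        have a2 : j.2 ≤ dpos p' := not_lt.1 fun hh => (hj.2.2.2 ⟨hej.1.trans he.2, hh⟩).2 h'
        have := hl ⟨j, hj⟩
        rw [spos_of_le a1, spos_of_ge a2] at this
        cases this
      · exact absurd ((h2 e hed).1 he.1) (not_lt.2 he.2.le)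
    · have := hl j
      rw [h', spos_wand] at this
      rw [eq_wand_of_spos this, h'] at hlt
      exact lt_irrefl _ hlt
  · have := (hl j).symm
    rw [h, spos_wand] at this
    rw [eq_wand_of_spos this, h] at hlt
    exact lt_irrefl _ hlt

theorem isCantorSpace_special : IsCantorSpace SpecialSpace where
  nonempty := ⟨mach zero_mem_cantorSet 0 ⟨0, zero_mem_cantorSet⟩⟩
  compact := inferInstance
  metrizable := by
    have h : TopologicalSpace.MetrizableSpace Theta :=
      inferInstanceAs (TopologicalSpace.MetrizableSpace
        (Theta : Set ((m : ℕ+) → ZMod m)))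
    infer_instance
  totallyDisconnected := by
    refine ⟨fun S _ hS p hp p' hp' => ?_⟩
    have h1 : ∀ j N, (loc j p).toFin N = (loc j p').toFin N := fun j N => by
      have := hS.constant (continuous_loc j 0 .M N).continuousOn hp hp'
      simpa only [Spiral.add_zero', Spiral.side_M] using this
    have h2 : ∀ e ∉ setD, dpos p < e ↔ dpos p' < e := fun e he => by
      have hc := isClopen_dpos_lt he
      constructor
      · exact fun h => hS.subset_isClopen hc ⟨p, hp, h⟩ hp'
      · exact fun h => hS.subset_isClopen hc ⟨p', hp', h⟩ hp
    have h3 : theta p = theta p' := ext_tmod fun N =>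
      hS.constant ((tmod_continuous N).comp continuous_theta).continuousOn hp hp'
    have h4 : p.2 = p'.2 :=
      (hS.image Prod.snd continuous_snd.continuousOn).subsingleton ⟨p, hp, rfl⟩ ⟨p', hp', rfl⟩
    refine special_ext (le_antisymm ?_ ?_) h3 h4
    · exact not_lt.1 (dpos_eq_of_forall (fun j N => (h1 j N).symm) fun e he => (h2 e he).symm)
    · exact not_lt.1 (dpos_eq_of_forall h1 h2)
  -- Moving in the factor `C` alone already excludes isolated points.
  perfect := by
    rw [perfectSpace_iff_forall_not_isolated]
    intro p
    rw [← mem_closure_iff_nhdsWithin_neBot, mem_closure_iff]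
    intro O hO hp
    obtain ⟨c, hc, hne⟩ := exists_ne_mem_cantorSet
      (hO.preimage (f := fun c : cantorSet => (p.1, c)) (by fun_prop)) (c := p.2) hp
    exact ⟨(p.1, c), hc, fun h => hne (congrArg Prod.snd h)⟩

/-! ## Clopen invariant sets -/

/-- Clopen sets which are invariant under the Special Homeomorphism. -/
def ClopenInv (V : Set SpecialSpace) : Prop :=
  IsClopen V ∧ ∀ p, specialHomeo p ∈ V ↔ p ∈ V

theorem clopenInv_empty : ClopenInv ∅ := ⟨isClopen_empty, fun _ => Iff.rfl⟩

theorem ClopenInv.inter {V V' : Set SpecialSpace} (h : ClopenInv V) (h' : ClopenInv V') :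
    ClopenInv (V ∩ V') := ⟨h.1.inter h'.1, fun p => and_congr (h.2 p) (h'.2 p)⟩

theorem ClopenInv.union {V V' : Set SpecialSpace} (h : ClopenInv V) (h' : ClopenInv V') :
    ClopenInv (V ∪ V') := ⟨h.1.union h'.1, fun p => or_congr (h.2 p) (h'.2 p)⟩

theorem ClopenInv.compl {V : Set SpecialSpace} (h : ClopenInv V) : ClopenInv Vᶜ :=
  ⟨h.1.compl, fun p => not_congr (h.2 p)⟩

theorem ClopenInv.diff {V V' : Set SpecialSpace} (h : ClopenInv V) (h' : ClopenInv V') :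
    ClopenInv (V \ V') := h.inter h'.compl

theorem clopenInv_snd {K : Set cantorSet} (hK : IsClopen K) :
    ClopenInv {p : SpecialSpace | p.2 ∈ K} :=
  ⟨hK.preimage continuous_snd, fun _ => Iff.rfl⟩

/-- The homeomorphism keeps every wandering point over its gap, and a cut `e` lies in no gap. -/
theorem clopenInv_dpos_lt {e : ℝ} (he : e ∉ setD) : ClopenInv {p : SpecialSpace | dpos p < e} := by
  refine ⟨isClopen_dpos_lt he, fun p => ?_⟩
  change dpos (specialHomeo p) < e ↔ dpos p < e
  rcases special_cases p with ⟨h, -⟩ | ⟨j, x, h⟩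
  · rw [dpos_special_of_mem h]
  · rw [h, special_wand]
    have h1 := dpos_wand j x p.2
    have h2 := dpos_wand j (x + 1) p.2
    by_cases h3 : e ≤ j.1.1
    · exact ⟨fun h => by linarith [h2.1], fun h => by linarith [h1.1]⟩
    · have h4 : j.1.2 ≤ e := not_lt.1 fun h => he (j.2.2.2.2 ⟨not_le.1 h3, h⟩).1
      exact ⟨fun h => by linarith [h1.2], fun h => by linarith [h2.2]⟩

theorem ClopenInv.wand_mem {V : Set SpecialSpace} (h : ClopenInv V) {j : Gap} {x : ℤ}
    {c : cantorSet} (hx : wand j x c ∈ V) (y : ℤ) : wand j y c ∈ V := by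
  induction y using Int.inductionOn' (b := x) with
  | zero => exact hx
  | succ k _ ih => rw [← special_wand]; exact (h.2 _).2 ih
  | pred k _ ih => rw [← h.2, special_wand, sub_add_cancel]; exact ih

theorem spiralOver_subset_of_isClosed {V : Set SpecialSpace} (hV : IsClosed V) {j : Gap}
    {c : cantorSet} (h : ∀ x, wand j x c ∈ V) : spiralOver j c ⊆ V :=
  (spiralOver_subset_closure j c).trans
    (closure_minimal (by rintro _ ⟨x, rfl⟩; exact h x) hV)

/-- A neighbourhood of the part of the space over `[u, v] × {c}` contains the part over a box. -/
theorem exists_box {O : Set SpecialSpace} (hO : IsOpen O) {u v : ℝ} (huv : u ≤ v)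
    {c : cantorSet} (h : ∀ p : SpecialSpace, dpos p ∈ Icc u v → p.2 = c → p ∈ O) :
    ∃ δ > 0, ∃ K : Set cantorSet, IsClopen K ∧ c ∈ K ∧
      ∀ p : SpecialSpace, dpos p ∈ Ioo (u - δ) (v + δ) → p.2 ∈ K → p ∈ O := by
  -- Compactness makes the projection of the complement of `O` closed, so the tube lemma can be
  -- applied in `ℝ × C`.
  have hcl : IsClosed ((fun p : SpecialSpace => (dpos p, p.2)) '' Oᶜ) :=
    (hO.isClosed_compl.isCompact.image (continuous_dpos.prodMk continuous_snd)).isClosed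
  obtain ⟨A, B, hA, hB, hA', hB', hAB⟩ := generalized_tube_lemma (isCompact_Icc (a := u) (b := v))
    (isCompact_singleton (x := c)) hcl.isOpen_compl (by
      rintro ⟨d, c'⟩ ⟨hd, rfl⟩ ⟨p, hp, e⟩
      obtain ⟨rfl, e2⟩ := Prod.mk.inj e
      exact hp (h p hd e2))
  obtain ⟨δ, hδ, hth⟩ := isCompact_Icc.exists_thickening_subset_open hA hA'
  obtain ⟨K, hK, hcK, hKB⟩ := compact_exists_isClopen_in_isOpen hB (hB' rfl)
  refine ⟨δ, hδ, K, hK, hcK, fun p hp hpK => ?_⟩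
  by_contra hpO
  refine hAB (show (dpos p, p.2) ∈ A ×ˢ B from ⟨?_, hKB hpK⟩) ⟨p, hpO, rfl⟩
  refine hth (Metric.mem_thickening_iff.2 ?_)
  by_cases h1 : dpos p < u
  · exact ⟨u, ⟨le_rfl, huv⟩, by rw [Real.dist_eq, abs_lt]; constructor <;> linarith [hp.1]⟩
  by_cases h2 : v < dpos p
  · exact ⟨v, ⟨huv, le_rfl⟩, by rw [Real.dist_eq, abs_lt]; constructor <;> linarith [hp.2]⟩
  · exact ⟨dpos p, ⟨not_lt.1 h1, not_lt.1 h2⟩, by simpa using hδ⟩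

/-! ## Locally constant functions are determined at a finite level -/

/-- If every level failed, the pairs that agree at level `N` but not under `g` would form decreasing
nonempty compact sets, and a common point would contradict separation. -/
theorem exists_level {Y : Type*} [TopologicalSpace Y] {F : Set Y} (hF : IsCompact F)
    (hF' : IsClosed F) {A : ℕ → Type*} [∀ N, TopologicalSpace (A N)] [∀ N, DiscreteTopology (A N)]
    {h : ∀ N, Y → A N} (hc : ∀ N, Continuous (h N))
    (hmono : ∀ N y y', h (N + 1) y = h (N + 1) y' → h N y = h N y')
    (hsep : ∀ y ∈ F, ∀ y' ∈ F, (∀ N, h N y = h N y') → y = y')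
    {G : Type*} [TopologicalSpace G] [DiscreteTopology G] {g : Y → G} (hg : Continuous g) :
    ∃ N, ∀ y ∈ F, ∀ y' ∈ F, h N y = h N y' → g y = g y' := by
  by_contra! hcon
  let t : ℕ → Set (Y × Y) := fun N => (F ×ˢ F) ∩ ({q | h N q.1 = h N q.2} ∩ {q | g q.1 ≠ g q.2})
  have hcl : ∀ N, IsClosed (t N) := fun N => by
    refine (hF'.prod hF').inter (IsClosed.inter ?_ ?_)
    · exact isClosed_eq ((hc N).comp continuous_fst) ((hc N).comp continuous_snd)
    · have : Continuous fun q : Y × Y => (g q.1, g q.2) := by fun_prop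
      exact (isClosed_discrete {q : G × G | q.1 ≠ q.2}).preimage this
  obtain ⟨⟨y, y'⟩, hq⟩ := IsCompact.nonempty_iInter_of_sequence_nonempty_isCompact_isClosed t
    (fun N q hq => ⟨hq.1, hmono N _ _ hq.2.1, hq.2.2⟩)
    (fun N => by
      obtain ⟨y, hy, y', hy', e, ne⟩ := hcon N
      exact ⟨(y, y'), ⟨hy, hy'⟩, e, ne⟩)
    ((hF.prod hF).of_isClosed_subset (hcl 0) inter_subset_left) hcl
  have hq' := mem_iInter.1 hq
  refine (hq' 0).2.2 (congrArg g ?_)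
  exact hsep y (hq' 0).1.1 y' (hq' 0).1.2 fun N => (hq' N).2.1

/-- This set contains `F`, and each of its points has the same values as some point of `F`; so facts
about values on `F` spread to a neighbourhood. -/
theorem isOpen_agree {Y A G : Type*} [TopologicalSpace Y] [TopologicalSpace A] [DiscreteTopology A]
    [TopologicalSpace G] [DiscreteTopology G] {h : Y → A} (hh : Continuous h) {g : Y → G}
    (hg : Continuous g) (F : Set Y) : IsOpen {y | ∃ y' ∈ F, h y = h y' ∧ g y = g y'} := by
  have : {y | ∃ y' ∈ F, h y = h y' ∧ g y = g y'} = ⋃ y' ∈ F, h ⁻¹' {h y'} ∩ g ⁻¹' {g y'} := by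
    ext y
    simp [and_left_comm]
  rw [this]
  exact isOpen_biUnion fun y' _ =>
    ((isOpen_discrete _).preimage hh).inter ((isOpen_discrete _).preimage hg)

/-! ## The local form of a map to `𝓦_n` -/

theorem Spiral.side_eq {K : Side} (hK : K ≠ .M) {s s' : Spiral} (h : s.1.2 = s'.1.2) :
    s.side K = s'.side K := by
  cases K
  · exact ext' rfl h
  · exact absurd rfl hK
  · exact ext' rfl h

theorem Spiral.toFin_zero {s s' : Spiral} (h : s.1.2 = s'.1.2) : s.toFin 0 = s'.toFin 0 := by
  have : ∀ y : ZStar, y.collapse 0 = 0 := fun y => by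
    cases y <;> simp only [ZStar.collapse] <;> omega
  exact toFin_ext ((this _).trans (this _).symm) (by rw [h])

/-- If the image of an end is in the interior of `Σ_n`, then `n = 0`. -/
theorem eq_zero_of_side {n : ℕ} {K : Side} (hK : K ≠ .M) {s s' : Spiral} (hs : s'.1.1 = .int 0)
    (h : (s.side K).toFin n = s'.toFin n) : n = 0 := by
  have := congrArg (fun a : FinSpiral n => a.1.1) h
  simp only [Spiral.toFin_fst, hs] at this
  cases K
  · change (-n : ℤ) = max (-(n : ℤ)) (min n 0) at this
    omega
  · exact absurd rfl hK
  · change (n : ℤ) = max (-(n : ℤ)) (min n 0) at this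
    omega

section Local

variable {n : ℕ} {φ : SpecialSpace → W n} {G : Type*} [TopologicalSpace G] [DiscreteTopology G]
  {g : SpecialSpace → G}

theorem isClosed_spiralOver (j : Gap) (c : cantorSet) : IsClosed (spiralOver j c) :=
  (isClosed_Icc.preimage continuous_dpos).inter (isClosed_eq continuous_snd continuous_const)

/-- On the wandering orbit the formula for `φ` is the classification of walks. Both sides are
locally constant, so it passes to the closed spiral by density and then to a neighbourhood. The
level `N` comes from compactness of the closed spiral. -/
theorem exists_local_spiral (hφ : Continuous φ) (hrel : ∀ p, WRel n (φ p) (φ (specialHomeo p)))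
    (hg : Continuous g) (j : Gap) (c : cantorSet) :
    ∃ (ω : Fin n → Letter) (K : Side) (r : ℤ) (N : ℕ) (O : Set SpecialSpace), IsOpen O ∧
      spiralOver j c ⊆ O ∧
      (∀ p ∈ O, φ p = (ω, (((loc j p).add r).side K).toFin n)) ∧
      ∀ p ∈ O, ∀ p' ∈ O, ((loc j p).add r).toFin N = ((loc j p').add r).toFin N → g p = g p' := by
  have hwalk : ∀ x, WRel n (φ (wand j x c)) (φ (wand j (x + 1) c)) := fun x => by
    rw [← special_wand]
    exact hrel _
  obtain ⟨K, r, hK⟩ := exists_side_of_walk (f := fun x => (φ (wand j x c)).2) fun x => (hwalk x).2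
  have hω : ∀ x, (φ (wand j x c)).1 = (φ (wand j 0 c)).1 := by
    intro x
    induction x using Int.inductionOn' (b := 0) with
    | zero => rfl
    | succ k _ ih => rw [← ih]; exact (hwalk k).1.symm
    | pred k _ ih =>
      have := (hwalk (k - 1)).1
      rw [sub_add_cancel] at this
      rw [← ih]
      exact this
  obtain ⟨N, hN⟩ := exists_level (isClosed_spiralOver j c).isCompact (isClosed_spiralOver j c)
    (h := fun N p => (((loc j p).add r).side .M).toFin N) (fun N => continuous_loc j r .M N)
    (fun N y y' h => Spiral.toFin_eq_of_le N.le_succ h) (by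
      rintro p ⟨hp, hpc⟩ p' ⟨hp', hpc'⟩ h
      have h' := congrArg (Spiral.add (-r)) (Spiral.ext_toFin h)
      simp only [Spiral.side_M, Spiral.add_add, add_neg_cancel, Spiral.add_zero'] at h'
      have h1 : spos j p = spos j p' := congrArg (fun s : Spiral => s.1.1) h'
      have h2 : theta p = theta p' := congrArg (fun s : Spiral => s.1.2) h'
      refine special_ext ?_ h2 (hpc.trans hpc'.symm)
      rcases spos_cases j p with ⟨a1, a2⟩ | ⟨a1, a2⟩ | ⟨x, a1, a2⟩ <;>
        rcases spos_cases j p' with ⟨b1, b2⟩ | ⟨b1, b2⟩ | ⟨y, b1, b2⟩ <;>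
        rw [a2, b2] at h1 <;> cases h1
      · exact le_antisymm (a1.trans hp'.1) (b1.trans hp.1)
      · exact le_antisymm (hp.2.trans b1) (hp'.2.trans a1)
      · rw [a1, b1]; rfl) hg
  refine ⟨(φ (wand j 0 c)).1, K, r, N,
    {p | φ p = ((φ (wand j 0 c)).1, (((loc j p).add r).side K).toFin n)} ∩
      {p | ∃ p' ∈ spiralOver j c, (((loc j p).add r).side .M).toFin N =
        (((loc j p').add r).side .M).toFin N ∧ g p = g p'}, ?_, ?_, fun p hp => hp.1, ?_⟩
  · refine IsOpen.inter ?_ (isOpen_agree (continuous_loc j r .M N) hg _)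
    have h2 : Continuous fun p => (φ p, (((loc j p).add r).side K).toFin n) :=
      hφ.prodMk (continuous_loc j r K n)
    exact (isOpen_discrete {q : W n × FinSpiral n | q.1 = ((φ (wand j 0 c)).1, q.2)}).preimage h2
  · intro p hp
    refine ⟨?_, p, hp, rfl, rfl⟩
    refine spiralOver_subset_of_isClosed
      (V := {p | φ p = ((φ (wand j 0 c)).1, (((loc j p).add r).side K).toFin n)}) ?_ ?_ hp
    · have h2 : Continuous fun p => (φ p, (((loc j p).add r).side K).toFin n) :=
        hφ.prodMk (continuous_loc j r K n)
      exact (isClosed_discrete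
        {q : W n × FinSpiral n | q.1 = ((φ (wand j 0 c)).1, q.2)}).preimage h2
    · intro x
      refine Prod.ext (hω x) ?_
      rw [hK x, loc_wand, Spiral.ofInt_add]
  · rintro p ⟨-, q, hq, e1, e2⟩ p' ⟨-, q', hq', e1', e2'⟩ h
    rw [e2, e2']
    exact hN q hq q' hq' (e1.symm.trans (h.trans e1'))

/-- The orbit of an adding machine also yields a walk, but a recurrent one, which cannot cross.
Retractions to an end forget the position, so any gap `j` may be used to write the formula. -/
theorem exists_local_mach (hφ : Continuous φ) (hrel : ∀ p, WRel n (φ p) (φ (specialHomeo p)))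
    (hg : Continuous g) {a : ℝ} (ha : a ∈ cantorSet) (c : cantorSet) (j : Gap) :
    ∃ (ω : Fin n → Letter) (K : Side) (r : ℤ) (N : ℕ) (O : Set SpecialSpace), IsOpen O ∧ K ≠ .M ∧
      (∀ p : SpecialSpace, dpos p = a → p.2 = c → p ∈ O) ∧
      (∀ p ∈ O, φ p = (ω, (((loc j p).add r).side K).toFin n)) ∧
      ∀ p ∈ O, ∀ p' ∈ O, tmod N (theta p) = tmod N (theta p') → g p = g p' := by
  have hwalk : ∀ x : ℤ, WRel n (φ (mach ha x c)) (φ (mach ha ((x + 1 : ℤ) : Theta) c)) := fun x => by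
    have := hrel (mach ha x c)
    rw [special_mach] at this
    rwa [Int.cast_add, Int.cast_one]
  have hω : ∀ x : ℤ, (φ (mach ha x c)).1 = (φ (mach ha ((0 : ℤ) : Theta) c)).1 := by
    intro x
    induction x using Int.inductionOn' (b := 0) with
    | zero => rfl
    | succ k _ ih => rw [← ih]; exact (hwalk k).1.symm
    | pred k _ ih =>
      have := (hwalk (k - 1)).1
      rw [sub_add_cancel] at this
      rw [← ih]
      exact this
  obtain ⟨K, r, hKM, hK⟩ : ∃ (K : Side) (r : ℤ), K ≠ .M ∧ ∀ x : ℤ, (φ (mach ha x c)).2 =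
      ((Spiral.ofInt (x + r)).side K).toFin n := by
    obtain ⟨K, r, hK⟩ := exists_side_of_walk (f := fun x : ℤ => (φ (mach ha x c)).2)
      fun x => (hwalk x).2
    by_cases hKM : K = .M
    · subst hKM
      -- For `n = 0` all retractions agree after projection to `Σ_0`, so `M` may be replaced by `L`.
      refine ⟨.L, r, by simp, fun x => (hK x).trans ?_⟩
      -- recurrence of the adding machine forces `n = 0`
      have hn : n = 0 := by
        obtain ⟨u, hu, ht⟩ := exists_seq_atTop ((-r : ℤ) : Theta)
        have h1 : Filter.Tendsto (fun k => mach ha (u k : Theta) c) Filter.atTop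
            (𝓝 (mach ha ((-r : ℤ) : Theta) c)) :=
          tendsto_special tendsto_const_nhds ht fun _ => rfl
        have h2 := (hφ.tendsto _).comp h1
        rw [nhds_discrete, Filter.tendsto_pure] at h2
        obtain ⟨k, hk1, hk2⟩ := (h2.and (hu.eventually_ge_atTop (n - r))).exists
        have h3 := congrArg (fun w : W n => w.2.1.1) hk1
        simp only [Function.comp_apply] at h3
        rw [hK, hK] at h3
        change max (-(n : ℤ)) (min n (u k + r)) = max (-(n : ℤ)) (min n (-r + r)) at h3
        omega
      subst hn
      exact Spiral.toFin_zero rfl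
    · exact ⟨K, r, hKM, hK⟩
  have hFcl : IsClosed {p : SpecialSpace | dpos p = a ∧ p.2 = c} :=
    (isClosed_eq continuous_dpos continuous_const).inter (isClosed_eq continuous_snd continuous_const)
  obtain ⟨N, hN⟩ := exists_level hFcl.isCompact hFcl (h := fun N p => tmod N (theta p))
    (fun N => (tmod_continuous N).comp continuous_theta)
    (fun N y y' h => tmod_eq_of_le N.le_succ h)
    (fun p hp p' hp' h => special_ext (hp.1.trans hp'.1.symm) (ext_tmod h)
      (hp.2.trans hp'.2.symm)) hg
  have hcont : Continuous fun p => (φ p, (((loc j p).add r).side K).toFin n) :=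
    hφ.prodMk (continuous_loc j r K n)
  refine ⟨(φ (mach ha ((0 : ℤ) : Theta) c)).1, K, r, N,
    {p | φ p = ((φ (mach ha ((0 : ℤ) : Theta) c)).1, (((loc j p).add r).side K).toFin n)} ∩
      {p | ∃ p' ∈ {p : SpecialSpace | dpos p = a ∧ p.2 = c}, tmod N (theta p) = tmod N (theta p') ∧
        g p = g p'}, ?_, hKM, ?_, fun p hp => hp.1, ?_⟩
  · exact ((isOpen_discrete {q : W n × FinSpiral n |
      q.1 = ((φ (mach ha ((0 : ℤ) : Theta) c)).1, q.2)}).preimage hcont).inter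
        (isOpen_agree ((tmod_continuous N).comp continuous_theta) hg _)
  · intro p hp hpc
    refine ⟨?_, p, ⟨hp, hpc⟩, rfl, rfl⟩
    have hcl : IsClosed {p | φ p =
        ((φ (mach ha ((0 : ℤ) : Theta) c)).1, (((loc j p).add r).side K).toFin n)} :=
      (isClosed_discrete {q : W n × FinSpiral n |
        q.1 = ((φ (mach ha ((0 : ℤ) : Theta) c)).1, q.2)}).preimage hcont
    have hmem : p = mach ha (theta p) c := special_ext hp rfl hpc
    rw [hmem]
    refine closure_minimal ?_ hcl (mach_mem_closure ha (theta p) c)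
    rintro _ ⟨x, rfl⟩
    refine Prod.ext (hω x) ((hK x).trans (congrArg _ (Spiral.side_eq hKM ?_)))
    exact Int.cast_add x r
  · rintro p ⟨-, q, hq, e1, e2⟩ p' ⟨-, q', hq', e1', e2'⟩ h
    rw [e2, e2']
    exact hN q hq q' hq' (e1.symm.trans (h.trans e1'))

end Local

/-! ### Decomposition of the space into clopen invariant pieces -/

section Pieces

variable {n : ℕ} {φ : SpecialSpace → W n} {G : Type*} {g : SpecialSpace → G}

/-- A clopen invariant set `P` which is retracted to a spiral contained in it, such that `φ` maps it
to the copy `ω` of `Σ_n` by means of this retraction (followed by the retraction `K` to an end, when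
`K ≠ M`), and such that the projection of the spiral to `Σ_N` determines `g`. -/
def Good (φ : SpecialSpace → W n) (g : SpecialSpace → G) (l : (Fin n → Letter) × Side) (N : ℕ)
    (P : Set SpecialSpace) : Prop :=
  ClopenInv P ∧ ∃ (j : Gap) (r : ℤ), (∃ x c, wand j x c ∈ P) ∧
    (∀ p ∈ P, φ p = (l.1, (((loc j p).add r).side l.2).toFin n)) ∧
    ∀ p ∈ P, ∀ p' ∈ P, ((loc j p).add r).toFin N = ((loc j p').add r).toFin N → g p = g p'

theorem Good.mono {l : (Fin n → Letter) × Side} {M N : ℕ} (h : M ≤ N) {P : Set SpecialSpace}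
    (hP : Good φ g l M P) : Good φ g l N P := by
  obtain ⟨h1, j, r, h2, h3, h4⟩ := hP
  exact ⟨h1, j, r, h2, h3, fun p hp p' hp' e => h4 p hp p' hp' (Spiral.toFin_eq_of_le h e)⟩

/-- As `C` has no isolated points, `P` contains two wandering points that differ only in the
`C`-coordinate. A clopen set of that coordinate separates them, and both parts keep the retraction
of `P`. -/
theorem Good.split {l : (Fin n → Letter) × Side} {N : ℕ} {P : Set SpecialSpace}
    (hP : Good φ g l N P) : ∃ P' P'', Good φ g l N P' ∧ Good φ g l N P'' ∧ Disjoint P' P'' ∧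
      P' ∪ P'' = P := by
  obtain ⟨h1, j, r, ⟨x, c, hx⟩, h3, h4⟩ := hP
  have hO : IsOpen ((fun c => wand j x c) ⁻¹' P) := h1.1.isOpen.preimage (by unfold wand; fun_prop)
  obtain ⟨c', hc', hne⟩ := exists_ne_mem_cantorSet hO hx
  obtain ⟨K, hK, hcK, hKc⟩ := compact_exists_isClopen_in_isOpen
    (isOpen_compl_singleton (x := c')) (show c ∈ ({c'} : Set cantorSet)ᶜ from hne.symm)
  have hc'K : c' ∉ K := fun h => hKc h rfl
  have hI := clopenInv_snd hK
  have good : ∀ V, ClopenInv V → (∃ c, wand j x c ∈ P ∩ V) → Good φ g l N (P ∩ V) :=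
    fun V hV ⟨c, hc⟩ => ⟨h1.inter hV, j, r, ⟨x, c, hc⟩, fun p hp => h3 p hp.1,
      fun p hp p' hp' => h4 p hp.1 p' hp'.1⟩
  exact ⟨_, _, good _ hI ⟨c, hx, hcK⟩, good _ hI.compl ⟨c', hc', hc'K⟩,
    (disjoint_compl_right (a := {p : SpecialSpace | p.2 ∈ K})).mono inter_subset_right
      inter_subset_right, inter_union_compl _ _⟩

theorem Good.split_fin {l : (Fin n → Letter) × Side} {N : ℕ} (m : ℕ) {P : Set SpecialSpace}
    (hP : Good φ g l N P) : ∃ f : Fin (m + 1) → Set SpecialSpace, (∀ i, Good φ g l N (f i)) ∧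
      (∀ i i' p, p ∈ f i → p ∈ f i' → i = i') ∧ ∀ p, (∃ i, p ∈ f i) ↔ p ∈ P := by
  induction m generalizing P with
  | zero => exact ⟨fun _ => P, fun _ => hP, fun i i' _ _ _ => Subsingleton.elim (α := Fin 1) i i', by simp⟩
  | succ m ih =>
    obtain ⟨P', P'', h1, h2, h3, rfl⟩ := hP.split
    obtain ⟨f, hf1, hf2, hf3⟩ := ih h2
    have hd : ∀ i p, p ∈ P' → p ∈ f i → False := fun i p hp hpi =>
      disjoint_left.1 h3 hp ((hf3 p).1 ⟨i, hpi⟩)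
    refine ⟨Fin.cons P' f, fun i => ?_, fun i i' p => ?_, fun p => ?_⟩
    · refine Fin.cases h1 (fun i => ?_) i
      simpa using hf1 i
    · refine Fin.cases ?_ (fun i => ?_) i <;> refine Fin.cases ?_ (fun i' => ?_) i'
      · intros; rfl
      · intro a b; exact (hd i' p (by simpa using a) (by simpa using b)).elim
      · intro a b; exact (hd i p (by simpa using b) (by simpa using a)).elim
      · intro a b
        rw [hf2 i i' p (by simpa using a) (by simpa using b)]
    · rw [Fin.exists_fin_succ]
      simp only [Fin.cons_zero, Fin.cons_succ, hf3]
      rfl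

theorem Good.split_finite {l : (Fin n → Letter) × Side} {N : ℕ} (I : Type*) [Finite I] [Nonempty I]
    {P : Set SpecialSpace} (hP : Good φ g l N P) :
    ∃ f : I → Set SpecialSpace, (∀ i, Good φ g l N (f i)) ∧
      (∀ i i' p, p ∈ f i → p ∈ f i' → i = i') ∧ ∀ p, (∃ i, p ∈ f i) ↔ p ∈ P := by
  obtain ⟨m, ⟨e⟩⟩ := Finite.exists_equiv_fin I
  obtain ⟨m, rfl⟩ : ∃ m', m = m' + 1 :=
    Nat.exists_eq_succ_of_ne_zero fun h => by subst h; exact (e (Classical.arbitrary I)).elim0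
  obtain ⟨f, h1, h2, h3⟩ := hP.split_fin m
  refine ⟨f ∘ e, fun i => h1 _, fun i i' p hi hi' => e.injective (h2 _ _ p hi hi'), fun p => ?_⟩
  rw [← h3 p]
  exact e.exists_congr_left.trans (by simp)

/-- Finitely many disjoint pieces can be subdivided into any larger number of pieces. -/
theorem exists_subdivision {l : (Fin n → Letter) × Side} {N : ℕ} {ι I : Type*} [Finite ι]
    [Nonempty ι] [Finite I] (hcard : Nat.card ι ≤ Nat.card I) {P : ι → Set SpecialSpace}
    (hP : ∀ i, Good φ g l N (P i)) (hd : ∀ i i' p, p ∈ P i → p ∈ P i' → i = i') :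
    ∃ f : I → Set SpecialSpace, (∀ i, Good φ g l N (f i)) ∧
      (∀ i i' p, p ∈ f i → p ∈ f i' → i = i') ∧ ∀ p, (∃ i, p ∈ f i) ↔ ∃ i, p ∈ P i := by
  have := Fintype.ofFinite ι
  have := Fintype.ofFinite I
  rw [Nat.card_eq_fintype_card, Nat.card_eq_fintype_card] at hcard
  obtain ⟨e⟩ := Function.Embedding.nonempty_of_card_le hcard
  have hs := Function.invFun_surjective e.injective
  -- The fibre of this surjection over `i` indexes the parts into which `P i` is to be cut.
  set σ : I → ι := Function.invFun e
  have hne : ∀ i, Nonempty {a // σ a = i} := fun i => let ⟨a, ha⟩ := hs i; ⟨⟨a, ha⟩⟩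
  choose f h1 h2 h3 using fun i => (hP i).split_finite {a // σ a = i}
  refine ⟨fun a => f (σ a) ⟨a, rfl⟩, fun a => h1 _ _, fun a a' p ha ha' => ?_, fun p => ?_⟩
  · have e1 := hd _ _ p ((h3 _ p).1 ⟨_, ha⟩) ((h3 _ p).1 ⟨_, ha'⟩)
    have key : ∀ i (h : σ a' = i), p ∈ f i ⟨a', h⟩ := by rintro _ rfl; exact ha'
    exact congrArg Subtype.val (h2 _ _ _ p ha (key _ e1.symm))
  · constructor
    · rintro ⟨a, ha⟩
      exact ⟨_, (h3 _ p).1 ⟨_, ha⟩⟩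
    · rintro ⟨i, hi⟩
      obtain ⟨⟨a, rfl⟩, ha⟩ := (h3 i p).2 hi
      exact ⟨a, ha⟩

/-- A finite decomposition of `V` into labelled pieces. -/
def Decomposes (φ : SpecialSpace → W n) (g : SpecialSpace → G) (V : Set SpecialSpace) : Prop :=
  ∃ (N : ℕ) (S : Finset (((Fin n → Letter) × Side) × Set SpecialSpace)),
    (∀ q ∈ S, Good φ g q.1 N q.2) ∧ (∀ q ∈ S, ∀ q' ∈ S, ∀ p, p ∈ q.2 → p ∈ q'.2 → q = q') ∧
    ∀ p, (∃ q ∈ S, p ∈ q.2) ↔ p ∈ V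

theorem decomposes_empty : Decomposes φ g ∅ := ⟨0, ∅, by simp, by simp, by simp⟩

theorem Good.decomposes {l : (Fin n → Letter) × Side} {N : ℕ} {P : Set SpecialSpace}
    (hP : Good φ g l N P) : Decomposes φ g P :=
  ⟨N, {(l, P)}, by simpa using hP, by simp, by simp⟩

theorem Decomposes.union {V V' : Set SpecialSpace} (h : Decomposes φ g V) (h' : Decomposes φ g V')
    (hd : Disjoint V V') : Decomposes φ g (V ∪ V') := by
  classical
  obtain ⟨N, S, h1, h2, h3⟩ := h
  obtain ⟨N', S', h1', h2', h3'⟩ := h'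
  refine ⟨max N N', S ∪ S', fun q hq => ?_, fun q hq q' hq' p hp hp' => ?_, fun p => ?_⟩
  · rcases Finset.mem_union.1 hq with hq | hq
    · exact (h1 q hq).mono (le_max_left _ _)
    · exact (h1' q hq).mono (le_max_right _ _)
  · rcases Finset.mem_union.1 hq with hq | hq <;> rcases Finset.mem_union.1 hq' with hq' | hq'
    · exact h2 q hq q' hq' p hp hp'
    · exact (disjoint_left.1 hd ((h3 p).1 ⟨q, hq, hp⟩) ((h3' p).1 ⟨q', hq', hp'⟩)).elim
    · exact (disjoint_left.1 hd ((h3 p).1 ⟨q', hq', hp'⟩) ((h3' p).1 ⟨q, hq, hp⟩)).elim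
    · exact h2' q hq q' hq' p hp hp'
  · rw [mem_union, ← h3, ← h3']
    simp only [Finset.mem_union]
    constructor
    · rintro ⟨q, hq | hq, hp⟩
      · exact Or.inl ⟨q, hq, hp⟩
      · exact Or.inr ⟨q, hq, hp⟩
    · rintro (⟨q, hq, hp⟩ | ⟨q, hq, hp⟩)
      · exact ⟨q, Or.inl hq, hp⟩
      · exact ⟨q, Or.inr hq, hp⟩

/-- A set which is mapped to one end of `Σ_n`, by a map that only depends on the adding machine
coordinate, is a piece. -/
theorem good_of_end {V : Set SpecialSpace} (hV : ClopenInv V) (hne : V.Nonempty) {K : Side}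
    (hK : K ≠ .M) {ω : Fin n → Letter} {j : Gap} {r : ℤ} {N : ℕ}
    (h1 : ∀ p ∈ V, φ p = (ω, (((loc j p).add r).side K).toFin n))
    (h2 : ∀ p ∈ V, ∀ p' ∈ V, tmod N (theta p) = tmod N (theta p') → g p = g p') :
    Good φ g (ω, K) N V := by
  -- There may be no wandering point over `j` in `V`. Any gap `k` with one will serve, as only the
  -- adding machine coordinate matters.
  obtain ⟨k, x, c, hx⟩ := exists_wand_mem hV.1.isOpen hne
  refine ⟨hV, k, r, ⟨x, c, hx⟩, fun p hp => ?_, fun p hp p' hp' e => h2 p hp p' hp' ?_⟩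
  · rw [h1 p hp]
    exact congrArg (fun s : Spiral => (ω, s.toFin n)) (Spiral.side_eq hK rfl)
  · have := Spiral.tmod_eq_of_toFin_eq e
    change tmod N (theta p + r) = tmod N (theta p' + r) at this
    rw [map_add, map_add] at this
    exact add_right_cancel this

theorem exists_gap_left (j : Gap) {δ : ℝ} (hδ : 0 < δ) :
    ∃ k : Gap, j.1.1 - δ < k.1.1 ∧ k.1.2 < j.1.1 := by
  obtain ⟨k, hk, h1, h2⟩ := exists_gap_near j.2.2.1 (δ := min δ (j.1.2 - j.1.1))
    (lt_min hδ (by linarith [j.lt]))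
  have l1 := min_le_left δ (j.1.2 - j.1.1)
  have l2 := min_le_right δ (j.1.2 - j.1.1)
  refine ⟨⟨k, hk⟩, by linarith [h1.1], lt_of_le_of_ne (not_lt.1 fun h => ?_) (gap_ends_ne hk j.2)⟩
  exact (j.2.2.2.2 ⟨h, by linarith [h2.2]⟩).2 hk.2.2.1

theorem exists_gap_right (j : Gap) {δ : ℝ} (hδ : 0 < δ) :
    ∃ k : Gap, j.1.2 < k.1.1 ∧ k.1.2 < j.1.2 + δ := by
  obtain ⟨k, hk, h1, h2⟩ := exists_gap_near j.2.2.2.1 (δ := min δ (j.1.2 - j.1.1))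
    (lt_min hδ (by linarith [j.lt]))
  have l1 := min_le_left δ (j.1.2 - j.1.1)
  have l2 := min_le_right δ (j.1.2 - j.1.1)
  refine ⟨⟨k, hk⟩, lt_of_le_of_ne (not_lt.1 fun h => ?_) (gap_ends_ne j.2 hk), by linarith [h2.2]⟩
  exact (j.2.2.2.2 ⟨by linarith [h1.1], h⟩).2 hk.2.1

theorem exists_cut_left_gap (j : Gap) {δ : ℝ} (hδ : 0 < δ) :
    ∃ e ∈ Ioo (j.1.1 - δ) j.1.1, e ∉ setD :=
  exists_cut_left j.2.2.1 hδ fun _ hk => gap_ends_ne hk j.2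

theorem exists_cut_right_gap (j : Gap) {δ : ℝ} (hδ : 0 < δ) :
    ∃ e ∈ Ioo j.1.2 (j.1.2 + δ), e ∉ setD :=
  exists_cut_right j.2.2.2.1 hδ fun _ hk h => gap_ends_ne j.2 hk h.symm

/-- The part of the space over `(e, e') × K`, when `e` and `e'` are not in `D`. -/
def boxOver (e e' : ℝ) (K : Set cantorSet) : Set SpecialSpace :=
  {p | dpos p < e}ᶜ ∩ ({p | dpos p < e'} ∩ {p | p.2 ∈ K})

theorem clopenInv_boxOver {e e' : ℝ} (he : e ∉ setD) (he' : e' ∉ setD) {K : Set cantorSet}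
    (hK : IsClopen K) : ClopenInv (boxOver e e' K) :=
  (clopenInv_dpos_lt he).compl.inter ((clopenInv_dpos_lt he').inter (clopenInv_snd hK))

theorem mem_boxOver {e e' : ℝ} {K : Set cantorSet} {p : SpecialSpace} :
    p ∈ boxOver e e' K ↔ e ≤ dpos p ∧ dpos p < e' ∧ p.2 ∈ K := by
  unfold boxOver
  simp

/-- The retraction to an end which agrees with `K` at `-∞`. -/
def Side.atNegInf : Side → Side
  | R => R
  | _ => L

/-- The retraction to an end which agrees with `K` at `+∞`. -/
def Side.atPosInf : Side → Side
  | L => L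
  | _ => R

theorem spos_special_negInf {j : Gap} {p : SpecialSpace} :
    spos j (specialHomeo p) = .negInf ↔ spos j p = .negInf := by
  have h : spos j (specialHomeo p) = (spos j p).add 1 :=
    congrArg (fun s : Spiral => s.1.1) (loc_special j p)
  rw [h]
  cases spos j p <;> simp [ZStar.add]

/-- A clopen invariant set close to a closed spiral, but disjoint from it, decomposes. -/
theorem decomposes_off_spiral {j : Gap} {V : Set SpecialSpace} (hV : ClopenInv V)
    (hno : ∀ x c, wand j x c ∉ V) {ω : Fin n → Letter} {K : Side} {r : ℤ} {N : ℕ}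
    (h1 : ∀ p ∈ V, φ p = (ω, (((loc j p).add r).side K).toFin n))
    (h2 : ∀ p ∈ V, ∀ p' ∈ V, ((loc j p).add r).toFin N = ((loc j p').add r).toFin N →
      g p = g p') : Decomposes φ g V := by
  have hcl : IsClopen {p | qPoint j 0 ≤ dpos p} := isClopen_spos_ge j 0
  have hq := qPoint_mem j.lt 0
  -- Without wandering points over `j`, the retraction sends all of `V` to the two ends, which the
  -- point `q(j, 0)` separates by a clopen condition.
  have hs : ∀ p ∈ V, (spos j p = .negInf ∧ dpos p < qPoint j 0) ∨
      (spos j p = .posInf ∧ qPoint j 0 ≤ dpos p) := by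
    intro p hp
    rcases spos_cases j p with ⟨a1, a2⟩ | ⟨a1, a2⟩ | ⟨x, a1, a2⟩
    · exact Or.inl ⟨a2, by linarith [hq.1]⟩
    · exact Or.inr ⟨a2, by linarith [hq.2]⟩
    · exact absurd (a1 ▸ hp) (hno x p.2)
  have hL : V ∩ {p | spos j p = .negInf} = V ∩ {p | qPoint j 0 ≤ dpos p}ᶜ := by
    ext p
    refine and_congr_right fun hp => ?_
    simp only [mem_ofPred_eq, mem_compl_iff, not_le]
    rcases hs p hp with ⟨a1, a2⟩ | ⟨a1, a2⟩
    · simp [a1, a2]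
    · simp [a1, a2]
  have hR : V \ (V ∩ {p | spos j p = .negInf}) = V ∩ {p | spos j p = .posInf} := by
    ext p
    simp only [mem_sdiff, mem_inter_iff, mem_ofPred_eq]
    constructor
    · rintro ⟨hp, hn⟩
      rcases hs p hp with ⟨a1, -⟩ | ⟨a1, -⟩
      · exact absurd ⟨hp, a1⟩ hn
      · exact ⟨hp, a1⟩
    · rintro ⟨hp, h⟩
      exact ⟨hp, fun h' => by rw [h'.2] at h; cases h⟩
  have hVL : ClopenInv (V ∩ {p | spos j p = .negInf}) :=
    ⟨by rw [hL]; exact hV.1.inter hcl.compl,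
      fun p => and_congr (hV.2 p) spos_special_negInf⟩
  have hVR := hV.diff hVL
  -- on each side the level-`N` projection only depends on the adding machine coordinate
  have part : ∀ (y : ZStar) (K' : Side), y.add r = y → K' ≠ .M → K.act y = K'.act y →
      ClopenInv (V ∩ {p | spos j p = y}) → Decomposes φ g (V ∩ {p | spos j p = y}) := by
    intro y K' hy hK' hKK hcl
    rcases (V ∩ {p | spos j p = y}).eq_empty_or_nonempty with he | hne
    · rw [he]; exact decomposes_empty
    refine (good_of_end hcl hne hK' (j := j) (r := r) (ω := ω) (N := N) ?_ ?_).decomposes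
    · rintro p ⟨hp, hps⟩
      rw [h1 p hp]
      refine congrArg (fun s : Spiral => (ω, s.toFin n)) (Spiral.ext' ?_ rfl)
      change K.act ((spos j p).add r) = K'.act ((spos j p).add r)
      rw [show spos j p = y from hps, hy, hKK]
    · rintro p ⟨hp, hps⟩ p' ⟨hp', hps'⟩ e
      refine h2 p hp p' hp' (Spiral.toFin_ext ?_ ?_)
      · change ((spos j p).add r).collapse N = ((spos j p').add r).collapse N
        rw [show spos j p = y from hps, show spos j p' = y from hps']
      · change tmod N (theta p + r) = tmod N (theta p' + r)
        rw [map_add, map_add, e]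
  have e : V = (V ∩ {p | spos j p = .negInf}) ∪ (V \ (V ∩ {p | spos j p = .negInf})) :=
    (union_sdiff_cancel inter_subset_left).symm
  rw [e]
  refine Decomposes.union ?_ ?_ disjoint_sdiff_self_right
  · exact part _ K.atNegInf rfl (by cases K <;> simp [Side.atNegInf]) (by cases K <;> rfl) hVL
  · rw [hR] at hVR ⊢
    exact part _ K.atPosInf rfl (by cases K <;> simp [Side.atPosInf]) (by cases K <;> rfl) hVR

variable [TopologicalSpace G] [DiscreteTopology G]

/-- A point over a closed gap is enclosed by cuts just outside the gap; any other point is over a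
Cantor point with cuts on both sides. All clopen invariant subsets of `U` are treated, so that
overlapping neighbourhoods can later be made disjoint. -/
theorem exists_nhds_decomposes (hφ : Continuous φ)
    (hrel : ∀ p, WRel n (φ p) (φ (specialHomeo p))) (hg : Continuous g) (p₀ : SpecialSpace) :
    ∃ U, ClopenInv U ∧ p₀ ∈ U ∧ ∀ V ⊆ U, ClopenInv V → Decomposes φ g V := by
  by_cases hp₀ : ∃ j : Gap, dpos p₀ ∈ Icc j.1.1 j.1.2
  · obtain ⟨j, hj⟩ := hp₀
    obtain ⟨ω, K, r, N, O, hO, hsub, h1, h2⟩ := exists_local_spiral hφ hrel hg j p₀.2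
    obtain ⟨δ, hδ, Kc, hKc, hmem, hbox⟩ := exists_box hO j.lt.le fun p hp hpc => hsub ⟨hp, hpc⟩
    obtain ⟨e, he, heD⟩ := exists_cut_left_gap j hδ
    obtain ⟨e', he', heD'⟩ := exists_cut_right_gap j hδ
    refine ⟨boxOver e e' Kc, clopenInv_boxOver heD heD' hKc,
      mem_boxOver.2 ⟨by linarith [hj.1, he.2], by linarith [hj.2, he'.1], hmem⟩, ?_⟩
    intro V hVU hV
    have hVO : V ⊆ O := fun p hp => by
      obtain ⟨a1, a2, a3⟩ := mem_boxOver.1 (hVU hp)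
      exact hbox p ⟨by linarith [he.1], by linarith [he'.2]⟩ a3
    have hK1 : IsClopen ((fun c => wand j 0 c) ⁻¹' V) :=
      hV.1.preimage (by unfold wand; fun_prop)
    -- `V1` keeps the coordinates `c` whose spiral over `j` is in `V`, and is one piece if nonempty.
    -- By invariance `V \ V1` has no wandering point over `j`.
    set V1 := V ∩ {p | p.2 ∈ (fun c => wand j 0 c) ⁻¹' V} with hV1def
    have hV1 : ClopenInv V1 := hV.inter (clopenInv_snd hK1)
    have e : V = V1 ∪ (V \ V1) := (union_sdiff_cancel inter_subset_left).symm
    rw [e]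
    refine Decomposes.union ?_ ?_ disjoint_sdiff_self_right
    · rcases V1.eq_empty_or_nonempty with hemp | ⟨p, hp⟩
      · rw [hemp]; exact decomposes_empty
      · refine Good.decomposes (l := (ω, K)) (N := N) ⟨hV1, j, r, ⟨0, p.2, hp.2, hp.2⟩,
          fun p hp => h1 p (hVO hp.1), fun p hp p' hp' => h2 p (hVO hp.1) p' (hVO hp'.1)⟩
    · refine decomposes_off_spiral (j := j) (hV.diff hV1) (fun x c hx => ?_)
        (fun p hp => h1 p (hVO hp.1)) (fun p hp p' hp' => h2 p (hVO hp.1) p' (hVO hp'.1))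
      exact hx.2 ⟨hx.1, hV.wand_mem hx.1 0⟩
  · have ha : dpos p₀ ∈ cantorSet := by
      rcases dpos_mem_cantorSet_or p₀ with h | ⟨j, h⟩
      · exact h
      · exact absurd ⟨j, Ioo_subset_Icc_self h⟩ hp₀
    obtain ⟨j, -, -, -⟩ := exists_wand_mem isOpen_univ ⟨p₀, mem_univ _⟩
    obtain ⟨ω, K, r, N, O, hO, hK, hsub, h1, h2⟩ := exists_local_mach hφ hrel hg ha p₀.2 j
    obtain ⟨δ, hδ, Kc, hKc, hmem, hbox⟩ := exists_box hO (le_refl (dpos p₀))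
      fun p hp hpc => hsub p (le_antisymm hp.2 hp.1) hpc
    obtain ⟨e, he, heD⟩ := exists_cut_left ha hδ fun k hk h =>
      hp₀ ⟨⟨k, hk⟩, by rw [← h]; exact ⟨hk.1.le, le_rfl⟩⟩
    obtain ⟨e', he', heD'⟩ := exists_cut_right ha hδ fun k hk h =>
      hp₀ ⟨⟨k, hk⟩, by rw [← h]; exact ⟨le_rfl, hk.1.le⟩⟩
    refine ⟨boxOver e e' Kc, clopenInv_boxOver heD heD' hKc,
      mem_boxOver.2 ⟨by linarith [he.2], by linarith [he'.1], hmem⟩, ?_⟩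
    intro V hVU hV
    have hVO : V ⊆ O := fun p hp => by
      obtain ⟨a1, a2, a3⟩ := mem_boxOver.1 (hVU hp)
      exact hbox p ⟨by linarith [he.1], by linarith [he'.2]⟩ a3
    rcases V.eq_empty_or_nonempty with hemp | hne
    · rw [hemp]; exact decomposes_empty
    · exact (good_of_end hV hne hK (fun p hp => h1 p (hVO hp))
        fun p hp p' hp' => h2 p (hVO hp) p' (hVO hp')).decomposes

theorem ClopenInv.decomposes (hφ : Continuous φ)
    (hrel : ∀ p, WRel n (φ p) (φ (specialHomeo p))) (hg : Continuous g) {V : Set SpecialSpace}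
    (hV : ClopenInv V) : Decomposes φ g V := by
  have key : ∃ U, ClopenInv U ∧ univ ⊆ U ∧ ∀ V ⊆ U, ClopenInv V → Decomposes φ g V := by
    refine isCompact_univ.induction_on (p := fun s => ∃ U, ClopenInv U ∧ s ⊆ U ∧
      ∀ V ⊆ U, ClopenInv V → Decomposes φ g V) ?_ ?_ ?_ ?_
    · exact ⟨∅, clopenInv_empty, Subset.rfl, fun V hV _ => by
        rw [subset_empty_iff.1 hV]; exact decomposes_empty⟩
    · rintro s t hst ⟨U, h1, h2, h3⟩
      exact ⟨U, h1, hst.trans h2, h3⟩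
    · rintro s t ⟨U, h1, h2, h3⟩ ⟨U', h1', h2', h3'⟩
      refine ⟨U ∪ U', h1.union h1', union_subset_union h2 h2', fun V hVU hV => ?_⟩
      rw [← inter_union_sdiff V U]
      refine Decomposes.union (h3 _ inter_subset_right (hV.inter h1)) (h3' _ ?_ (hV.diff h1)) ?_
      · rintro p ⟨hp, hpU⟩
        exact (hVU hp).resolve_left hpU
      · exact disjoint_sdiff_self_right.mono_left inter_subset_right
    · intro p _
      obtain ⟨U, h1, h2, h3⟩ := exists_nhds_decomposes hφ hrel hg p
      exact ⟨U, mem_nhdsWithin_of_mem_nhds (h1.1.isOpen.mem_nhds h2), U, h1, Subset.rfl, h3⟩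
  obtain ⟨U, -, h2, h3⟩ := key
  exact h3 V ((subset_univ V).trans h2) hV

/-- Around a spiral which is mapped onto the copy `ω` of `Σ_n` there are pieces of all three
kinds. -/
theorem exists_good_of_each_side (hφ : Continuous φ)
    (hrel : ∀ p, WRel n (φ p) (φ (specialHomeo p))) (hg : Continuous g)
    (hsurj : Function.Surjective φ) (ω : Fin n → Letter) :
    ∃ (N : ℕ) (P : Side → Set SpecialSpace), (∀ K, Good φ g (ω, K) N (P K)) ∧
      ∀ K K' p, p ∈ P K → p ∈ P K' → K = K' := by
  -- The position `0` is interior when `n > 0`, so the orbit through a wandering preimage must cross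
  -- and `K = M`. For `n = 0` all retractions agree.
  let y : W n := (ω, (Spiral.ofInt 0).toFin n)
  obtain ⟨p, hp⟩ := hsurj y
  obtain ⟨j, x, c, hx⟩ := exists_wand_mem ((isOpen_discrete {y}).preimage hφ) ⟨p, hp⟩
  obtain ⟨ω', K, r, N, O, hO, hsub, h1, h2⟩ := exists_local_spiral hφ hrel hg j c
  have hx' := (h1 _ (hsub (wand_mem_spiralOver j x c))).symm.trans hx
  obtain rfl : ω' = ω := congrArg Prod.fst hx'
  have h1' : ∀ p ∈ O, φ p = (ω', ((loc j p).add r).toFin n) := by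
    intro p hp
    rw [h1 p hp]
    by_cases hK : K = .M
    · rw [hK]; rfl
    · obtain rfl := eq_zero_of_side hK rfl (congrArg Prod.snd hx')
      exact congrArg (Prod.mk ω') (Spiral.toFin_zero rfl)
  obtain ⟨δ, hδ, Kc, hKc, hmem, hbox⟩ := exists_box hO j.lt.le fun p hp hpc => hsub ⟨hp, hpc⟩
  obtain ⟨e, he, heD⟩ := exists_cut_left_gap j hδ
  obtain ⟨e', he', heD'⟩ := exists_cut_right_gap j hδ
  -- The order will be `e < k < f < j < f' < k' < e'`, with gaps `k`, `j`, `k'` separated by cuts.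
  -- The boxes around `k` and `k'` lie on either side of `j`, which gives the types `L` and `R`; the
  -- box around `j` has type `M`.
  obtain ⟨k, hk1, hk2⟩ := exists_gap_left j (δ := j.1.1 - e) (by linarith [he.2])
  obtain ⟨k', hk1', hk2'⟩ := exists_gap_right j (δ := e' - j.1.2) (by linarith [he'.1])
  obtain ⟨f, hf, hfD⟩ := exists_cut_left_gap j (δ := j.1.1 - k.1.2) (by linarith)
  obtain ⟨f', hf', hfD'⟩ := exists_cut_right_gap j (δ := k'.1.1 - j.1.2) (by linarith)
  have hj := j.lt
  have hBO : ∀ {a b}, e ≤ a → b ≤ e' → ∀ p ∈ boxOver a b Kc, p ∈ O := by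
    intro a b ha hb p hp
    obtain ⟨a1, a2, a3⟩ := mem_boxOver.1 hp
    exact hbox p ⟨by linarith [he.1], by linarith [he'.2]⟩ a3
  have part : ∀ (K : Side) (y : ZStar) (V : Set SpecialSpace), ClopenInv V → V.Nonempty → V ⊆ O →
      K ≠ .M → y.add r = y → K.act y = y → (∀ p ∈ V, spos j p = y) → Good φ g (ω', K) N V := by
    intro K y V hV hne hVO hK hy hKy hs
    refine good_of_end hV hne hK (j := j) (r := r) (fun p hp => ?_) fun p hp p' hp' e => ?_
    · rw [h1' p (hVO hp)]
      refine congrArg (fun s : Spiral => (ω', s.toFin n)) (Spiral.ext' ?_ rfl)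
      change (spos j p).add r = K.act ((spos j p).add r)
      rw [hs p hp, hy, hKy]
    · refine h2 p (hVO hp) p' (hVO hp') (Spiral.toFin_ext ?_ ?_)
      · change ((spos j p).add r).collapse N = ((spos j p').add r).collapse N
        rw [hs p hp, hs p' hp']
      · change tmod N (theta p + r) = tmod N (theta p' + r)
        rw [map_add, map_add, e]
  let P : Side → Set SpecialSpace := fun
    | .L => boxOver e f Kc
    | .M => boxOver f f' Kc
    | .R => boxOver f' e' Kc
  refine ⟨N, P, fun K => ?_, fun K K' p hp hp' => ?_⟩
  · cases K
    · refine part .L .negInf (boxOver e f Kc) (clopenInv_boxOver heD hfD hKc) ⟨wand k 0 c, ?_⟩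
        (hBO le_rfl (by linarith [hf.2, he'.1])) (by simp) rfl rfl fun p hp => ?_
      · have := dpos_wand k 0 c
        exact mem_boxOver.2 ⟨by linarith [this.1], by linarith [this.2, hf.1], hmem⟩
      · exact spos_of_le (by linarith [(mem_boxOver.1 hp).2.1, hf.2])
    · have hMO : ∀ p ∈ boxOver f f' Kc, p ∈ O :=
        hBO (by linarith [hf.1, hk1, k.lt]) (by linarith [hf'.2, hk2', k'.lt])
      have := dpos_wand j 0 c
      exact ⟨clopenInv_boxOver hfD hfD' hKc, j, r, ⟨0, c, mem_boxOver.2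
        ⟨by linarith [this.1, hf.2], by linarith [this.2, hf'.1], hmem⟩⟩,
        fun p hp => h1' p (hMO p hp), fun p hp p' hp' => h2 p (hMO p hp) p' (hMO p' hp')⟩
    · refine part .R .posInf (boxOver f' e' Kc) (clopenInv_boxOver hfD' heD' hKc) ⟨wand k' 0 c, ?_⟩
        (hBO (by linarith [hf'.1, he.2]) le_rfl) (by simp) rfl rfl fun p hp => ?_
      · have := dpos_wand k' 0 c
        exact mem_boxOver.2 ⟨by linarith [this.1, hf'.2], by linarith [this.2], hmem⟩
      · exact spos_of_ge (by linarith [(mem_boxOver.1 hp).1, hf'.1])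
  · have hff : f < f' := by linarith [hf.2, hf'.1]
    cases K <;> cases K' <;> first
      | rfl
      | (exfalso
         have a := mem_boxOver.1 hp
         have b := mem_boxOver.1 hp'
         linarith [a.1, a.2.1, b.1, b.2.1])

end Pieces

/-! ## Words -/

/-- The prefix of length `n` of a word. -/
def wpre (n : ℕ) : (k : ℕ) → (Fin (n + k) → Letter) → Fin n → Letter
  | 0, w => w
  | k + 1, w => wpre n k (Fin.init (n := n + k) w)

/-- The first letter after the prefix of length `n` which is not `M`, if there is one. -/
def wside (n : ℕ) : (k : ℕ) → (Fin (n + k) → Letter) → Side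
  | 0, _ => .M
  | k + 1, w => (wside n k (Fin.init (n := n + k) w)).comp (w (Fin.last (n + k))).1

/-- On the full spiral the bonding maps are retractions, and in a composition of these only the
first letter other than `M` acts. -/
theorem xiIter_toFin (n k : ℕ) (w : Fin (n + k) → Letter) (s : Spiral) :
    xiIter n k (w, s.toFin (n + k)) = (wpre n k w, (s.side (wside n k w)).toFin n) := by
  induction k generalizing s with
  | zero => rfl
  | succ k ih =>
    have h : xi (n + k) (w, s.toFin (n + (k + 1))) =
        (Fin.init (n := n + k) w, (s.side (w (Fin.last (n + k))).1).toFin (n + k)) :=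
      Prod.ext rfl (Spiral.xiSide_toFin _ _ _)
    change xiIter n k (xi (n + k) (w, s.toFin (n + (k + 1)))) = _
    rw [h, ih]
    simp only [wpre, wside, Spiral.side_comp]
    rfl

instance : Finite Side :=
  Finite.of_surjective (fun i : Fin 3 => if i = 0 then Side.L else if i = 1 then .M else .R)
    fun K => by
      cases K
      · exact ⟨0, rfl⟩
      · exact ⟨1, rfl⟩
      · exact ⟨2, rfl⟩

/-- After one letter which gives the label, `M₁` or `M₂` can be appended freely; the count at least
doubles each time, and a linear bound suffices. -/
theorem le_card_words (n : ℕ) (l : (Fin n → Letter) × Side) (k : ℕ) :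
    k ≤ Nat.card {w : Fin (n + k) → Letter // (wpre n k w, wside n k w) = l} := by
  induction k with
  | zero => exact Nat.zero_le _
  | succ k ih =>
    rcases Nat.eq_zero_or_pos k with rfl | hk
    · have : Nonempty {w : Fin (n + (0 + 1)) → Letter // (wpre n (0 + 1) w, wside n (0 + 1) w) = l} :=
        ⟨⟨Fin.snoc (n := n) (α := fun _ => Letter) l.1 (l.2, 0), by simp [wpre, wside, Side.comp]⟩⟩
      exact Nat.card_pos
    · let F : {w : Fin (n + k) → Letter // (wpre n k w, wside n k w) = l} × Fin 2 →
          {w : Fin (n + (k + 1)) → Letter // (wpre n (k + 1) w, wside n (k + 1) w) = l} := fun q =>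
        ⟨Fin.snoc (n := n + k) (α := fun _ => Letter) q.1.1 (.M, q.2), by
          have hc : ∀ K : Side, K.comp .M = K := fun K => by cases K <;> rfl
          simp only [wpre, wside, Fin.init_snoc, Fin.snoc_last, hc]
          exact q.1.2⟩
      have hF : Function.Injective F := by
        rintro ⟨⟨w, hw⟩, i⟩ ⟨⟨w', hw'⟩, i'⟩ h
        have h' := congrArg Subtype.val h
        have e1 := congrArg (Fin.init (n := n + k) (α := fun _ => Letter)) h'
        have e2 := congrFun h' (Fin.last (n + k))
        simp only [F, Fin.init_snoc, Fin.snoc_last] at e1 e2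
        subst e1
        simp only [Prod.mk.injEq, true_and] at e2
        rw [e2]
      have := Nat.card_le_card_of_injective F hF
      rw [Nat.card_prod, Nat.card_fin] at this
      omega

/-! ## The Lifting Property of the Special Homeomorphism -/

theorem exists_loc_eq (j : Gap) (c : cantorSet) (r : ℤ) (s : Spiral) :
    ∃ p ∈ spiralOver j c, (loc j p).add r = s := by
  suffices h : ∃ p ∈ spiralOver j c, loc j p = s.add (-r) by
    obtain ⟨p, hp, e⟩ := h
    exact ⟨p, hp, by rw [e, Spiral.add_add, neg_add_cancel, Spiral.add_zero']⟩
  generalize s.add (-r) = s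
  obtain ⟨⟨y, t⟩, hs⟩ := s
  cases y with
  | negInf =>
    exact ⟨mach j.2.2.1 t c, ⟨⟨le_rfl, j.lt.le⟩, rfl⟩, Spiral.ext' (spos_of_le le_rfl) rfl⟩
  | posInf =>
    exact ⟨mach j.2.2.2.1 t c, ⟨⟨j.lt.le, le_rfl⟩, rfl⟩, Spiral.ext' (spos_of_ge le_rfl) rfl⟩
  | int x =>
    exact ⟨wand j x c, wand_mem_spiralOver j x c, Spiral.ext' (spos_wand j x c) (hs x rfl).symm⟩

section Lift

variable {n : ℕ} {φ : SpecialSpace → W n} {G : Type*} [TopologicalSpace G] [DiscreteTopology G]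
  {g : SpecialSpace → G}

/-- Pieces of every label are set aside first, and their complement, again clopen and invariant, is
decomposed. -/
theorem exists_full_decomposition (hφ : Continuous φ)
    (hrel : ∀ p, WRel n (φ p) (φ (specialHomeo p))) (hg : Continuous g)
    (hsurj : Function.Surjective φ) :
    ∃ (N : ℕ) (S : Finset (((Fin n → Letter) × Side) × Set SpecialSpace)),
      (∀ q ∈ S, Good φ g q.1 N q.2) ∧ (∀ q ∈ S, ∀ q' ∈ S, ∀ p, p ∈ q.2 → p ∈ q'.2 → q = q') ∧
      (∀ p, ∃ q ∈ S, p ∈ q.2) ∧ ∀ l, ∃ q ∈ S, q.1 = l := by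
  classical
  choose N₁ P hP hPd using exists_good_of_each_side hφ hrel hg hsurj
  have := Fintype.ofFinite ((Fin n → Letter) × Side)
  have := Fintype.ofFinite (Fin n → Letter)
  -- Pieces for different `ω` are disjoint because `φ` itself reads off `ω`.
  have hPω : ∀ (l : (Fin n → Letter) × Side) (p : SpecialSpace), p ∈ P l.1 l.2 → (φ p).1 = l.1 := fun l p hp => by
    obtain ⟨-, j, r, -, h, -⟩ := hP l.1 l.2
    rw [h p hp]
  have hQ : ClopenInv (⋃ l : (Fin n → Letter) × Side, P l.1 l.2) :=
    ⟨isClopen_iUnion_of_finite fun l => (hP l.1 l.2).1.1, fun p => by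
      simp only [mem_iUnion, (hP _ _).1.2 p]⟩
  obtain ⟨N₂, S, h1, h2, h3⟩ := hQ.compl.decomposes hφ hrel hg
  let S₁ : Finset (((Fin n → Letter) × Side) × Set SpecialSpace) :=
    Finset.univ.image fun l => (l, P l.1 l.2)
  have hS₁ : ∀ q, q ∈ S₁ ↔ q.2 = P q.1.1 q.1.2 := fun q => by
    simp only [S₁, Finset.mem_image, Finset.mem_univ, true_and]
    exact ⟨by rintro ⟨l, rfl⟩; rfl, fun h => ⟨q.1, Prod.ext rfl h.symm⟩⟩
  have hd : ∀ q ∈ S, ∀ q' ∈ S₁, ∀ p, p ∈ q.2 → p ∈ q'.2 → False := by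
    intro q hq q' hq' p hp hp'
    rw [(hS₁ q').1 hq'] at hp'
    exact (h3 p).1 ⟨q, hq, hp⟩ (mem_iUnion.2 ⟨q'.1, hp'⟩)
  refine ⟨max N₂ (Finset.univ.sup N₁), S ∪ S₁, fun q hq => ?_, fun q hq q' hq' p hp hp' => ?_,
    fun p => ?_, fun l => ⟨(l, P l.1 l.2), Finset.mem_union_right _ ((hS₁ _).2 rfl), rfl⟩⟩
  · rcases Finset.mem_union.1 hq with hq | hq
    · exact (h1 q hq).mono (le_max_left _ _)
    · rw [(hS₁ q).1 hq]
      exact (hP q.1.1 q.1.2).mono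
        ((Finset.le_sup (f := N₁) (Finset.mem_univ q.1.1)).trans (le_max_right _ _))
  · rcases Finset.mem_union.1 hq with hq | hq <;> rcases Finset.mem_union.1 hq' with hq' | hq'
    · exact h2 q hq q' hq' p hp hp'
    · exact (hd q hq q' hq' p hp hp').elim
    · exact (hd q' hq' q hq p hp' hp).elim
    · rw [(hS₁ q).1 hq] at hp
      rw [(hS₁ q').1 hq'] at hp'
      have e1 : q.1.1 = q'.1.1 := (hPω q.1 p hp).symm.trans (hPω q'.1 p hp')
      rw [e1] at hp
      have e : q.1 = q'.1 := Prod.ext e1 (hPd _ _ _ p hp hp')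
      exact Prod.ext e (by rw [(hS₁ q).1 hq, (hS₁ q').1 hq', e])
  · by_cases hp : p ∈ ⋃ l : (Fin n → Letter) × Side, P l.1 l.2
    · obtain ⟨l, hl⟩ := mem_iUnion.1 hp
      exact ⟨(l, P l.1 l.2), Finset.mem_union_right _ ((hS₁ _).2 rfl), hl⟩
    · obtain ⟨q, hq, hpq⟩ := (h3 p).2 hp
      exact ⟨q, Finset.mem_union_left _ hq, hpq⟩

/-- There is a decomposition of the space into pieces indexed by the words of some length. -/
theorem exists_word_decomposition (hφ : Continuous φ)
    (hrel : ∀ p, WRel n (φ p) (φ (specialHomeo p))) (hg : Continuous g)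
    (hsurj : Function.Surjective φ) :
    ∃ (k : ℕ) (F : (Fin (n + k) → Letter) → Set SpecialSpace), 0 < k ∧
      (∀ w, Good φ g (wpre n k w, wside n k w) (n + k) (F w)) ∧
      (∀ w w' p, p ∈ F w → p ∈ F w' → w = w') ∧ ∀ p, ∃ w, p ∈ F w := by
  classical
  obtain ⟨N, S, h1, h2, h3, h4⟩ := exists_full_decomposition hφ hrel hg hsurj
  -- `N ≤ n + k` makes the level fine enough for `g`; `S.card ≤ k` ensures that each label has at
  -- least as many words as pieces.
  obtain ⟨k, hk0, hkN, hkS⟩ : ∃ k, 0 < k ∧ N ≤ n + k ∧ S.card ≤ k :=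
    ⟨N + S.card + 1, by omega, by omega, by omega⟩
  have hsub : ∀ l, ∃ f : {w : Fin (n + k) → Letter // (wpre n k w, wside n k w) = l} →
      Set SpecialSpace, (∀ i, Good φ g l (n + k) (f i)) ∧
      (∀ i i' p, p ∈ f i → p ∈ f i' → i = i') ∧
      ∀ p, (∃ i, p ∈ f i) ↔ ∃ i : {q // q ∈ S ∧ q.1 = l}, p ∈ i.1.2 := by
    intro l
    obtain ⟨q, hq, hql⟩ := h4 l
    have : Finite {q // q ∈ S ∧ q.1 = l} :=
      Finite.of_injective (fun q => (⟨q.1, q.2.1⟩ : S)) fun a b h => Subtype.ext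
        (congrArg (fun s : S => s.1) h)
    have : Nonempty {q // q ∈ S ∧ q.1 = l} := ⟨⟨q, hq, hql⟩⟩
    refine exists_subdivision (P := fun i : {q // q ∈ S ∧ q.1 = l} => i.1.2) ?_ ?_ ?_
    · refine le_trans ?_ (hkS.trans (le_card_words n l k))
      have := Nat.card_le_card_of_injective (fun q : {q // q ∈ S ∧ q.1 = l} => (⟨q.1, q.2.1⟩ : S))
        fun a b h => Subtype.ext (congrArg (fun s : S => s.1) h)
      simpa using this
    · rintro ⟨q, hq, rfl⟩
      exact (h1 q hq).mono hkN
    · rintro ⟨q, hq, hql⟩ ⟨q', hq', hql'⟩ p hp hp'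
      exact Subtype.ext (h2 q hq q' hq' p hp hp')
  choose f hf1 hf2 hf3 using hsub
  have key : ∀ w l (h : (wpre n k w, wside n k w) = l),
      f (wpre n k w, wside n k w) ⟨w, rfl⟩ = f l ⟨w, h⟩ := by rintro w _ rfl; rfl
  refine ⟨k, fun w => f _ ⟨w, rfl⟩, hk0, fun w => hf1 _ _, fun w w' p hp hp' => ?_, fun p => ?_⟩
  · obtain ⟨⟨q, hq, hql⟩, hpq⟩ := (hf3 _ p).1 ⟨_, hp⟩
    obtain ⟨⟨q', hq', hql'⟩, hpq'⟩ := (hf3 _ p).1 ⟨_, hp'⟩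
    obtain rfl := h2 q hq q' hq' p hpq hpq'
    have e := hql'.symm.trans hql
    exact congrArg Subtype.val (hf2 _ _ _ p hp ((congrArg (p ∈ ·) (key w' _ e)).mp hp'))
  · obtain ⟨q, hq, hp⟩ := h3 p
    obtain ⟨⟨w, hw⟩, h⟩ := (hf3 q.1 p).2 ⟨⟨q, hq, rfl⟩, hp⟩
    exact ⟨w, (congrArg (p ∈ ·) (key w _ hw)).mpr h⟩

/-- The lift sends the piece of the word `w` to the copy `w` of `Σ_{n+k}` by the retraction of that
piece. The function `g` encodes the condition on the fibres. -/
theorem exists_lift (hφ : Continuous φ) (hmap : MapsRel φ (graphRel specialHomeo) (WRel n))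
    (hg : Continuous g) :
    ∃ k : ℕ, 0 < k ∧ ∃ ρ : SpecialSpace → W (n + k), Continuous ρ ∧
      MapsRel ρ (graphRel specialHomeo) (WRel (n + k)) ∧
      (∀ p p', ρ p = ρ p' → g p = g p') ∧ φ = xiIter n k ∘ ρ := by
  have hrel : ∀ p, WRel n (φ p) (φ (specialHomeo p)) :=
    fun p => (hmap.2 _ _).2 ⟨p, _, rfl, rfl, rfl⟩
  obtain ⟨k, F, hk, hF, hFd, hFu⟩ := exists_word_decomposition hφ hrel hg hmap.1
  choose hinv j r hne hφF hgF using hF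
  choose w hw using hFu
  have hwu : ∀ {p v}, p ∈ F v → w p = v := fun h => hFd _ _ _ (hw _) h
  let ρ : SpecialSpace → W (n + k) := fun p =>
    (w p, ((loc (j (w p)) p).add (r (w p))).toFin (n + k))
  have hρ : ∀ {p v}, p ∈ F v → ρ p = (v, ((loc (j v) p).add (r v)).toFin (n + k)) := by
    intro p v h
    obtain rfl := hwu h
    rfl
  have hwT : ∀ p, w (specialHomeo p) = w p := fun p => hwu (((hinv (w p)).2 p).2 (hw p))
  have hρT : ∀ p, ρ (specialHomeo p) =
      (w p, (((loc (j (w p)) p).add (r (w p))).add 1).toFin (n + k)) := fun p => by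
    rw [hρ (((hinv (w p)).2 p).2 (hw p)), loc_special, Spiral.add_comm']
  -- A closed invariant set with one wandering point contains the closed spiral through it, so every
  -- piece is retracted onto the full spiral.
  have hex : ∀ v s, ∃ p ∈ F v, (loc (j v) p).add (r v) = s := by
    intro v s
    obtain ⟨x, c, hx⟩ := hne v
    obtain ⟨p, hp, e⟩ := exists_loc_eq (j v) c (r v) s
    exact ⟨p, spiralOver_subset_of_isClosed (hinv v).1.isClosed (fun y => (hinv v).wand_mem hx y) hp, e⟩
  refine ⟨k, hk, ρ, ?_, ⟨?_, fun a b => ?_⟩, fun p p' h => ?_, funext fun p => ?_⟩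
  · rw [continuous_discrete_rng]
    intro b
    have : ρ ⁻¹' {b} = F b.1 ∩
        (fun p => (((loc (j b.1) p).add (r b.1)).side .M).toFin (n + k)) ⁻¹' {b.2} := by
      ext p
      constructor
      · rintro rfl
        exact ⟨hw p, rfl⟩
      · rintro ⟨h1, h2⟩
        exact (hρ h1).trans (Prod.ext rfl h2)
    rw [this]
    exact (hinv b.1).1.isOpen.inter
      ((isOpen_discrete _).preimage (continuous_loc (j b.1) (r b.1) .M (n + k)))
  · rintro ⟨v, a⟩
    obtain ⟨s, rfl⟩ := Spiral.toFin_surjective (n + k) a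
    obtain ⟨p, hp, e⟩ := hex v s
    exact ⟨p, by rw [hρ hp, e]⟩
  · constructor
    · obtain ⟨v, a⟩ := a
      obtain ⟨v', b⟩ := b
      rintro ⟨h1, h2⟩
      obtain rfl : v = v' := h1
      obtain ⟨s, rfl, rfl⟩ := Spiral.rel_iff.1 h2
      obtain ⟨p, hp, rfl⟩ := hex v s
      obtain rfl := hwu hp
      exact ⟨p, _, rfl, rfl, hρT p⟩
    · rintro ⟨x, _, rfl, rfl, rfl⟩
      refine ⟨(hwT x).symm, ?_⟩
      rw [hρT]
      exact Spiral.rel_iff.2 ⟨_, rfl, rfl⟩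
  · have h1 : w p = w p' := congrArg Prod.fst h
    have hp' := hw p'
    rw [← h1] at hp'
    have h2 := congrArg Prod.snd h
    refine hgF (w p) p (hw p) p' hp' ?_
    have h3 := hρ hp'
    rw [← h] at h3
    exact congrArg Prod.snd h3
  · exact (hφF (w p) p (hw p)).trans (xiIter_toFin n k (w p) _).symm

end Lift

/-- Every system which is isomorphic to the Special Homeomorphism has the Lifting Property. -/
theorem liftingProperty_of_conj {X : Type*} [MetricSpace X] [CompactSpace X]
    [TotallyDisconnectedSpace X] {T : X ≃ₜ X} (H : X ≃ₜ SpecialSpace)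
    (hH : ∀ x, H (T x) = specialHomeo (H x)) : LiftingProperty T := by
  intro n φ hφ hmap ε hε
  -- a locally constant function with small fibres
  have hcov : ∀ x : X, ∃ U : Set X, IsClopen U ∧ x ∈ U ∧ U ⊆ Metric.ball x (ε / 2) := fun x =>
    compact_exists_isClopen_in_isOpen Metric.isOpen_ball (Metric.mem_ball_self (by positivity))
  choose U hU hxU hUb using hcov
  obtain ⟨s, hs⟩ := isCompact_univ.elim_finite_subcover U (fun x => (hU x).isOpen)
    fun x _ => mem_iUnion.2 ⟨x, hxU x⟩
  classical
  let g : X → s → Bool := fun x i => decide (x ∈ U i)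
  have hg : Continuous g := by
    refine continuous_pi fun i => ?_
    rw [continuous_discrete_rng]
    rintro (_ | _)
    · convert (hU i).compl.isOpen using 1
      ext x; simp [g]
    · convert (hU i).isOpen using 1
      ext x; simp [g]
  have hgε : ∀ x y, g x = g y → dist x y ≤ ε := by
    intro x y h
    obtain ⟨i, hi, hxi⟩ := mem_iUnion₂.1 (hs (mem_univ x))
    have := congrFun h ⟨i, hi⟩
    have hyi : y ∈ U i := by simpa [g, hxi] using this
    have h1 := Metric.mem_ball.1 (hUb i hxi)
    have h2 := Metric.mem_ball'.1 (hUb i hyi)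
    linarith [dist_triangle x i y]
  have hTs : ∀ p, T (H.symm p) = H.symm (specialHomeo p) := fun p => by
    rw [H.eq_symm_apply, hH, H.apply_symm_apply]
  have hmap' : MapsRel (φ ∘ H.symm) (graphRel specialHomeo) (WRel n) := by
    refine ⟨hmap.1.comp H.symm.surjective, fun a b => (hmap.2 a b).trans ?_⟩
    constructor
    · rintro ⟨x, _, rfl, rfl, rfl⟩
      exact ⟨H x, _, rfl, by simp, by simp [← hH]⟩
    · rintro ⟨x, _, rfl, rfl, rfl⟩
      exact ⟨H.symm x, _, rfl, rfl, by simp [hTs]⟩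
  obtain ⟨k, hk, ρ, h1, h2, h3, h4⟩ := exists_lift (hφ.comp H.symm.continuous) hmap'
    (hg.comp H.symm.continuous)
  refine ⟨k, hk, ρ ∘ H, h1.comp H.continuous, ⟨h2.1.comp H.surjective, fun a b => ?_⟩,
    fun a => Metric.diam_le_of_forall_dist_le hε.le ?_, ?_⟩
  · refine (h2.2 a b).trans ?_
    constructor
    · rintro ⟨x, _, rfl, rfl, rfl⟩
      exact ⟨H.symm x, _, rfl, by simp, by simp [hTs]⟩
    · rintro ⟨x, _, rfl, rfl, rfl⟩
      exact ⟨H x, _, rfl, rfl, by simp [hH]⟩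
  · intro x hx y hy
    refine hgε x y ?_
    have := h3 (H x) (H y) (Eq.trans hx (Eq.symm hy))
    simpa using this
  · rw [← Function.comp_assoc, ← h4]
    ext x
    simp

/-! ## Systems with the Lifting Property are inverse limits -/

theorem wRel_xi {n : ℕ} {a b : W (n + 1)} (h : WRel (n + 1) a b) : WRel n (xi n a) (xi n b) := by
  obtain ⟨w, s⟩ := a
  obtain ⟨w', s'⟩ := b
  obtain ⟨h1, h2⟩ := h
  obtain rfl : w = w' := h1
  obtain ⟨u, rfl, rfl⟩ := Spiral.rel_iff.1 h2
  refine ⟨rfl, ?_⟩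
  change FinSpiral.Rel (xiSide _ _) (xiSide _ _)
  rw [Spiral.xiSide_toFin, Spiral.xiSide_toFin, Spiral.side_add]
  exact Spiral.rel_iff.2 ⟨_, rfl, rfl⟩

theorem wRel_nonempty (n : ℕ) : Nonempty (W n) :=
  ⟨(fun _ => (.M, 0), (Spiral.ofInt 0).toFin n)⟩

/-- The image in `𝓦_m` of a point of `𝓦_N`, when `m ≤ N` (and a constant otherwise). -/
noncomputable def down : (N : ℕ) → W N → (m : ℕ) → W m
  | 0, a, m => if h : m = 0 then h ▸ a else (wRel_nonempty m).some
  | N + 1, a, m => if h : m = N + 1 then h ▸ a else down N (xi N a) m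

theorem down_self (N : ℕ) (a : W N) : down N a N = a := by
  cases N <;> simp [down]

theorem down_succ {N m : ℕ} (h : m ≤ N) (a : W (N + 1)) : down (N + 1) a m = down N (xi N a) m := by
  simp only [down]
  rw [dif_neg (by omega)]

/-- `down` takes the target level as an argument, so that stages of different levels can be compared
without writing one level as a sum. Here it is matched with the iterated bonding map. -/
theorem down_add {n m : ℕ} (h : m ≤ n) (k : ℕ) (a : W (n + k)) :
    down (n + k) a m = down n (xiIter n k a) m := by
  induction k with
  | zero => rfl
  | succ k ih => exact (down_succ (N := n + k) (by omega) a).trans (ih _)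

theorem xi_down {N m : ℕ} (h : m + 1 ≤ N) (a : W N) : xi m (down N a (m + 1)) = down N a m := by
  induction N with
  | zero => omega
  | succ N ih =>
    rw [down_succ (by omega : m ≤ N)]
    rcases Nat.eq_or_lt_of_le h with h | h
    · obtain rfl : m = N := by omega
      rw [down_self, down_self]
    · rw [down_succ (by omega), ih (by omega)]

theorem down_thread (u : WInf) {N m : ℕ} (h : m ≤ N) : down N (u.1 N) m = u.1 m := by
  induction N with
  | zero =>
    obtain rfl : m = 0 := by omega
    exact down_self _ _
  | succ N ih =>
    rcases Nat.eq_or_lt_of_le h with rfl | h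
    · exact down_self _ _
    · rw [down_succ (by omega), u.2 N, ih (by omega)]

theorem wRel_down {N m : ℕ} (h : m ≤ N) {a b : W N} (hab : WRel N a b) :
    WRel m (down N a m) (down N b m) := by
  induction N with
  | zero =>
    obtain rfl : m = 0 := by omega
    rwa [down_self, down_self]
  | succ N ih =>
    rcases Nat.eq_or_lt_of_le h with rfl | h
    · rwa [down_self, down_self]
    · rw [down_succ (by omega), down_succ (by omega)]
      exact ih (by omega) (wRel_xi hab)

theorem finSpiral_zero_subsingleton (a b : FinSpiral 0) : a = b := by
  obtain ⟨s, rfl⟩ := Spiral.toFin_surjective 0 a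
  obtain ⟨s', rfl⟩ := Spiral.toFin_surjective 0 b
  have h : ∀ t t' : ZMod (Nat.factorial 0), t = t' := fun t t' => Subsingleton.elim (α := Fin 1) t t'
  have : ∀ y : ZStar, y.collapse 0 = 0 := fun y => by
    cases y <;> simp only [ZStar.collapse] <;> omega
  exact Spiral.toFin_ext ((this _).trans (this _).symm) (h _ _)

instance : T2Space WInf := inferInstanceAs (T2Space (Subtype _))

section Limit

variable {X : Type*} [MetricSpace X]

/-- A continuous map to some `𝓦_n` which maps `T` to `R_n`. -/
structure Stage (T : X ≃ₜ X) where
  n : ℕ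
  toFun : X → W n
  cont : Continuous toFun
  maps : MapsRel toFun (graphRel T) (WRel n)

variable {T : X ≃ₜ X}

theorem LiftingProperty.exists_next (hT : LiftingProperty T) (s : Stage T) {ε : ℝ} (hε : 0 < ε) :
    ∃ s' : Stage T, s.n < s'.n ∧ (∀ a, Metric.diam (s'.toFun ⁻¹' {a}) ≤ ε) ∧
      ∀ x, ∀ m ≤ s.n, down s'.n (s'.toFun x) m = down s.n (s.toFun x) m := by
  obtain ⟨k, hk, ρ, h1, h2, h3, h4⟩ := hT s.n s.toFun s.cont s.maps ε hε
  refine ⟨⟨s.n + k, ρ, h1, h2⟩, Nat.lt_add_of_pos_right hk, h3, fun x m hm => ?_⟩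
  rw [down_add hm, h4]
  rfl

/-- The constant map to the one-point space `𝓦_0`. -/
noncomputable def Stage.initial [Nonempty X] (T : X ≃ₜ X) : Stage T where
  n := 0
  toFun _ := (wRel_nonempty 0).some
  cont := continuous_const
  maps := by
    -- `𝓦_0` is one point: the empty word, one position, one residue modulo `0! = 1`.
    have hsub : ∀ a b : W 0, a = b := fun a b =>
      Prod.ext (Subsingleton.elim _ _) (finSpiral_zero_subsingleton _ _)
    refine ⟨fun a => ⟨Classical.arbitrary X, hsub _ _⟩, fun a b => ⟨fun _ =>
      ⟨Classical.arbitrary X, _, rfl, hsub _ _, hsub _ _⟩, fun _ => ?_⟩⟩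
    obtain ⟨w, s⟩ := a
    obtain ⟨u, hu⟩ := Spiral.toFin_surjective 0 s
    exact ⟨congrArg Prod.fst (hsub _ _), Spiral.rel_iff.2
      ⟨u, finSpiral_zero_subsingleton _ _, finSpiral_zero_subsingleton _ _⟩⟩

theorem LiftingProperty.exists_sequence [Nonempty X] (hT : LiftingProperty T) :
    ∃ s : ℕ → Stage T, (∀ i, (s i).n < (s (i + 1)).n) ∧
      (∀ i a, Metric.diam ((s (i + 1)).toFun ⁻¹' {a}) ≤ 1 / ((i : ℝ) + 1)) ∧
      ∀ i x, ∀ m ≤ (s i).n,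
        down (s (i + 1)).n ((s (i + 1)).toFun x) m = down (s i).n ((s i).toFun x) m := by
  choose f h1 h2 h3 using fun (i : ℕ) (s : Stage T) =>
    hT.exists_next s (show (0 : ℝ) < 1 / ((i : ℝ) + 1) by positivity)
  exact ⟨fun i => Nat.rec (Stage.initial T) f i, fun i => h1 i _, fun i => h2 i _, fun i => h3 i _⟩

/-- A system with the Lifting Property is isomorphic to the inverse limit `(𝓦_∞, R_∞)`. -/
theorem LiftingProperty.exists_homeomorph [Nonempty X] [CompactSpace X] (hT : LiftingProperty T) :
    ∃ H : X ≃ₜ WInf, MapsRel H (graphRel T) RInf := by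
  obtain ⟨s, hlt, hdiam, hdown⟩ := hT.exists_sequence
  have hmono : StrictMono fun i => (s i).n := strictMono_nat_of_lt_succ hlt
  have hge : ∀ i, i ≤ (s i).n := fun _ => hmono.le_apply
  have hdown' : ∀ {i i'}, i ≤ i' → ∀ x, ∀ m ≤ (s i).n,
      down (s i').n ((s i').toFun x) m = down (s i).n ((s i).toFun x) m := by
    intro i i' h x m hm
    induction i', h using Nat.le_induction with
    | base => rfl
    | succ i' hi' ih => rw [hdown i' x m (hm.trans (hmono.monotone hi')), ih]
  -- Stage `m` has level at least `m`, so it determines coordinate `m`; later stages give the same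
  -- value.
  let H : X → WInf := fun x => ⟨fun m => down (s m).n ((s m).toFun x) m, fun m => by
    rw [xi_down (hge (m + 1))]
    exact hdown m x m (hge m)⟩
  have hH : ∀ i x, (H x).1 (s i).n = (s i).toFun x := fun i x => by
    change down (s (s i).n).n ((s (s i).n).toFun x) (s i).n = _
    rw [hdown' (hge i) x _ le_rfl, down_self]
  have hclose : ∀ i x y, (s (i + 1)).toFun x = (s (i + 1)).toFun y → dist x y ≤ 1 / ((i : ℝ) + 1) :=
    fun i x y h => (Metric.dist_le_diam_of_mem (Metric.isBounded_of_compactSpace) (by rfl)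
      (show y ∈ (s (i + 1)).toFun ⁻¹' {(s (i + 1)).toFun x} from h.symm)).trans (hdiam i _)
  have hlim := tendsto_one_div_add_atTop_nhds_zero_nat (𝕜 := ℝ)
  have hcont : Continuous H := by
    refine Continuous.subtype_mk (continuous_pi fun m => ?_) _
    exact (continuous_of_discreteTopology (f := fun a => down (s m).n a m)).comp (s m).cont
  have hinj : Function.Injective H := by
    intro x y hxy
    refine dist_le_zero.1 (ge_of_tendsto' hlim fun i => hclose i x y ?_)
    rw [← hH, ← hH, hxy]
  -- The fibres of the stages over the coordinates of `u` are nonempty, compact and decreasing; a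
  -- common point maps to `u`.
  have hsurj : Function.Surjective H := by
    intro u
    obtain ⟨x, hx⟩ := IsCompact.nonempty_iInter_of_sequence_nonempty_isCompact_isClosed
      (fun i => (s i).toFun ⁻¹' {u.1 (s i).n})
      (fun i x hx => by
        change (s i).toFun x = u.1 (s i).n
        have h1 := hdown i x (s i).n le_rfl
        rw [show (s (i + 1)).toFun x = u.1 (s (i + 1)).n from hx, down_self,
          down_thread u (hlt i).le] at h1
        exact h1.symm)
      (fun i => (s i).maps.1 _)
      ((isClosed_discrete _).preimage (s 0).cont).isCompact
      (fun i => (isClosed_discrete _).preimage (s i).cont)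
    refine ⟨x, Subtype.ext (funext fun m => ?_)⟩
    have hx' : (s m).toFun x = u.1 (s m).n := mem_iInter.1 hx m
    change down (s m).n ((s m).toFun x) m = u.1 m
    rw [hx', down_thread u (hge m)]
  refine ⟨Continuous.homeoOfEquivCompactToT2 (f := Equiv.ofBijective H ⟨hinj, hsurj⟩) hcont,
    hsurj, fun a b => ⟨fun hab => ?_, ?_⟩⟩
  · obtain ⟨x, rfl⟩ := hsurj a
    obtain ⟨y, rfl⟩ := hsurj b
    refine ⟨x, y, ?_, rfl, rfl⟩
    -- the points which realise the relation at the finite stages converge to `x` and `y`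
    choose z _ hz hzx hzy using fun i : ℕ => ((s (i + 1)).maps.2 _ _).1 (hab (s (i + 1)).n)
    have hzx' : Filter.Tendsto z Filter.atTop (𝓝 x) := by
      refine tendsto_iff_dist_tendsto_zero.2 (squeeze_zero (fun _ => dist_nonneg) (fun i => ?_) hlim)
      exact hclose i _ _ ((hzx i).trans (hH (i + 1) x))
    have hzy' : Filter.Tendsto (fun i => T (z i)) Filter.atTop (𝓝 y) := by
      refine tendsto_iff_dist_tendsto_zero.2 (squeeze_zero (fun _ => dist_nonneg) (fun i => ?_) hlim)
      refine hclose i _ _ (Eq.trans ?_ (hH (i + 1) y))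
      rw [show T (z i) = _ from hz i]
      exact hzy i
    exact tendsto_nhds_unique ((T.continuous.tendsto x).comp hzx') hzy'
  · rintro ⟨x, _, rfl, rfl, rfl⟩ m
    exact wRel_down (hge m) (((s m).maps.2 _ _).2 ⟨x, _, rfl, rfl, rfl⟩)

end Limit

end GenericHomeo

theorem corollary2p3 :
    (∀ (X : Type*) [MetricSpace X], GenericHomeo.IsCantorSpace X → ∀ T : X ≃ₜ X,
      (GenericHomeo.LiftingProperty T ↔
        ∃ H : X ≃ₜ GenericHomeo.SpecialSpace,
          ∀ x, H (T x) = GenericHomeo.specialHomeo (H x))) ∧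
    GenericHomeo.IsCantorSpace GenericHomeo.SpecialSpace ∧
    ∃ H : GenericHomeo.SpecialSpace ≃ₜ GenericHomeo.WInf,
      GenericHomeo.MapsRel H (GenericHomeo.graphRel GenericHomeo.specialHomeo)
        GenericHomeo.RInf := by
  have hC := GenericHomeo.isCantorSpace_special
  have hS : ∃ H : GenericHomeo.SpecialSpace ≃ₜ GenericHomeo.WInf,
      GenericHomeo.MapsRel H (GenericHomeo.graphRel GenericHomeo.specialHomeo)
        GenericHomeo.RInf := by
    have := hC.nonempty
    have := hC.metrizable
    have := hC.totallyDisconnected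
    -- Any compatible metric will do; the Lifting Property is then obtained from the identity
    -- conjugacy.
    let _ := TopologicalSpace.metrizableSpaceMetric GenericHomeo.SpecialSpace
    exact (GenericHomeo.liftingProperty_of_conj (T := GenericHomeo.specialHomeo)
      (Homeomorph.refl _) fun _ => rfl).exists_homeomorph
  refine ⟨fun X _ hX T => ⟨fun hT => ?_, fun ⟨H, hH⟩ => ?_⟩, hC, hS⟩
  · have := hX.nonempty
    have := hX.compact
    obtain ⟨H₁, -, h₁⟩ := hT.exists_homeomorph
    obtain ⟨H₂, -, h₂⟩ := hS
    refine ⟨H₁.trans H₂.symm, fun x => ?_⟩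
    -- `R_∞` holds between `H₁ x` and `H₁ (T x)`, and its pullback by `H₂` is the graph of the
    -- Special Homeomorphism.
    obtain ⟨p, q, hpq, hp, hq⟩ := (h₂ _ _).1 ((h₁ _ _).2 ⟨x, _, rfl, rfl, rfl⟩)
    have hp' : H₂.symm (H₁ x) = p := by rw [← hp, H₂.symm_apply_apply]
    have hq' : H₂.symm (H₁ (T x)) = q := by rw [← hq, H₂.symm_apply_apply]
    rw [Homeomorph.trans_apply, Homeomorph.trans_apply, hp', hq']
    exact Eq.symm hpq
  · have := hX.compact
    have := hX.totallyDisconnected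
    exact GenericHomeo.liftingProperty_of_conj H hH
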